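/- Let $k\in 2\mathbb Z$, $m\in\mathbb Z_{\ge 0}$, and write $z=x+iy$ for points of the upper half-plane $\mathbb H$. For $\operatorname{Re} s>1-\frac k2$ let $$E_k(z,s)=\tfrac12\sum_{(a,b)\in\mathbb Z^2\setminus\{(0,0)\}}\frac{y^s}{|az+b|^{2s}(az+b)^k},$$ $$\widehat{\widehat E}_k(z,s)=\left(s+\tfrac k2\right)\left(s+\tfrac k2-1\right)\pi^{-s-\frac k2}\,\Gamma\!\left(s+\tfrac k2+\tfrac{|k|}2\right)E_k(z,s).$$ For each $z\in\mathbb H$ the function $s\mapsto\widehat{\widehat E}_k(z,s)$ extends to an entire function of $s$, denoted in the same way. For $s_0\in\mathbb C$ and $n\ge0$ let $\widehat{\widehat E}{}_k^{[n]}(z;s_0)=\frac{\partial^n}{\partial s^n}\widehat{\widehat E}_k(z,s)\big|_{s=s_0}$, viewed as a function of $z\in\mathbb H$. For $\lambda\in\mathbb C$ let $V_k^m(\lambda)$ be the space of smooth functions $f:\mathbb H\to\mathbb C$ such that $f\left(\frac{az+b}{cz+d}\right)=(cz+d)^kf(z)$ for all $\begin{pmatrix}a&b\\c&d\end{pmatrix}\in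 \mathrm{SL}(2,\mathbb Z)$, such that $f(z)=O(y^N)$ for some $N$ as $y\to\infty$, uniformly in $x$, and such that $(\Delta_k-\lambda)^mf=0$, where $$\Delta_k=y^2\left(\frac{\partial^2}{\partial x^2}+\frac{\partial^2}{\partial y^2}\right)-iky\left(\frac{\partial}{\partial x}+i\frac{\partial}{\partial y}\right).$$ Let $E_k^m(\lambda)$ be the complex vector space spanned by all functions $\widehat{\widehat E}{}_k^{[n]}(z;s_0)$ with $n\ge 0$, $s_0(s_0+k-1)=\lambda$ and $\widehat{\widehat E}{}_k^{[n]}(z;s_0)\in V_k^m(\lambda)$. Theorem. For every $\lambda\in\mathbb C$ the space $E_k^m(\lambda)$ has dimension exactly $m$, and for each $s_0$ with $\lambda=s_0(s_0+k-1)$ it is already spanned by those $\widehat{\widehat E}{}_k^{[n]}(z;s_0)$, $n\ge0$, at this one point that lie in $V_k^m(\lambda)$. Moreover: 1. If $\lambda\notin\left\{\frac k2\left(1-\frac k2\right),\,-\left(\frac{1-k}2\right)^2\right\}$, then there are exactly two $s_0$ with $\lambda=s_0(s_0+k-1)$. For each of them $\widehat{\widehat E}{}_k^{[0]}(z;s_0)\not\equiv0$,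 and a basis of $E_k^m(\lambda)$ is given by $\widehat{\widehat E}{}_k^{[n]}(z;s_0)$, $0\le n\le m-1$. 2. If $\lambda=\frac k2\left(1-\frac k2\right)$, then the solutions of $\lambda=s_0(s_0+k-1)$ are $s_0=-\frac k2$ and $s_0=1-\frac k2$. For each of them: if $k\ne0$, then $\widehat{\widehat E}{}_k^{[0]}(z;s_0)\equiv0$ and a basis of $E_k^m(\lambda)$ is given by $\widehat{\widehat E}{}_k^{[n]}(z;s_0)$, $1\le n\le m$; if $k=0$, then $\widehat{\widehat E}{}_k^{[0]}(z;s_0)\not\equiv0$ and a basis of $E_k^m(\lambda)$ is given by $\widehat{\widehat E}{}_k^{[n]}(z;s_0)$, $0\le n\le m-1$. 3. If $\lambda=-\left(\frac{1-k}2\right)^2$, then $s_0=\frac{1-k}2$ is the only solution of $\lambda=s_0(s_0+k-1)$, and a basis of $E_k^m(\lambda)$ is given by $\widehat{\widehat E}{}_k^{[2n]}(z;s_0)$, $0\le n\le m-1$. -/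

import Mathlib

open scoped UpperHalfPlane ContDiff

noncomputable section

/-- The non-holomorphic Eisenstein series
`E_k(z, s) = (1/2) ∑_{(m, n) ≠ (0, 0)} y ^ s / (|m z + n| ^ (2 s) (m z + n) ^ k)`,
as a series; it converges absolutely for `re s > 1 - k / 2`. -/
def eisensteinSum (k : ℤ) (z : ℍ) (s : ℂ) : ℂ :=
  (1 / 2) * ∑' p : {p : ℤ × ℤ // p ≠ (0, 0)},
    ((z.im : ℝ) : ℂ) ^ s /
      (((‖(p.1.1 : ℂ) * (z : ℂ) + (p.1.2 : ℂ)‖ : ℝ) : ℂ) ^ (2 * s) *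
        ((p.1.1 : ℂ) * (z : ℂ) + (p.1.2 : ℂ)) ^ k)

/-- The doubly-completed Eisenstein series in the region of absolute convergence:
`(s + k/2) (s + k/2 - 1) π ^ (-s - k/2) Γ(s + k/2 + |k|/2) E_k(z, s)`. -/
def doublyCompletedSum (k : ℤ) (z : ℍ) (s : ℂ) : ℂ :=
  (s + (k : ℂ) / 2) * (s + (k : ℂ) / 2 - 1) * ((Real.pi : ℝ) : ℂ) ^ (-s - (k : ℂ) / 2) *
    Complex.Gamma (s + (k : ℂ) / 2 + ((|k| : ℤ) : ℂ) / 2) * eisensteinSum k z s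

/-- `F` is an entire function of `s` that agrees with the doubly-completed Eisenstein series at `z`
in the half-plane `re s > 1 - k / 2`. -/
def IsEntireContinuation (k : ℤ) (z : ℍ) (F : ℂ → ℂ) : Prop :=
  Differentiable ℂ F ∧ ∀ s : ℂ, 1 - (k : ℝ) / 2 < s.re → F s = doublyCompletedSum k z s

open Classical in
/-- The doubly-completed Eisenstein series as a function of `s ∈ ℂ`, by analytic continuation:
the entire function agreeing with the series in its half-plane of absolute convergence. -/
def doublyCompletedEisenstein (k : ℤ) (z : ℍ) : ℂ → ℂ :=
  if h : ∃ F : ℂ → ℂ, IsEntireContinuation k z F then h.choose else 0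

/-- The entire continuation is unique. -/
theorem IsEntireContinuation.unique {k : ℤ} {z : ℍ} {F G : ℂ → ℂ}
    (hF : IsEntireContinuation k z F) (hG : IsEntireContinuation k z G) : F = G := by
  have hFa : AnalyticOnNhd ℂ F Set.univ := fun s _ => hF.1.analyticAt s
  have hGa : AnalyticOnNhd ℂ G Set.univ := fun s _ => hG.1.analyticAt s
  refine hFa.eq_of_eventuallyEq hGa (z₀ := ((2 - (k : ℝ) / 2 : ℝ) : ℂ)) ?_
  have ho : IsOpen {s : ℂ | 1 - (k : ℝ) / 2 < s.re} :=
    isOpen_lt continuous_const Complex.continuous_re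
  have hmem : ((2 - (k : ℝ) / 2 : ℝ) : ℂ) ∈ {s : ℂ | 1 - (k : ℝ) / 2 < s.re} := by
    simp only [Set.mem_ofPred_eq, Complex.ofReal_re]
    linarith
  filter_upwards [ho.mem_nhds hmem] with s hs
  rw [hF.2 s hs, hG.2 s hs]

/-- Any entire continuation is the doubly-completed Eisenstein series. -/
theorem IsEntireContinuation.eq_doublyCompletedEisenstein {k : ℤ} {z : ℍ} {F : ℂ → ℂ}
    (hF : IsEntireContinuation k z F) : doublyCompletedEisenstein k z = F := by
  have h : ∃ F : ℂ → ℂ, IsEntireContinuation k z F := ⟨F, hF⟩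
  rw [doublyCompletedEisenstein, dif_pos h]
  exact h.choose_spec.unique hF

/-- The Taylor coefficient function of index `n` at `s₀`: the function of `z` given by the
`n`-th derivative in `s` of the doubly-completed Eisenstein series, at `s = s₀`. -/
def taylorCoeff (k : ℤ) (n : ℕ) (s₀ : ℂ) : ℍ → ℂ :=
  fun z => iteratedDeriv n (doublyCompletedEisenstein k z) s₀

/-- The partial derivative `∂f/∂x` on the upper half-plane, `z = x + i y`. -/
def partialX (f : ℍ → ℂ) : ℍ → ℂ :=
  fun z => fderiv ℝ (fun w : ℂ => f (UpperHalfPlane.ofComplex w)) (z : ℂ) 1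

/-- The partial derivative `∂f/∂y` on the upper half-plane, `z = x + i y`. -/
def partialY (f : ℍ → ℂ) : ℍ → ℂ :=
  fun z => fderiv ℝ (fun w : ℂ => f (UpperHalfPlane.ofComplex w)) (z : ℂ) Complex.I

/-- The weight `k` hyperbolic Laplacian
`Δ_k = y² (∂²/∂x² + ∂²/∂y²) - i k y (∂/∂x + i ∂/∂y)`. -/
def hyperbolicLaplacian (k : ℤ) (f : ℍ → ℂ) : ℍ → ℂ :=
  fun z => ((z.im : ℝ) : ℂ) ^ 2 * (partialX (partialX f) z + partialY (partialY f) z)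
    - Complex.I * (k : ℂ) * ((z.im : ℝ) : ℂ) * (partialX f z + Complex.I * partialY f z)

/-- The operator `Δ_k - lam`. -/
def shiftedLaplacian (k : ℤ) (lam : ℂ) (f : ℍ → ℂ) : ℍ → ℂ :=
  fun z => hyperbolicLaplacian k f z - lam * f z

/-- `f` is a shifted polyharmonic Maass form of weight `k`, depth `m` and eigenvalue `lam`
for `PSL(2, ℤ)`. -/
structure IsShiftedPolyharmonicMaassForm (k : ℤ) (m : ℕ) (lam : ℂ) (f : ℍ → ℂ) : Prop where
  smooth : ContDiffOn ℝ ∞ (fun w : ℂ => f (UpperHalfPlane.ofComplex w)) {w : ℂ | 0 < w.im}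
  modular : ∀ (γ : Matrix.SpecialLinearGroup (Fin 2) ℤ) (z : ℍ),
    f (γ • z) = (((γ 1 0 : ℤ) : ℂ) * (z : ℂ) + ((γ 1 1 : ℤ) : ℂ)) ^ k * f z
  moderate_growth : ∃ N : ℕ,
    Asymptotics.IsBigO UpperHalfPlane.atImInfty f (fun z : ℍ => z.im ^ N)
  annihilated : (shiftedLaplacian k lam)^[m] f = 0

/-- The underlying set of the space `V_k^m(lam)` of shifted polyharmonic Maass forms. -/
def polyharmonicForms (k : ℤ) (m : ℕ) (lam : ℂ) : Set (ℍ → ℂ) :=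
  {f | IsShiftedPolyharmonicMaassForm k m lam f}

/-- The shifted `m`-harmonic Eisenstein space at `s₀`, spanned by those Taylor coefficient functions
at `s₀` that lie in `V_k^m(lam)`, where `lam = s₀ (s₀ + k - 1)`. -/
def eisensteinSpaceAt (k : ℤ) (m : ℕ) (s₀ : ℂ) : Submodule ℂ (ℍ → ℂ) :=
  Submodule.span ℂ {f | (∃ n : ℕ, f = taylorCoeff k n s₀) ∧
    f ∈ polyharmonicForms k m (s₀ * (s₀ + (k : ℂ) - 1))}

/-- The shifted `m`-harmonic Eisenstein space `E_k^m(lam)`, generated by all the Taylor coefficient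
functions in `V_k^m(lam)` at the points `s₀` with `s₀ (s₀ + k - 1) = lam`. -/
def eisensteinSpace (k : ℤ) (m : ℕ) (lam : ℂ) : Submodule ℂ (ℍ → ℂ) :=
  Submodule.span ℂ {f | (∃ (s₀ : ℂ) (n : ℕ), s₀ * (s₀ + (k : ℂ) - 1) = lam ∧
    f = taylorCoeff k n s₀) ∧ f ∈ polyharmonicForms k m lam}

/-- The family `v` is a basis of the subspace `W`. -/
def IsBasisOf {ι : Type*} (v : ι → ℍ → ℂ) (W : Submodule ℂ (ℍ → ℂ)) : Prop :=
  LinearIndependent ℂ v ∧ Submodule.span ℂ (Set.range v) = W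

end

open Complex Topology Filter Set MeasureTheory

noncomputable section

/-! Write `K = |k|`, `k₊ = max(k, 0)`, `σ = s + (k - 1) / 2` and `Q(z) = |az + b|² / y`. Since `(s +
k/2)(s + k/2 - 1) = σ² - 1/4`, the doubly-completed series is `(π^{K/2} / 2)(σ² - 1/4)` times the
Mellin transform at `s + k₊` of `θ(t) = ∑ (az + b)^{-k} Q^{k₊} exp(-πtQ)`, summed over nonzero `(a,
b)`. Poisson summation in `b` gives the inversion formula `t ↦ 1/t` in weight 0; Wirtinger
derivatives and complex conjugation carry it to all even weights (`thetaTail_inv`). Riemann's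
splitting of the Mellin integral at `t = 1` then gives the entire function `[k = 0]/2 + (π^{K/2} /
2)(σ² - 1/4) J(s)`, where `J(s)` is the integral over `t > 1` of `θ(t) (t^{s + k₊ - 1} + t^{K - s -
k₊})`. It is invariant under `s ↦ 1 - k - s`, that is `σ ↦ -σ`, and its `s`-derivatives `F_n` are
explicit (`completedDeriv`).

On a single lattice term `Δ_k` acts as an ordinary differential operator in `Q`. Two integrations by
parts yield `(Δ_k - s(s + k - 1)) J = [k = 0]`; the boundary terms at `t = 1` are evaluated by
differentiating the inversion formula there. Hence `Δ_k F_0 = s(s + k - 1) F_0`, and the `n`-fold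
`s`-derivative of this relation is `(Δ_k - λ) F_n = 2nσ F_{n-1} + n(n - 1) F_{n-2}`
(`laplace_completedDeriv`).

The rest of the structure is linear algebra. All `F_n` are smooth, modular and of moderate growth,
so membership in `V_k^m(λ)` only means annihilation by `(Δ_k - λ)^m`. If `σ ≠ 0` and `F_0 ≠ 0`, then
`(Δ_k - λ)^n F_n` is a nonzero multiple of `F_0`, so the `F_n` form a Jordan chain. If `σ² = 1/4`
and `k ≠ 0`, then `F_0 = 0` and the chain starts at `F_1`, a nonzero multiple of `J`. If `σ = 0`,
the functional equation kills the odd `F_n`, and the recursion links the even ones. The solutions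
`s` and `1 - k - s` of `λ = s(s + k - 1)` give the same functions up to sign.

The analytic input left is that the head of each chain is nonzero, which follows once `J` is not a
constant (`not_symMellin_const'`). If it were, zero unless `k = 0`, then on `z = iy` the terms with
`a = 0` would form a bounded function for large `y`, because the other terms decay rapidly. Its
Mellin transform would then stay bounded near the point `w = σ + (K + 1)/2`. But that transform
contains `ζ(2w - K)(1/(w - s - k₊) + 1/(w + s + k₊ - K - 1))`, which blows up there because `ζ` has
no zeros on `Re ≥ 1`; one may take `Re σ ≥ 0` by the functional equation. -/

namespace MaassEisenstein

/-! ### Termwise differentiation of series of smooth functions on the upper half-plane -/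

/-- The upper half-plane as a subset of `ℂ`. -/
abbrev halfPlane : Set ℂ := {w : ℂ | 0 < w.im}

theorem isOpen_halfPlane : IsOpen halfPlane := isOpen_lt continuous_const Complex.continuous_im

theorem halfPlane_mem_nhds {w : ℂ} (hw : w ∈ halfPlane) : halfPlane ∈ 𝓝 w :=
  isOpen_halfPlane.mem_nhds hw

/-- The partial derivative in the real direction. -/
def dX (f : ℂ → ℂ) (w : ℂ) : ℂ := fderiv ℝ f w 1

/-- The partial derivative in the imaginary direction. -/
def dY (f : ℂ → ℂ) (w : ℂ) : ℂ := fderiv ℝ f w I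

/-- The real-linear map with value `α` at `1` and `β` at `I`. -/
def gradMap (α β : ℂ) : ℂ →L[ℝ] ℂ := reCLM.smulRight α + imCLM.smulRight β

@[simp] theorem gradMap_apply (α β v : ℂ) : gradMap α β v = v.re * α + v.im * β := by
  simp [gradMap]

theorem eq_gradMap (L : ℂ →L[ℝ] ℂ) : L = gradMap (L 1) (L I) := by
  ext v
  have : v = v.re • (1 : ℂ) + v.im • I := by simp [Complex.re_add_im]
  conv_lhs => rw [this]
  rw [map_add, map_smul, map_smul]
  simp

theorem norm_gradMap_le (α β : ℂ) : ‖gradMap α β‖ ≤ ‖α‖ + ‖β‖ := by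
  refine ContinuousLinearMap.opNorm_le_bound _ (by positivity) fun v => ?_
  rw [gradMap_apply]
  refine (norm_add_le _ _).trans ?_
  rw [norm_mul, norm_mul, norm_real, norm_real, add_mul]
  have h1 := Complex.abs_re_le_norm v
  have h2 := Complex.abs_im_le_norm v
  rw [mul_comm ‖α‖, mul_comm ‖β‖]
  gcongr <;> simpa

/-- `f` has partial derivatives `α` and `β` at `w`, and is differentiable there. -/
def HasGrad (f : ℂ → ℂ) (w α β : ℂ) : Prop := HasFDerivAt f (gradMap α β) w

theorem HasGrad.dX {f : ℂ → ℂ} {w α β : ℂ} (h : HasGrad f w α β) : dX f w = α := by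
  rw [MaassEisenstein.dX, HasFDerivAt.fderiv h]; simp

theorem HasGrad.dY {f : ℂ → ℂ} {w α β : ℂ} (h : HasGrad f w α β) : dY f w = β := by
  rw [MaassEisenstein.dY, HasFDerivAt.fderiv h]; simp

theorem _root_.DifferentiableAt.hasGrad {f : ℂ → ℂ} {w : ℂ} (h : DifferentiableAt ℝ f w) :
    HasGrad f w (MaassEisenstein.dX f w) (MaassEisenstein.dY f w) := by
  have := h.hasFDerivAt
  rw [eq_gradMap (fderiv ℝ f w)] at this
  exact this

theorem HasGrad.differentiableAt {f : ℂ → ℂ} {w α β : ℂ} (h : HasGrad f w α β) :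
    DifferentiableAt ℝ f w := HasFDerivAt.differentiableAt h

theorem HasGrad.congr {f : ℂ → ℂ} {w α β α' β' : ℂ} (h : HasGrad f w α β) (h1 : α = α')
    (h2 : β = β') : HasGrad f w α' β' := h1 ▸ h2 ▸ h

theorem HasGrad.congr_eventuallyEq {f g : ℂ → ℂ} {w α β : ℂ} (h : HasGrad f w α β)
    (hfg : g =ᶠ[𝓝 w] f) : HasGrad g w α β := HasFDerivAt.congr_of_eventuallyEq h hfg

theorem HasGrad.add {f g : ℂ → ℂ} {w α β γ δ : ℂ} (hf : HasGrad f w α β) (hg : HasGrad g w γ δ) :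
    HasGrad (fun z => f z + g z) w (α + γ) (β + δ) := by
  refine (HasFDerivAt.add hf hg).congr_fderiv ?_
  ext v; simp; ring

theorem HasGrad.sub {f g : ℂ → ℂ} {w α β γ δ : ℂ} (hf : HasGrad f w α β) (hg : HasGrad g w γ δ) :
    HasGrad (fun z => f z - g z) w (α - γ) (β - δ) := by
  refine (HasFDerivAt.sub hf hg).congr_fderiv ?_
  ext v; simp; ring

theorem HasGrad.mul {f g : ℂ → ℂ} {w α β γ δ : ℂ} (hf : HasGrad f w α β) (hg : HasGrad g w γ δ) :
    HasGrad (fun z => f z * g z) w (f w * γ + g w * α) (f w * δ + g w * β) := by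
  refine (HasFDerivAt.mul hf hg).congr_fderiv ?_
  ext v; simp; ring

theorem hasGrad_const (c w : ℂ) : HasGrad (fun _ => c) w 0 0 := by
  refine (hasFDerivAt_const c w).congr_fderiv ?_
  ext v; simp

theorem HasGrad.const_mul {f : ℂ → ℂ} {w α β : ℂ} (c : ℂ) (hf : HasGrad f w α β) :
    HasGrad (fun z => c * f z) w (c * α) (c * β) :=
  ((hasGrad_const c w).mul hf).congr (by ring) (by ring)

/-- Chain rule with a complex derivative of the outer function. -/
theorem HasGrad.comp_hasDerivAt {f g : ℂ → ℂ} {w α β g' : ℂ} (hg : HasDerivAt g g' (f w))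
    (hf : HasGrad f w α β) : HasGrad (fun z => g (f z)) w (g' * α) (g' * β) := by
  have := (hg.hasFDerivAt.restrictScalars ℝ).comp w hf
  refine this.congr_fderiv ?_
  ext v; simp; ring

/-- Chain rule with an outer function of a real variable. -/
theorem HasGrad.comp_real {g : ℝ → ℂ} {f : ℂ → ℝ} {w α β g' : ℂ} (hg : HasDerivAt g g' (f w))
    (hf : HasGrad (fun z => (f z : ℂ)) w α β) :
    HasGrad (fun z => g (f z)) w (g' * α) (g' * β) := by
  have hf' : HasFDerivAt f (reCLM.comp (gradMap α β)) w := by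
    have := (reCLM.hasFDerivAt (x := (f w : ℂ))).comp w hf
    refine this.congr_of_eventuallyEq (Eventually.of_forall fun z => ?_)
    simp
  -- The inner function is real-valued, so its gradient has no imaginary part and its real part can
  -- be identified with the complex gradient.
  have him : imCLM.comp (gradMap α β) = 0 := by
    have := (imCLM.hasFDerivAt (x := (f w : ℂ))).comp w hf
    refine HasFDerivAt.unique this ?_
    refine (hasFDerivAt_const (0 : ℝ) w).congr_of_eventuallyEq (Eventually.of_forall fun z => ?_)
    simp
  have hre : ∀ v, (((gradMap α β v).re : ℝ) : ℂ) = gradMap α β v := by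
    intro v
    have := DFunLike.congr_fun him v
    apply Complex.ext
    · simp
    · simpa using this.symm
  have := hg.hasFDerivAt.comp w hf'
  refine this.congr_fderiv ?_
  ext v
  have h2 := hre v
  simp only [ContinuousLinearMap.comp_apply, reCLM_apply, ContinuousLinearMap.toSpanSingleton_apply,
    real_smul]
  rw [h2]; simp; ring

theorem hasGrad_id (w : ℂ) : HasGrad (fun z => z) w 1 I := by
  refine (hasFDerivAt_id w).congr_fderiv ?_
  ext v; simp [Complex.re_add_im]

theorem hasGrad_conj (w : ℂ) : HasGrad (fun z => (starRingEnd ℂ) z) w 1 (-I) := by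
  refine (conjCLE.hasFDerivAt (x := w)).congr_fderiv ?_
  ext v
  apply Complex.ext <;> simp

theorem hasGrad_im (w : ℂ) : HasGrad (fun z => (z.im : ℂ)) w 0 1 := by
  refine ((ofRealCLM.hasFDerivAt).comp w imCLM.hasFDerivAt).congr_fderiv ?_
  ext v; simp

theorem contDiffOn_dX {f : ℂ → ℂ} (hf : ContDiffOn ℝ ∞ f halfPlane) :
    ContDiffOn ℝ ∞ (dX f) halfPlane :=
  (hf.fderiv_of_isOpen isOpen_halfPlane (by simp)).clm_apply contDiffOn_const

theorem contDiffOn_dY {f : ℂ → ℂ} (hf : ContDiffOn ℝ ∞ f halfPlane) :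
    ContDiffOn ℝ ∞ (dY f) halfPlane :=
  (hf.fderiv_of_isOpen isOpen_halfPlane (by simp)).clm_apply contDiffOn_const

theorem _root_.ContDiffOn.differentiableAt_halfPlane {f : ℂ → ℂ}
    (hf : ContDiffOn ℝ ∞ f halfPlane) {w : ℂ} (hw : w ∈ halfPlane) : DifferentiableAt ℝ f w :=
  (hf.differentiableOn (by simp)).differentiableAt (halfPlane_mem_nhds hw)

theorem _root_.Set.EqOn.dX_eq {f g : ℂ → ℂ} (h : EqOn f g halfPlane) :
    EqOn (MaassEisenstein.dX f) (MaassEisenstein.dX g) halfPlane := fun w hw => by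
  have : f =ᶠ[𝓝 w] g := by filter_upwards [halfPlane_mem_nhds hw] with z hz using h hz
  rw [MaassEisenstein.dX, MaassEisenstein.dX, this.fderiv_eq]

theorem _root_.Set.EqOn.dY_eq {f g : ℂ → ℂ} (h : EqOn f g halfPlane) :
    EqOn (MaassEisenstein.dY f) (MaassEisenstein.dY g) halfPlane := fun w hw => by
  have : f =ᶠ[𝓝 w] g := by filter_upwards [halfPlane_mem_nhds hw] with z hz using h hz
  rw [MaassEisenstein.dY, MaassEisenstein.dY, this.fderiv_eq]

variable {ι : Type*}

/-- The family is summable, with a locally uniform summable bound on the upper half-plane. -/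
def LocallySummable (u : ι → ℂ → ℂ) : Prop :=
  ∀ w ∈ halfPlane, ∃ B : ι → ℝ, Summable B ∧ ∀ᶠ z in 𝓝 w, ∀ i, ‖u i z‖ ≤ B i

/-- A family of smooth functions whose partial derivatives up to order `n` are summable with
locally uniform bounds. -/
def TermwiseSmooth : ℕ → (ι → ℂ → ℂ) → Prop
  | 0, u => (∀ i, ContDiffOn ℝ ∞ (u i) halfPlane) ∧ LocallySummable u
  | n + 1, u => ((∀ i, ContDiffOn ℝ ∞ (u i) halfPlane) ∧ LocallySummable u) ∧
      TermwiseSmooth n (fun i => dX (u i)) ∧ TermwiseSmooth n (fun i => dY (u i))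

theorem TermwiseSmooth.locallySummable {n : ℕ} {u : ι → ℂ → ℂ} (h : TermwiseSmooth n u) :
    LocallySummable u := by
  cases n
  · exact h.2
  · exact h.1.2

theorem LocallySummable.summable {u : ι → ℂ → ℂ} (h : LocallySummable u) {w : ℂ}
    (hw : w ∈ halfPlane) : Summable (fun i => u i w) := by
  obtain ⟨B, hB, hb⟩ := h w hw
  exact Summable.of_norm_bounded hB (fun i => hb.self_of_nhds i)

theorem LocallySummable.add {u v : ι → ℂ → ℂ} (hu : LocallySummable u) (hv : LocallySummable v) :
    LocallySummable (fun i z => u i z + v i z) := fun w hw => by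
  obtain ⟨B, hB, hb⟩ := hu w hw
  obtain ⟨C, hC, hc⟩ := hv w hw
  refine ⟨fun i => B i + C i, hB.add hC, ?_⟩
  filter_upwards [hb, hc] with z h1 h2 i
  exact (norm_add_le _ _).trans (add_le_add (h1 i) (h2 i))

theorem LocallySummable.congr {u v : ι → ℂ → ℂ} (hu : LocallySummable u)
    (h : ∀ i, EqOn (u i) (v i) halfPlane) : LocallySummable v := fun w hw => by
  obtain ⟨B, hB, hb⟩ := hu w hw
  refine ⟨B, hB, ?_⟩
  filter_upwards [hb, halfPlane_mem_nhds hw] with z h1 hz i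
  rw [← h i hz]; exact h1 i

theorem TermwiseSmooth.congr {n : ℕ} : ∀ {u v : ι → ℂ → ℂ}, TermwiseSmooth n u →
    (∀ i, EqOn (u i) (v i) halfPlane) → TermwiseSmooth n v := by
  induction n with
  | zero => exact fun hu h => ⟨fun i => (hu.1 i).congr fun z hz => (h i hz).symm, hu.2.congr h⟩
  | succ n ih =>
    exact fun hu h => ⟨⟨fun i => (hu.1.1 i).congr fun z hz => (h i hz).symm, hu.1.2.congr h⟩,
      ih hu.2.1 fun i => (h i).dX_eq, ih hu.2.2 fun i => (h i).dY_eq⟩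

theorem TermwiseSmooth.add {n : ℕ} : ∀ {u v : ι → ℂ → ℂ}, TermwiseSmooth n u →
    TermwiseSmooth n v → TermwiseSmooth n (fun i z => u i z + v i z) := by
  induction n with
  | zero => exact fun hu hv => ⟨fun i => (hu.1 i).add (hv.1 i), hu.2.add hv.2⟩
  | succ n ih =>
    intro u v hu hv
    refine ⟨⟨fun i => (hu.1.1 i).add (hv.1.1 i), hu.1.2.add hv.1.2⟩, ?_, ?_⟩
    · refine (ih hu.2.1 hv.2.1).congr fun i w hw => ?_
      exact (((hu.1.1 i).differentiableAt_halfPlane hw).hasGrad.add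
        ((hv.1.1 i).differentiableAt_halfPlane hw).hasGrad).dX.symm
    · refine (ih hu.2.2 hv.2.2).congr fun i w hw => ?_
      exact (((hu.1.1 i).differentiableAt_halfPlane hw).hasGrad.add
        ((hv.1.1 i).differentiableAt_halfPlane hw).hasGrad).dY.symm

/-- Near `w` the bounds hold on a whole ball, which is connected, so the theorem on termwise
differentiation applies with the sum of the two bounds. -/
theorem TermwiseSmooth.hasGrad_tsum {n : ℕ} {u : ι → ℂ → ℂ} (hu : TermwiseSmooth (n + 1) u)
    {w : ℂ} (hw : w ∈ halfPlane) :
    HasGrad (fun z => ∑' i, u i z) w (∑' i, dX (u i) w) (∑' i, dY (u i) w) := by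
  obtain ⟨B, hB, hb⟩ := hu.2.1.locallySummable w hw
  obtain ⟨C, hC, hc⟩ := hu.2.2.locallySummable w hw
  obtain ⟨ε, hε, hball⟩ := Metric.eventually_nhds_iff_ball.1
    ((hb.and hc).and (halfPlane_mem_nhds hw))
  have hw' : w ∈ Metric.ball w ε := Metric.mem_ball_self hε
  have key := hasFDerivAt_tsum_of_isPreconnected (𝕜 := ℝ) (f := u)
    (f' := fun i z => gradMap (dX (u i) z) (dY (u i) z)) (u := fun i => B i + C i)
    (hB.add hC) Metric.isOpen_ball (convex_ball w ε).isPreconnected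
    (fun i z hz => ((hu.1.1 i).differentiableAt_halfPlane (hball z hz).2).hasGrad)
    (fun i z hz => (norm_gradMap_le _ _).trans
      (add_le_add ((hball z hz).1.1 i) ((hball z hz).1.2 i))) hw' (hu.1.2.summable hw) hw'
  refine key.congr_fderiv ?_
  have hsum : Summable (fun i => gradMap (dX (u i) w) (dY (u i) w)) :=
    Summable.of_norm_bounded (hB.add hC) fun i => (norm_gradMap_le _ _).trans
      (add_le_add ((hball w hw').1.1 i) ((hball w hw').1.2 i))
  rw [eq_gradMap (∑' i, gradMap (dX (u i) w) (dY (u i) w))]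
  congr 1
  · rw [← ContinuousLinearMap.apply_apply (𝕜 := ℝ) (1 : ℂ) (∑' i, _),
      ContinuousLinearMap.map_tsum _ hsum]
    simp
  · rw [← ContinuousLinearMap.apply_apply (𝕜 := ℝ) I (∑' i, _),
      ContinuousLinearMap.map_tsum _ hsum]
    simp

/-- One order is lost because at the bottom continuity is read off from differentiability. -/
theorem TermwiseSmooth.contDiffOn_tsum {n : ℕ} : ∀ {u : ι → ℂ → ℂ}, TermwiseSmooth (n + 1) u →
    ContDiffOn ℝ n (fun z => ∑' i, u i z) halfPlane := by
  induction n with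
  | zero =>
    intro u hu
    simp only [Nat.cast_zero, contDiffOn_zero]
    exact fun w hw => (hu.hasGrad_tsum hw).differentiableAt.continuousAt.continuousWithinAt
  | succ n ih =>
    intro u hu
    rw [Nat.cast_add, Nat.cast_one, contDiffOn_succ_iff_fderiv_of_isOpen isOpen_halfPlane]
    refine ⟨fun w hw => (hu.hasGrad_tsum hw).differentiableAt.differentiableWithinAt, by simp, ?_⟩
    have : ContDiffOn ℝ n (fun z => reCLM.smulRight (∑' i, dX (u i) z) +
        imCLM.smulRight (∑' i, dY (u i) z)) halfPlane :=
      (contDiffOn_const.smulRight (ih hu.2.1)).add (contDiffOn_const.smulRight (ih hu.2.2))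
    exact this.congr fun w hw => HasFDerivAt.fderiv (hu.hasGrad_tsum hw)

theorem contDiffOn_tsum {u : ι → ℂ → ℂ} (hu : ∀ n, TermwiseSmooth n u) :
    ContDiffOn ℝ ∞ (fun z => ∑' i, u i z) halfPlane :=
  contDiffOn_infty.2 fun n => (hu (n + 1)).contDiffOn_tsum

/-! ### Lattice sums of rapidly decaying functions of a binary quadratic form -/

/-- The nonzero integral vectors. -/
abbrev Pairs := {p : ℤ × ℤ // p ≠ (0, 0)}

/-- The linear form `a w + b`. -/
def lin (v : ℤ × ℤ) (w : ℂ) : ℂ := v.1 * w + v.2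

/-- The conjugate linear form `a w̄ + b`. -/
def linConj (v : ℤ × ℤ) (w : ℂ) : ℂ := v.1 * (starRingEnd ℂ) w + v.2

/-- The quadratic form `|a w + b|² / im w`. -/
def quad (v : ℤ × ℤ) (w : ℂ) : ℝ := ‖lin v w‖ ^ 2 / w.im

/-- The maximum norm on integral vectors. -/
def size (v : ℤ × ℤ) : ℝ := max |(v.1 : ℝ)| |(v.2 : ℝ)|

theorem conj_lin (v : ℤ × ℤ) (w : ℂ) : (starRingEnd ℂ) (lin v w) = linConj v w := by
  simp [lin, linConj]

theorem norm_linConj (v : ℤ × ℤ) (w : ℂ) : ‖linConj v w‖ = ‖lin v w‖ := by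
  rw [← conj_lin, norm_conj]

theorem lin_mul_linConj (v : ℤ × ℤ) (w : ℂ) :
    lin v w * linConj v w = ((‖lin v w‖ ^ 2 : ℝ) : ℂ) := by
  rw [← conj_lin, mul_conj, normSq_eq_norm_sq]

theorem ofReal_quad (v : ℤ × ℤ) (w : ℂ) :
    ((quad v w : ℝ) : ℂ) = lin v w * linConj v w / (w.im : ℂ) := by
  rw [lin_mul_linConj, quad]; push_cast; rfl

theorem linConj_eq (v : ℤ × ℤ) (w : ℂ) : linConj v w = lin v w - 2 * I * v.1 * w.im := by
  have : (starRingEnd ℂ) w = w - 2 * I * w.im := by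
    apply Complex.ext <;> simp; ring
  rw [linConj, lin, this]; ring

theorem one_le_size (v : Pairs) : 1 ≤ size v.1 := by
  obtain ⟨⟨a, b⟩, h⟩ := v
  simp only [size]
  by_cases ha : a = 0
  · have hb : b ≠ 0 := fun hb => h (by simp [ha, hb])
    exact le_max_of_le_right (by exact_mod_cast Int.one_le_abs hb)
  · exact le_max_of_le_left (by exact_mod_cast Int.one_le_abs ha)

theorem size_pos (v : Pairs) : 0 < size v.1 := zero_lt_one.trans_le (one_le_size v)

theorem size_eq_norm (v : ℤ × ℤ) : size v = ‖![v.1, v.2]‖ := by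
  rw [EisensteinSeries.norm_eq_max_natAbs, size]
  simp [Nat.cast_natAbs]

theorem summable_size_pow {n : ℕ} (hn : 3 ≤ n) : Summable fun v : Pairs => (size v.1 ^ n)⁻¹ := by
  have h := EisensteinSeries.summable_one_div_norm_rpow (k := n) (by
    have : (3 : ℝ) ≤ n := by exact_mod_cast hn
    linarith)
  have h2 := h.comp_injective (i := fun v : Pairs => ![v.1.1, v.1.2]) (by
    rintro ⟨⟨a, b⟩, h⟩ ⟨⟨c, d⟩, h'⟩ hab
    have h0 := congrFun hab 0
    have h1 := congrFun hab 1
    simp at h0 h1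
    simp [h0, h1])
  refine h2.congr fun v => ?_
  simp only [Function.comp_apply]
  rw [size_eq_norm, Real.rpow_neg (norm_nonneg _), Real.rpow_natCast]

/-- Uniformity on the strip serves twice: for locally uniform convergence and for the growth
estimate at the cusp. -/
theorem exists_mul_size_le_norm_lin (A : ℝ) {B : ℝ} (hB : 0 < B) :
    ∃ r > 0, ∀ w : ℂ, |w.re| ≤ A → B ≤ w.im → ∀ v : Pairs, r * size v.1 ≤ ‖lin v.1 w‖ := by
  refine ⟨EisensteinSeries.r ⟨⟨A, B⟩, hB⟩, EisensteinSeries.r_pos _, fun w h1 h2 v => ?_⟩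
  have hw : 0 < w.im := hB.trans_le h2
  have hv : ![v.1.1, v.1.2] ≠ 0 := fun h => v.2 (by
    have h0 := congrFun h 0
    have h1 := congrFun h 1
    simp at h0 h1
    ext <;> simp [h0, h1])
  have key := EisensteinSeries.r_mul_max_le ⟨w, hw⟩ hv
  have hs := EisensteinSeries.r_lower_bound_on_verticalStrip ⟨w, hw⟩ hB
    (A := A) ⟨by simpa using h1, by simpa using h2⟩
  rw [size_eq_norm]
  refine (mul_le_mul_of_nonneg_right hs (norm_nonneg _)).trans (key.trans (le_of_eq ?_))
  simp [lin]

theorem norm_lin_pos (v : Pairs) {w : ℂ} (hw : w ∈ halfPlane) : 0 < ‖lin v.1 w‖ := by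
  obtain ⟨r, hr, h⟩ := exists_mul_size_le_norm_lin |w.re| (B := w.im) hw
  exact (mul_pos hr (size_pos v)).trans_le (h w le_rfl le_rfl v)

theorem lin_ne_zero (v : Pairs) {w : ℂ} (hw : w ∈ halfPlane) : lin v.1 w ≠ 0 :=
  norm_pos_iff.1 (norm_lin_pos v hw)

theorem quad_pos (v : Pairs) {w : ℂ} (hw : w ∈ halfPlane) : 0 < quad v.1 w :=
  div_pos (pow_pos (norm_lin_pos v hw) 2) hw

theorem abs_fst_le_size (v : ℤ × ℤ) : |(v.1 : ℝ)| ≤ size v := le_max_left _ _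

/-- A function on `(0, ∞)` with its successive derivatives, each of them dominated by all large
inverse powers. -/
structure IsKernel (φ : ℕ → ℝ → ℂ) : Prop where
  hasDerivAt : ∀ l q, 0 < q → HasDerivAt (φ l) (φ (l + 1) q) q
  bound : ∀ l, ∃ N₀ : ℕ, ∀ N ≥ N₀, ∃ C, 0 ≤ C ∧ ∀ q > 0, ‖φ l q‖ ≤ C / q ^ N

theorem IsKernel.contDiffOn {φ : ℕ → ℝ → ℂ} (hφ : IsKernel φ) (l : ℕ) :
    ContDiffOn ℝ ∞ (φ l) (Ioi 0) := by
  refine contDiffOn_infty.2 fun n => ?_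
  induction n generalizing l with
  | zero =>
    simp only [Nat.cast_zero, contDiffOn_zero]
    exact fun q hq => (hφ.hasDerivAt l q hq).continuousAt.continuousWithinAt
  | succ n ih =>
    rw [Nat.cast_add, Nat.cast_one, contDiffOn_succ_iff_deriv_of_isOpen isOpen_Ioi]
    refine ⟨fun q hq => (hφ.hasDerivAt l q hq).differentiableAt.differentiableWithinAt, by simp, ?_⟩
    exact (ih (l + 1)).congr fun q hq => (hφ.hasDerivAt l q hq).deriv

/-- The general term of the lattice sums. -/
def latticeTerm (φ : ℕ → ℝ → ℂ) (d : ℕ) (f : ℂ → ℂ) (i j l : ℕ) (v : Pairs) (w : ℂ) : ℂ :=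
  (v.1.1 : ℂ) ^ d * f w * lin v.1 w ^ i * linConj v.1 w ^ j * φ l (quad v.1 w)

theorem IsKernel.exists_term_bound {φ : ℕ → ℝ → ℂ} (hφ : IsKernel φ) (d i j l : ℕ) (A : ℝ)
    {B : ℝ} (hB : 0 < B) : ∃ (N : ℕ) (C : ℝ), 0 ≤ C ∧ ∀ w : ℂ, |w.re| ≤ A → B ≤ w.im →
      ∀ v : Pairs, ‖(v.1.1 : ℂ) ^ d * lin v.1 w ^ i * linConj v.1 w ^ j * φ l (quad v.1 w)‖ ≤
        C * w.im ^ N * (size v.1 ^ 3)⁻¹ := by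
  obtain ⟨r, hr, hlow⟩ := exists_mul_size_le_norm_lin A hB
  obtain ⟨N₀, hN⟩ := hφ.bound l
  -- Decay of order `M` in `quad` leaves `im ^ M / ‖lin‖ ^ e` with `e = 2M - i - j`. This `M` makes
  -- `e ≥ d + 3`, which absorbs the factor `|a| ^ d` and leaves a summable inverse cube.
  set M := N₀ + d + 3 + i + j with hM
  obtain ⟨C, hC, hb⟩ := hN M (by omega)
  set e := 2 * M - i - j with he
  have he2 : i + j + e = 2 * M := by omega
  refine ⟨M, C / r ^ e, by positivity, fun w h1 h2 v => ?_⟩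
  have hw : w ∈ halfPlane := hB.trans_le h2
  have hwim : 0 < w.im := hw
  have hL := norm_lin_pos v hw
  have hs := size_pos v
  have hs1 := one_le_size v
  rw [norm_mul, norm_mul, norm_mul, norm_pow, norm_pow, norm_pow, norm_linConj, norm_intCast]
  have hq := hb _ (quad_pos v hw)
  have ha : |(v.1.1 : ℝ)| ^ d ≤ size v.1 ^ d := by gcongr; exact abs_fst_le_size _
  calc |(v.1.1 : ℝ)| ^ d * ‖lin v.1 w‖ ^ i * ‖lin v.1 w‖ ^ j * ‖φ l (quad v.1 w)‖
      ≤ size v.1 ^ d * ‖lin v.1 w‖ ^ i * ‖lin v.1 w‖ ^ j * (C / quad v.1 w ^ M) := by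
        gcongr
    _ = C * w.im ^ M * (size v.1 ^ d * (‖lin v.1 w‖ ^ e)⁻¹) := by
        rw [quad, div_pow, ← pow_mul, ← he2, pow_add, pow_add]
        field_simp
    _ ≤ C * w.im ^ M * (size v.1 ^ d * ((r * size v.1) ^ e)⁻¹) := by
        gcongr
        exact hlow w h1 h2 v
    _ = C / r ^ e * w.im ^ M * (size v.1 ^ d * (size v.1 ^ e)⁻¹) := by
        rw [mul_pow]; field_simp
    _ ≤ C / r ^ e * w.im ^ M * (size v.1 ^ 3)⁻¹ := by
        gcongr
        rw [← div_eq_mul_inv, div_le_iff₀ (by positivity), inv_mul_eq_div, le_div_iff₀ (by positivity),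
          ← pow_add]
        exact pow_le_pow_right₀ hs1 (by omega)

theorem hasGrad_lin (v : ℤ × ℤ) (w : ℂ) : HasGrad (lin v) w v.1 (I * v.1) :=
  (((hasGrad_id w).const_mul (v.1 : ℂ)).add (hasGrad_const v.2 w)).congr (by ring) (by ring)

theorem hasGrad_linConj (v : ℤ × ℤ) (w : ℂ) : HasGrad (linConj v) w v.1 (-(I * v.1)) :=
  (((hasGrad_conj w).const_mul (v.1 : ℂ)).add (hasGrad_const v.2 w)).congr (by ring) (by ring)

theorem HasGrad.pow {f : ℂ → ℂ} {w α β : ℂ} (hf : HasGrad f w α β) (n : ℕ) :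
    HasGrad (fun z => f z ^ n) w (n * f w ^ (n - 1) * α) (n * f w ^ (n - 1) * β) :=
  HasGrad.comp_hasDerivAt (hasDerivAt_pow n (f w)) hf

theorem HasGrad.inv {f : ℂ → ℂ} {w α β : ℂ} (hf : HasGrad f w α β) (h : f w ≠ 0) :
    HasGrad (fun z => (f z)⁻¹) w (-(f w ^ 2)⁻¹ * α) (-(f w ^ 2)⁻¹ * β) :=
  HasGrad.comp_hasDerivAt (hasDerivAt_inv h) hf

theorem HasGrad.zpow {f : ℂ → ℂ} {w α β : ℂ} (hf : HasGrad f w α β) (h : f w ≠ 0) (n : ℤ) :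
    HasGrad (fun z => f z ^ n) w (n * f w ^ (n - 1) * α) (n * f w ^ (n - 1) * β) :=
  HasGrad.comp_hasDerivAt (hasDerivAt_zpow n (f w) (Or.inl h)) hf

theorem im_ne_zero {w : ℂ} (hw : w ∈ halfPlane) : (w.im : ℂ) ≠ 0 :=
  ofReal_ne_zero.2 (ne_of_gt hw)

theorem hasGrad_quad (v : ℤ × ℤ) {w : ℂ} (hw : w ∈ halfPlane) :
    HasGrad (fun z => ((quad v z : ℝ) : ℂ)) w
      (v.1 * (lin v w + linConj v w) / w.im)
      (I * v.1 * (linConj v w - lin v w) / w.im - lin v w * linConj v w / w.im ^ 2) := by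
  have h := ((hasGrad_lin v w).mul (hasGrad_linConj v w)).mul
    ((hasGrad_im w).inv (im_ne_zero hw))
  have him := im_ne_zero hw
  refine (h.congr_eventuallyEq (Eventually.of_forall fun z => ?_)).congr ?_ ?_
  · simp only [ofReal_quad, div_eq_mul_inv]
  · field_simp; ring
  · field_simp; ring

theorem contDiffOn_im : ContDiffOn ℝ ∞ (fun w : ℂ => (w.im : ℂ)) halfPlane :=
  (ofRealCLM.contDiff.comp imCLM.contDiff).contDiffOn

theorem contDiffOn_im_inv : ContDiffOn ℝ ∞ (fun w : ℂ => (w.im : ℂ)⁻¹) halfPlane :=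
  contDiffOn_im.inv fun _ hw => im_ne_zero hw

theorem contDiff_lin (v : ℤ × ℤ) : ContDiff ℝ ∞ (lin v) := by
  unfold lin; fun_prop

theorem contDiff_linConj (v : ℤ × ℤ) : ContDiff ℝ ∞ (linConj v) :=
  (contDiff_const.mul conjCLE.contDiff).add contDiff_const

theorem contDiffOn_quad (v : ℤ × ℤ) : ContDiffOn ℝ ∞ (quad v) halfPlane := by
  have h : ContDiffOn ℝ ∞ (fun w => lin v w * linConj v w * (w.im : ℂ)⁻¹) halfPlane :=
    (((contDiff_lin v).mul (contDiff_linConj v)).contDiffOn).mul contDiffOn_im_inv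
  refine (reCLM.contDiff.comp_contDiffOn h).congr fun w _ => ?_
  rw [Function.comp_apply, ← div_eq_mul_inv, ← ofReal_quad]
  simp

variable {φ : ℕ → ℝ → ℂ}

/-- The summands are grouped so that each is again a `latticeTerm`: the family is closed under both
partial derivatives. The truncated exponents `i - 1` and `j - 1` are harmless because of the factors
`i` and `j`. -/
theorem hasGrad_latticeTerm (hφ : IsKernel φ) (d : ℕ) {f : ℂ → ℂ} (i j l : ℕ) (v : Pairs) {w : ℂ}
    (hw : w ∈ halfPlane) {α β : ℂ} (hf : HasGrad f w α β) :
    HasGrad (latticeTerm φ d f i j l v) w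
      (v.1.1 ^ d * α * lin v.1 w ^ i * linConj v.1 w ^ j * φ l (quad v.1 w)
        + v.1.1 ^ (d + 1) * (i * f w) * lin v.1 w ^ (i - 1) * linConj v.1 w ^ j * φ l (quad v.1 w)
        + v.1.1 ^ (d + 1) * (j * f w) * lin v.1 w ^ i * linConj v.1 w ^ (j - 1) * φ l (quad v.1 w)
        + v.1.1 ^ (d + 1) * (f w * (w.im : ℂ)⁻¹) * lin v.1 w ^ (i + 1) * linConj v.1 w ^ j *
          φ (l + 1) (quad v.1 w)
        + v.1.1 ^ (d + 1) * (f w * (w.im : ℂ)⁻¹) * lin v.1 w ^ i * linConj v.1 w ^ (j + 1) *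
          φ (l + 1) (quad v.1 w))
      (v.1.1 ^ d * β * lin v.1 w ^ i * linConj v.1 w ^ j * φ l (quad v.1 w)
        + v.1.1 ^ (d + 1) * ((I * i) * f w) * lin v.1 w ^ (i - 1) * linConj v.1 w ^ j *
          φ l (quad v.1 w)
        + v.1.1 ^ (d + 1) * ((-I * j) * f w) * lin v.1 w ^ i * linConj v.1 w ^ (j - 1) *
          φ l (quad v.1 w)
        + v.1.1 ^ (d + 1) * (-I * (f w * (w.im : ℂ)⁻¹)) * lin v.1 w ^ (i + 1) * linConj v.1 w ^ j *
          φ (l + 1) (quad v.1 w)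
        + v.1.1 ^ (d + 1) * (I * (f w * (w.im : ℂ)⁻¹)) * lin v.1 w ^ i * linConj v.1 w ^ (j + 1) *
          φ (l + 1) (quad v.1 w)
        + v.1.1 ^ d * (-1 * (f w * (w.im : ℂ)⁻¹ * (w.im : ℂ)⁻¹)) * lin v.1 w ^ (i + 1) *
          linConj v.1 w ^ (j + 1) * φ (l + 1) (quad v.1 w)) := by
  have him := im_ne_zero hw
  have h := (((hf.const_mul ((v.1.1 : ℂ) ^ d)).mul ((hasGrad_lin v.1 w).pow i)).mul
    ((hasGrad_linConj v.1 w).pow j)).mul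
      (HasGrad.comp_real (hφ.hasDerivAt l _ (quad_pos v hw)) (hasGrad_quad v.1 hw))
  refine h.congr ?_ ?_
  · field_simp; ring
  · field_simp; ring

/-- By closure under derivatives, local summability for all indices gives every order by induction,
provided the indices and the coefficient function vary. -/
theorem termwiseSmooth_latticeTerm (hφ : IsKernel φ) (n d : ℕ) {f : ℂ → ℂ} (i j l : ℕ)
    (hf : ContDiffOn ℝ ∞ f halfPlane) : TermwiseSmooth n (latticeTerm φ d f i j l) := by
  have key : ∀ (d : ℕ) {f : ℂ → ℂ} (i j l : ℕ) (_ : ContDiffOn ℝ ∞ f halfPlane),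
      (∀ v, ContDiffOn ℝ ∞ (latticeTerm φ d f i j l v) halfPlane) ∧
        LocallySummable (latticeTerm φ d f i j l) := by
    intro d f i j l hf
    refine ⟨fun v => ?_, fun w hw => ?_⟩
    · refine ((((contDiffOn_const.mul hf).mul ((contDiff_lin v.1).pow i).contDiffOn).mul
        ((contDiff_linConj v.1).pow j).contDiffOn)).mul ?_
      exact (hφ.contDiffOn l).comp (contDiffOn_quad v.1) fun w hw => quad_pos v hw
    · have hwim : 0 < w.im := hw
      obtain ⟨N, C, hC, hb⟩ := hφ.exists_term_bound d i j l (|w.re| + 1) (half_pos hwim)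
      refine ⟨fun v => (‖f w‖ + 1) * (C * (w.im + 1) ^ N * (size v.1 ^ 3)⁻¹),
        ((summable_size_pow le_rfl).mul_left _).mul_left _, ?_⟩
      have h1 : ∀ᶠ z in 𝓝 w, |z.re| < |w.re| + 1 :=
        (continuous_abs.comp continuous_re).continuousAt.eventually_lt continuousAt_const (by simp)
      have h2 : ∀ᶠ z in 𝓝 w, w.im / 2 < z.im :=
        continuousAt_const.eventually_lt continuous_im.continuousAt (by linarith)
      have h3 : ∀ᶠ z in 𝓝 w, z.im < w.im + 1 :=
        continuous_im.continuousAt.eventually_lt continuousAt_const (by simp)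
      have h4 : ∀ᶠ z in 𝓝 w, ‖f z‖ < ‖f w‖ + 1 :=
        (hf.differentiableAt_halfPlane hw).continuousAt.norm.eventually_lt continuousAt_const
          (by simp)
      filter_upwards [h1, h2, h3, h4] with z h1 h2 h3 h4 v
      have hz : 0 < z.im := by linarith
      have hs := size_pos v
      rw [show latticeTerm φ d f i j l v z = f z * ((v.1.1 : ℂ) ^ d * lin v.1 z ^ i *
        linConj v.1 z ^ j * φ l (quad v.1 z)) by rw [latticeTerm]; ring, norm_mul]
      refine mul_le_mul h4.le ((hb z h1.le h2.le v).trans ?_) (norm_nonneg _) (by positivity)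
      gcongr
  induction n generalizing d f i j l with
  | zero => exact key d i j l hf
  | succ n ih =>
    have hc : ∀ (c : ℂ) {g : ℂ → ℂ}, ContDiffOn ℝ ∞ g halfPlane →
      ContDiffOn ℝ ∞ (fun w => c * g w) halfPlane := fun c g hg => contDiffOn_const.mul hg
    have hfy := hf.mul contDiffOn_im_inv
    refine ⟨key d i j l hf, ?_, ?_⟩
    · refine (((((ih d i j l (contDiffOn_dX hf)).add (ih (d + 1) (i - 1) j l (hc i hf))).add
        (ih (d + 1) i (j - 1) l (hc j hf))).add
        (ih (d + 1) (i + 1) j (l + 1) hfy)).add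
        (ih (d + 1) i (j + 1) (l + 1) hfy)).congr fun v w hw => ?_
      exact (hasGrad_latticeTerm hφ d i j l v hw (hf.differentiableAt_halfPlane hw).hasGrad).dX.symm
    · refine ((((((ih d i j l (contDiffOn_dY hf)).add (ih (d + 1) (i - 1) j l (hc (I * i) hf))).add
        (ih (d + 1) i (j - 1) l (hc (-I * j) hf))).add
        (ih (d + 1) (i + 1) j (l + 1) (hc (-I) hfy))).add
        (ih (d + 1) i (j + 1) (l + 1) (hc I hfy))).add
        (ih d (i + 1) (j + 1) (l + 1) (hc (-1) (hfy.mul contDiffOn_im_inv)))).congr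
          fun v w hw => ?_
      exact (hasGrad_latticeTerm hφ d i j l v hw (hf.differentiableAt_halfPlane hw).hasGrad).dY.symm

/-! ### Truncated Mellin transforms -/

/-- The `n`-th derivative in `τ` of the integral of `u t * t ^ τ` over `t > 1`. -/
def mellinTail (u : ℝ → ℂ) (n : ℕ) (τ : ℂ) : ℂ :=
  ∫ t in Ioi (1 : ℝ), u t * ((Real.log t : ℝ) : ℂ) ^ n * (t : ℂ) ^ τ

/-- A measurable function decaying on `(1, ∞)` faster than any power. -/
structure RapidDecay (u : ℝ → ℂ) : Prop where
  meas : AEStronglyMeasurable u (volume.restrict (Ioi 1))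
  bound : ∀ N : ℕ, ∃ C, 0 ≤ C ∧ ∀ t > 1, ‖u t‖ ≤ C / t ^ N

theorem norm_log_pow_mul_cpow_le (n : ℕ) (τ : ℂ) {t : ℝ} (ht : 1 < t) :
    ‖((Real.log t : ℝ) : ℂ) ^ n * (t : ℂ) ^ τ‖ ≤ t ^ (n + τ.re) := by
  have ht0 : 0 < t := by linarith
  rw [norm_mul, norm_pow, norm_real, Complex.norm_cpow_eq_rpow_re_of_pos ht0, Real.rpow_add ht0,
    Real.rpow_natCast, Real.norm_of_nonneg (Real.log_nonneg ht.le)]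
  gcongr
  · exact Real.log_nonneg ht.le
  · exact (Real.log_le_sub_one_of_pos ht0).trans (by linarith)

theorem measurable_log_pow_mul_cpow (n : ℕ) (τ : ℂ) :
    Measurable fun t : ℝ => ((Real.log t : ℝ) : ℂ) ^ n * (t : ℂ) ^ τ := by
  fun_prop

theorem RapidDecay.exists_bound {u : ℝ → ℂ} (hu : RapidDecay u) (n : ℕ) (x : ℝ) :
    ∃ C, 0 ≤ C ∧ ∀ τ : ℂ, τ.re ≤ x → ∀ t > 1,
      ‖u t * ((Real.log t : ℝ) : ℂ) ^ n * (t : ℂ) ^ τ‖ ≤ C * t ^ (-2 : ℝ) := by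
  obtain ⟨N, hN⟩ := exists_nat_ge (n + x + 2)
  obtain ⟨C, hC, hb⟩ := hu.bound N
  refine ⟨C, hC, fun τ hτ t ht => ?_⟩
  have ht0 : 0 < t := by linarith
  rw [mul_assoc, norm_mul]
  calc ‖u t‖ * ‖((Real.log t : ℝ) : ℂ) ^ n * (t : ℂ) ^ τ‖ ≤ C / t ^ N * t ^ (n + τ.re) :=
        mul_le_mul (hb t ht) (norm_log_pow_mul_cpow_le n τ ht) (norm_nonneg _) (by positivity)
    _ = C * t ^ (n + τ.re - N) := by
        rw [Real.rpow_sub ht0, Real.rpow_natCast]; ring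
    _ ≤ C * t ^ (-2 : ℝ) := by
        gcongr
        · exact ht.le
        · linarith

theorem integrableOn_const_mul_rpow_neg_two (C : ℝ) :
    IntegrableOn (fun t : ℝ => C * t ^ (-2 : ℝ)) (Ioi 1) :=
  (integrableOn_Ioi_rpow_of_lt (by norm_num) one_pos).const_mul C

theorem RapidDecay.aestronglyMeasurable {u : ℝ → ℂ} (hu : RapidDecay u) (n : ℕ) (τ : ℂ) :
    AEStronglyMeasurable (fun t : ℝ => u t * ((Real.log t : ℝ) : ℂ) ^ n * (t : ℂ) ^ τ)
      (volume.restrict (Ioi 1)) := by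
  simp only [mul_assoc]
  exact hu.meas.mul (measurable_log_pow_mul_cpow n τ).aestronglyMeasurable

theorem RapidDecay.integrableOn {u : ℝ → ℂ} (hu : RapidDecay u) (n : ℕ) (τ : ℂ) :
    IntegrableOn (fun t : ℝ => u t * ((Real.log t : ℝ) : ℂ) ^ n * (t : ℂ) ^ τ) (Ioi 1) := by
  obtain ⟨C, -, hb⟩ := hu.exists_bound n τ.re
  refine Integrable.mono' (integrableOn_const_mul_rpow_neg_two C) (hu.aestronglyMeasurable n τ) ?_
  filter_upwards [ae_restrict_mem measurableSet_Ioi] with t ht using hb τ le_rfl t ht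

theorem RapidDecay.hasDerivAt_mellinTail {u : ℝ → ℂ} (hu : RapidDecay u) (n : ℕ) (τ : ℂ) :
    HasDerivAt (mellinTail u n) (mellinTail u (n + 1) τ) τ := by
  obtain ⟨C, -, hb⟩ := hu.exists_bound (n + 1) (τ.re + 1)
  refine (hasDerivAt_integral_of_dominated_loc_of_deriv_le
    (F := fun τ t => u t * ((Real.log t : ℝ) : ℂ) ^ n * (t : ℂ) ^ τ)
    (F' := fun τ t => u t * ((Real.log t : ℝ) : ℂ) ^ (n + 1) * (t : ℂ) ^ τ)
    (bound := fun t => C * t ^ (-2 : ℝ))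
    (Metric.ball_mem_nhds τ one_pos) (Eventually.of_forall fun σ => hu.aestronglyMeasurable n σ)
    (hu.integrableOn n τ) (hu.aestronglyMeasurable (n + 1) τ) ?_
    (integrableOn_const_mul_rpow_neg_two C) ?_).2
  · filter_upwards [ae_restrict_mem measurableSet_Ioi] with t ht σ hσ
    refine hb σ ?_ t ht
    have h1 := (Complex.abs_re_le_norm (σ - τ)).trans_lt (by rwa [Metric.mem_ball, dist_eq_norm] at hσ)
    rw [sub_re, abs_lt] at h1
    linarith
  · filter_upwards [ae_restrict_mem measurableSet_Ioi] with t ht σ _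
    have ht0 : (t : ℂ) ≠ 0 := ofReal_ne_zero.2 (by have : (1 : ℝ) < t := ht; linarith)
    have h := ((hasDerivAt_id σ).const_cpow (c := (t : ℂ)) (Or.inl ht0)).const_mul
      (u t * ((Real.log t : ℝ) : ℂ) ^ n)
    refine h.congr_deriv ?_
    rw [ofReal_log (by have : (1 : ℝ) < t := ht; linarith)]
    simp only [id]
    ring

/-- The exponential `exp (-π t q)`. -/
def expo (t q : ℝ) : ℂ := ((Real.exp (-(Real.pi * t * q)) : ℝ) : ℂ)

theorem norm_expo (t q : ℝ) : ‖expo t q‖ = Real.exp (-(Real.pi * t * q)) := by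
  rw [expo, norm_real, Real.norm_of_nonneg (Real.exp_pos _).le]

theorem norm_expo_le (N : ℕ) {t q : ℝ} (ht : 0 < t) (hq : 0 < q) :
    ‖expo t q‖ ≤ (N.factorial : ℝ) / (t ^ N * q ^ N) := by
  have hpi := Real.pi_pos
  have h1 : t * q ≤ Real.pi * t * q := by
    rw [mul_assoc]
    exact le_mul_of_one_le_left (by positivity) (by linarith [Real.pi_gt_three])
  have h2 := (Real.pow_div_factorial_le_exp (t * q) (by positivity) N).trans (Real.exp_le_exp.2 h1)
  have h3 : (0 : ℝ) < N.factorial := by exact_mod_cast N.factorial_pos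
  rw [norm_expo, Real.exp_neg, ← mul_pow]
  rw [div_le_iff₀ h3] at h2
  rw [inv_le_comm₀ (Real.exp_pos _) (by positivity), inv_div, div_le_iff₀ h3]
  exact h2

theorem hasDerivAt_expo_right (t q : ℝ) :
    HasDerivAt (fun q => expo t q) (-(Real.pi * t : ℝ) * expo t q) q := by
  have h : HasDerivAt (fun q : ℝ => Real.exp (-(Real.pi * t * q)))
      (Real.exp (-(Real.pi * t * q)) * -(Real.pi * t * 1)) q :=
    (((hasDerivAt_id q).const_mul (Real.pi * t)).neg).exp
  refine h.ofReal_comp.congr_deriv ?_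
  rw [expo]; push_cast; ring

theorem expo_comm (t q : ℝ) : expo t q = expo q t := by
  rw [expo, expo]; ring_nf

theorem hasDerivAt_expo_left (t q : ℝ) :
    HasDerivAt (fun t => expo t q) (-(Real.pi * q : ℝ) * expo t q) t := by
  have h := hasDerivAt_expo_right q t
  rw [expo_comm q t] at h
  exact h.congr_of_eventuallyEq (Eventually.of_forall fun t => expo_comm t q)

theorem continuous_expo_left (q : ℝ) : Continuous fun t => expo t q :=
  continuous_iff_continuousAt.2 fun t => (hasDerivAt_expo_left t q).continuousAt

theorem isKernel_expo {t : ℝ} (ht : 0 < t) :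
    IsKernel fun l q => (-(Real.pi * t : ℝ) : ℂ) ^ l * expo t q where
  hasDerivAt l q _ := ((hasDerivAt_expo_right t q).const_mul _).congr_deriv (by ring)
  bound l := by
    refine ⟨0, fun N _ => ⟨(Real.pi * t) ^ l * (N.factorial / t ^ N), ?_, fun q hq => ?_⟩⟩
    · have := Real.pi_pos; positivity
    · have := Real.pi_pos
      rw [norm_mul, norm_pow, norm_neg, norm_real, Real.norm_of_nonneg (by positivity), mul_div_assoc,
        div_div]
      gcongr
      exact norm_expo_le N ht hq

theorem rapidDecay_expo {q : ℝ} (hq : 0 < q) : RapidDecay fun t => expo t q where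
  meas := (continuous_expo_left q).aestronglyMeasurable
  bound N := by
    refine ⟨N.factorial / q ^ N, by positivity, fun t ht => ?_⟩
    have := norm_expo_le N (by linarith) hq (t := t)
    rwa [mul_comm, ← div_div] at this

/-- The integral of `exp (-π t q) (log t) ^ n t ^ τ` over `t > 1`. -/
def lap (n : ℕ) (τ : ℂ) (q : ℝ) : ℂ := mellinTail (fun t => expo t q) n τ

/-- The exponential supplies `t ^ (-N)` together with `q ^ (-N)`, and a large `N` pays for the
logarithms and for `t ^ τ`. -/
theorem exists_norm_lap_integrand_le (n : ℕ) (τ : ℂ) :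
    ∃ N₀ : ℕ, ∀ N ≥ N₀, ∀ q > 0, ∀ t > 1,
      ‖expo t q * ((Real.log t : ℝ) : ℂ) ^ n * (t : ℂ) ^ τ‖ ≤
        N.factorial / q ^ N * t ^ (-2 : ℝ) := by
  obtain ⟨N₀, hN₀⟩ := exists_nat_ge (n + τ.re + 2)
  refine ⟨N₀, fun N hN q hq t ht => ?_⟩
  have ht0 : 0 < t := by linarith
  have hN' : (N₀ : ℝ) ≤ N := by exact_mod_cast hN
  rw [mul_assoc, norm_mul]
  calc ‖expo t q‖ * ‖((Real.log t : ℝ) : ℂ) ^ n * (t : ℂ) ^ τ‖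
      ≤ N.factorial / (t ^ N * q ^ N) * t ^ (n + τ.re) :=
        mul_le_mul (norm_expo_le N ht0 hq) (norm_log_pow_mul_cpow_le n τ ht) (norm_nonneg _)
          (by positivity)
    _ = N.factorial / q ^ N * t ^ (n + τ.re - N) := by
        rw [Real.rpow_sub ht0, Real.rpow_natCast]; field_simp
    _ ≤ N.factorial / q ^ N * t ^ (-2 : ℝ) := by
        gcongr
        · exact ht.le
        · linarith

theorem integral_norm_lap_integrand_le (n : ℕ) (τ : ℂ) :
    ∃ N₀ : ℕ, ∀ N ≥ N₀, ∀ q > 0,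
      ∫ t in Ioi (1 : ℝ), ‖expo t q * ((Real.log t : ℝ) : ℂ) ^ n * (t : ℂ) ^ τ‖ ≤
        N.factorial / q ^ N := by
  obtain ⟨N₀, h⟩ := exists_norm_lap_integrand_le n τ
  refine ⟨N₀, fun N hN q hq => ?_⟩
  calc _ ≤ ∫ t in Ioi (1 : ℝ), N.factorial / q ^ N * t ^ (-2 : ℝ) :=
        setIntegral_mono_on ((rapidDecay_expo hq).integrableOn n τ).norm
          (integrableOn_const_mul_rpow_neg_two _) measurableSet_Ioi fun t ht => h N hN q hq t ht
    _ = N.factorial / q ^ N := by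
        rw [integral_const_mul, integral_Ioi_rpow_of_lt (by norm_num) one_pos]; norm_num

theorem exists_norm_lap_le (n : ℕ) (τ : ℂ) :
    ∃ N₀ : ℕ, ∀ N ≥ N₀, ∃ C, 0 ≤ C ∧ ∀ q > 0, ‖lap n τ q‖ ≤ C / q ^ N := by
  obtain ⟨N₀, h⟩ := integral_norm_lap_integrand_le n τ
  exact ⟨N₀, fun N hN => ⟨N.factorial, by positivity, fun q hq =>
    (norm_integral_le_integral_norm _).trans (h N hN q hq)⟩⟩

theorem hasDerivAt_lap (n : ℕ) (τ : ℂ) {q : ℝ} (hq : 0 < q) :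
    HasDerivAt (lap n τ) (-Real.pi * lap n (τ + 1) q) q := by
  obtain ⟨N, h⟩ := exists_norm_lap_integrand_le n (τ + 1)
  have hrd := fun {q : ℝ} (hq : 0 < q) => rapidDecay_expo hq
  have key := (hasDerivAt_integral_of_dominated_loc_of_deriv_le (μ := volume.restrict (Ioi 1))
    (F := fun q t => expo t q * ((Real.log t : ℝ) : ℂ) ^ n * (t : ℂ) ^ τ)
    (F' := fun q t => -Real.pi * (expo t q * ((Real.log t : ℝ) : ℂ) ^ n * (t : ℂ) ^ (τ + 1)))
    (bound := fun t => Real.pi * (N.factorial / (q / 2) ^ N * t ^ (-2 : ℝ)))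
    (x₀ := q) (s := Ioi (q / 2)) (Ioi_mem_nhds (by linarith)) ?_
    ((hrd hq).integrableOn n τ) (((hrd hq).aestronglyMeasurable n (τ + 1)).const_mul _) ?_
    ((integrableOn_const_mul_rpow_neg_two _).const_mul _) ?_).2
  · rw [integral_const_mul] at key
    exact key
  · filter_upwards [Ioi_mem_nhds hq] with p hp using (hrd hp).aestronglyMeasurable n τ
  · filter_upwards [ae_restrict_mem measurableSet_Ioi] with t ht p hp
    have hp : q / 2 < p := hp
    have ht : 1 < t := ht
    rw [norm_mul, norm_neg, norm_real, Real.norm_of_nonneg Real.pi_pos.le]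
    refine mul_le_mul_of_nonneg_left ((h N le_rfl p (by linarith) t ht).trans ?_) Real.pi_pos.le
    have : (0 : ℝ) < t ^ (-2 : ℝ) := Real.rpow_pos_of_pos (by linarith) _
    gcongr
  · filter_upwards [ae_restrict_mem measurableSet_Ioi] with t ht p hp
    have ht : 1 < t := ht
    have ht0 : (t : ℂ) ≠ 0 := ofReal_ne_zero.2 (by linarith)
    refine (((hasDerivAt_expo_right t p).mul_const _).mul_const _).congr_deriv ?_
    rw [cpow_add _ _ ht0, cpow_one]; push_cast; ring

theorem isKernel_lap (n : ℕ) (τ : ℂ) :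
    IsKernel fun l q => (-Real.pi : ℂ) ^ l * lap n (τ + l) q where
  hasDerivAt l q hq := by
    refine ((hasDerivAt_lap n (τ + l) hq).const_mul _).congr_deriv ?_
    push_cast; ring_nf
  bound l := by
    obtain ⟨N₀, h⟩ := exists_norm_lap_le n (τ + l)
    refine ⟨N₀, fun N hN => ?_⟩
    obtain ⟨C, hC, hb⟩ := h N hN
    refine ⟨Real.pi ^ l * C, mul_nonneg (pow_nonneg Real.pi_pos.le _) hC, fun q hq => ?_⟩
    rw [norm_mul, norm_pow, norm_neg, norm_real, Real.norm_of_nonneg Real.pi_pos.le, mul_div_assoc]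
    exact mul_le_mul_of_nonneg_left (hb q hq) (pow_nonneg Real.pi_pos.le _)

theorem tendsto_expo_mul_log_pow_mul_cpow (n : ℕ) (τ : ℂ) {q : ℝ} (hq : 0 < q) :
    Tendsto (fun t : ℝ => expo t q * ((Real.log t : ℝ) : ℂ) ^ n * (t : ℂ) ^ τ) atTop (𝓝 0) := by
  obtain ⟨C, -, hb⟩ := (rapidDecay_expo hq).exists_bound n τ.re
  have h0 : Tendsto (fun t : ℝ => C * t ^ (-2 : ℝ)) atTop (𝓝 0) := by
    simpa using (tendsto_rpow_neg_atTop (y := 2) (by norm_num)).const_mul C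
  refine squeeze_zero_norm' ?_ h0
  filter_upwards [eventually_gt_atTop 1] with t ht using hb τ le_rfl t ht

/-- Integration by parts for `lap`. -/
theorem pi_mul_lap_add_one (n : ℕ) (τ : ℂ) {q : ℝ} (hq : 0 < q) :
    Real.pi * q * lap n (τ + 1) q =
      (if n = 0 then expo 1 q else 0) + (τ + 1) * lap n τ q + n * lap (n - 1) τ q := by
  have hrd := rapidDecay_expo hq
  have hI : ∀ (n : ℕ) (τ : ℂ), Integrable (fun t : ℝ => expo t q * ((Real.log t : ℝ) : ℂ) ^ n * (t : ℂ) ^ τ)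
    (volume.restrict (Ioi 1)) := fun n τ => hrd.integrableOn n τ
  -- The integral of the derivative of `g` over `t > 1` produces all the terms. The boundary value
  -- at `1` survives only for `n = 0`, since `log 1 = 0`.
  set g : ℝ → ℂ := fun t => expo t q * ((Real.log t : ℝ) : ℂ) ^ n * (t : ℂ) ^ (τ + 1)
  set g' : ℝ → ℂ := fun t =>
    -(Real.pi * q) * (expo t q * ((Real.log t : ℝ) : ℂ) ^ n * (t : ℂ) ^ (τ + 1))
    + (τ + 1) * (expo t q * ((Real.log t : ℝ) : ℂ) ^ n * (t : ℂ) ^ τ)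
    + n * (expo t q * ((Real.log t : ℝ) : ℂ) ^ (n - 1) * (t : ℂ) ^ τ)
  have hder : ∀ t : ℝ, 0 < t → HasDerivAt g (g' t) t := by
    intro t ht
    have ht0 : (t : ℂ) ≠ 0 := ofReal_ne_zero.2 ht.ne'
    have h1 := (Real.hasDerivAt_log ht.ne').ofReal_comp.pow n
    have h2 : HasDerivAt (fun t : ℝ => (t : ℂ) ^ (τ + 1)) ((τ + 1) * (t : ℂ) ^ τ) t := by
      have := ((hasDerivAt_id (t : ℂ)).cpow_const (c := τ + 1)
        (Or.inl (by simpa using ht))).comp_ofReal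
      simpa using this
    refine (((hasDerivAt_expo_left t q).mul h1).mul h2).congr_deriv ?_
    simp only [g', Pi.mul_apply, Pi.pow_apply]
    rw [cpow_add _ _ ht0, cpow_one]
    push_cast
    field_simp
    ring
  have hint : IntegrableOn g' (Ioi 1) :=
    (((hI n (τ + 1)).const_mul _).add ((hI n τ).const_mul _)).add ((hI (n - 1) τ).const_mul _)
  have key := integral_Ioi_of_hasDerivAt_of_tendsto (a := 1) (f := g) (f' := g')
    (hder 1 one_pos).continuousAt.continuousWithinAt
    (fun t ht => hder t (zero_lt_one.trans ht)) hint (tendsto_expo_mul_log_pow_mul_cpow n (τ + 1) hq)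
  have hval : g 1 = if n = 0 then expo 1 q else 0 := by
    simp only [g, Real.log_one, ofReal_zero, ofReal_one, one_cpow, mul_one]
    split_ifs with h <;> simp [h]
  have h1 := (hI n (τ + 1)).const_mul (-(Real.pi * q : ℂ))
  have h2 := (hI n τ).const_mul (τ + 1)
  have h3 := (hI (n - 1) τ).const_mul (n : ℂ)
  have hsplit : ∫ t in Ioi 1, g' t = -(Real.pi * q) * lap n (τ + 1) q + (τ + 1) * lap n τ q
      + n * lap (n - 1) τ q := by
    simp only [lap, mellinTail, ← integral_const_mul]
    rw [← integral_add h1 h2]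
    exact integral_add (h1.add h2) h3
  rw [hval, hsplit] at key
  linear_combination -key

/-! ### Theta functions with harmonic coefficients -/

theorem summable_exp_neg_mul_sq {c : ℝ} (hc : 0 < c) :
    Summable fun n : ℤ => Real.exp (-(Real.pi * c * n ^ 2)) := by
  have h := ((summable_jacobiTheta₂_term_iff 0 (c * I)).2 (by simpa using hc)).norm
  refine h.congr fun n => ?_
  rw [jacobiTheta₂_term, Complex.norm_exp]
  congr 1
  have : (2 * Real.pi * I * (n : ℂ) * 0 + Real.pi * I * (n : ℂ) ^ 2 * (c * I)) =
      ((-(Real.pi * c * n ^ 2) : ℝ) : ℂ) := by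
    push_cast
    linear_combination (Real.pi * c * (n : ℂ) ^ 2) * I_sq
  rw [this, ofReal_re]

/-- The general term of the theta series after Poisson summation in one variable. -/
def dualTerm (x y t : ℝ) (a c : ℤ) : ℂ :=
  cexp (-(Real.pi * y * (c ^ 2 / t + a ^ 2 * t)) + 2 * Real.pi * I * (a * c * x))

theorem summable_dualTerm (x : ℝ) {y t : ℝ} (hy : 0 < y) (ht : 0 < t) :
    Summable fun p : ℤ × ℤ => dualTerm x y t p.1 p.2 := by
  have h1 := summable_exp_neg_mul_sq (c := y * t) (by positivity)
  have h2 := summable_exp_neg_mul_sq (c := y / t) (by positivity)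
  refine Summable.of_norm_bounded (h1.mul_of_nonneg h2 (fun _ => (Real.exp_pos _).le)
    fun _ => (Real.exp_pos _).le) fun p => ?_
  rw [dualTerm, Complex.norm_exp, ← Real.exp_add]
  have : (-(Real.pi * y * (p.2 ^ 2 / t + p.1 ^ 2 * t)) + 2 * Real.pi * I * (p.1 * p.2 * x) : ℂ) =
      ((-(Real.pi * (y * t) * p.1 ^ 2) + -(Real.pi * (y / t) * p.2 ^ 2) : ℝ) : ℂ)
        + ((2 * Real.pi * (p.1 * p.2 * x) : ℝ) : ℂ) * I := by
    push_cast; ring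
  rw [this, add_re, re_ofReal_mul, I_re, ofReal_re]
  simp

/-- The exponent `c² / t + a² t` is invariant under `t ↦ 1/t` combined with the exchange of `a` and
`c`, which absolute convergence permits. -/
theorem tsum_dualTerm_inv (x : ℝ) {y t : ℝ} (hy : 0 < y) (ht : 0 < t) :
    ∑' (a : ℤ) (c : ℤ), dualTerm x y t⁻¹ a c = ∑' (a : ℤ) (c : ℤ), dualTerm x y t a c := by
  have h := summable_dualTerm x hy ht
  rw [← Summable.tsum_comm (f := dualTerm x y t) h]
  refine tsum_congr fun a => tsum_congr fun c => ?_
  rw [dualTerm, dualTerm]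
  congr 1
  push_cast
  field_simp
  ring

theorem quad_eq (v : ℤ × ℤ) (w : ℂ) :
    quad v w = ((v.2 + v.1 * w.re) ^ 2 + v.1 ^ 2 * w.im ^ 2) / w.im := by
  rw [quad, ← normSq_eq_norm_sq, normSq_apply]
  simp [lin]
  ring

/-- Poisson summation in `b` alone, for fixed `a`: the exponent is quadratic in `b` with leading
coefficient `-πt / y`. -/
theorem tsum_expo_quad_right {t : ℝ} (ht : 0 < t) {w : ℂ} (hw : w ∈ halfPlane) (a : ℤ) :
    ∑' b : ℤ, expo t (quad (a, b) w) =
      ((Real.sqrt (w.im / t) : ℝ) : ℂ) * ∑' c : ℤ, dualTerm w.re w.im t a c := by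
  have hy : 0 < w.im := hw
  have hα : 0 < t / w.im := by positivity
  have hαc : 0 < ((t / w.im : ℝ) : ℂ).re := by simpa using hα
  have key := Complex.tsum_exp_neg_quadratic hαc (-((t / w.im : ℝ) : ℂ) * a * w.re)
  have hyc : (w.im : ℂ) ≠ 0 := ofReal_ne_zero.2 hy.ne'
  have htc : (t : ℂ) ≠ 0 := ofReal_ne_zero.2 ht.ne'
  have hsq : 1 / ((t / w.im : ℝ) : ℂ) ^ (1 / 2 : ℂ) = ((Real.sqrt (w.im / t) : ℝ) : ℂ) := by
    rw [Real.sqrt_eq_rpow, show (1 / 2 : ℂ) = ((1 / 2 : ℝ) : ℂ) by norm_num,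
      ← ofReal_cpow hα.le, one_div, ← ofReal_inv, ← Real.inv_rpow hα.le, inv_div]
  -- The part of the exponent free of `b`; on the dual side it combines with the constant left by
  -- the shifted square.
  set e := cexp (-(Real.pi * (t / w.im) * (a ^ 2 * (w.re ^ 2 + w.im ^ 2)))) with he
  have hL : ∀ b : ℤ, expo t (quad (a, b) w) = e * cexp (-Real.pi * ((t / w.im : ℝ) : ℂ) * (b : ℂ) ^ 2 +
      2 * Real.pi * (-((t / w.im : ℝ) : ℂ) * a * w.re) * b) := by
    intro b
    rw [expo, quad_eq, he, ← Complex.exp_add, ofReal_exp]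
    congr 1
    push_cast
    field_simp
    ring
  have hR : ∀ c : ℤ, dualTerm w.re w.im t a c = e * cexp (-Real.pi / ((t / w.im : ℝ) : ℂ) *
      (c + I * (-((t / w.im : ℝ) : ℂ) * a * w.re)) ^ 2) := by
    intro c
    rw [dualTerm, he, ← Complex.exp_add]
    congr 1
    push_cast
    field_simp
    ring_nf
    rw [I_sq]
    ring
  simp only [hL, hR, tsum_mul_left]
  rw [key, hsq]
  ring

theorem summable_expo_quad {t : ℝ} (ht : 0 < t) {w : ℂ} (hw : w ∈ halfPlane) :
    Summable fun v : Pairs => expo t (quad v.1 w) := by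
  have h := (termwiseSmooth_latticeTerm (isKernel_expo ht) 0 0 (f := fun _ => 1) 0 0 0
    contDiffOn_const).locallySummable.summable hw
  refine h.congr fun v => ?_
  simp [latticeTerm]

theorem lin_zero (w : ℂ) : lin (0, 0) w = 0 := by simp [lin]

theorem quad_zero (w : ℂ) : quad (0, 0) w = 0 := by simp [quad, lin_zero]

theorem hasSum_expo_quad {t : ℝ} (ht : 0 < t) {w : ℂ} (hw : w ∈ halfPlane) :
    HasSum (fun v : ℤ × ℤ => expo t (quad v w)) (∑' v : Pairs, expo t (quad v.1 w) + 1) := by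
  have h := (summable_expo_quad ht hw).hasSum
  have h2 := (hasSum_subtype_iff_indicator (f := fun v : ℤ × ℤ => expo t (quad v w))
    (s := {v | v ≠ (0, 0)})).1 h
  have h3 := h2.add (hasSum_ite_eq ((0, 0) : ℤ × ℤ) (1 : ℂ))
  convert h3 using 1
  funext v
  by_cases hv : v = (0, 0)
  · subst hv
    simp [quad_zero, expo]
  · rw [Set.indicator_of_mem hv, if_neg hv, add_zero]

/-- The double sum is invariant under `t ↦ 1/t`, and the prefactors satisfy `√(yt) = t √(y/t)`. -/
theorem theta_zero_inv {t : ℝ} (ht : 0 < t) {w : ℂ} (hw : w ∈ halfPlane) :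
    ∑' v : Pairs, expo t⁻¹ (quad v.1 w) + 1 = t * (∑' v : Pairs, expo t (quad v.1 w) + 1) := by
  have hy : 0 < w.im := hw
  have key : ∀ {t : ℝ}, 0 < t → ∑' v : Pairs, expo t (quad v.1 w) + 1 =
      ((Real.sqrt (w.im / t) : ℝ) : ℂ) * ∑' (a : ℤ) (c : ℤ), dualTerm w.re w.im t a c := by
    intro t ht
    have h := hasSum_expo_quad ht hw
    rw [← h.tsum_eq, h.summable.tsum_prod]
    simp only [tsum_expo_quad_right ht hw, tsum_mul_left]
  rw [key ht, key (inv_pos.2 ht), tsum_dualTerm_inv _ hy ht, ← mul_assoc, ← ofReal_mul]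
  congr 3
  rw [div_inv_eq_mul, ← Real.sqrt_sq ht.le, ← Real.sqrt_mul (by positivity)]
  rw [Real.sqrt_sq ht.le]
  congr 1
  field_simp

/-- The theta series with coefficients `(a w̄ + b) ^ l`, without its constant term. -/
def thetaConj (l : ℕ) (t : ℝ) (w : ℂ) : ℂ :=
  ∑' v : Pairs, linConj v.1 w ^ l * expo t (quad v.1 w)

theorem thetaConj_eq (l : ℕ) (t : ℝ) :
    thetaConj l t = fun w => ∑' v : Pairs,
      latticeTerm (fun l q => (-(Real.pi * t : ℝ) : ℂ) ^ l * expo t q) 0 (fun _ => 1) 0 l 0 v w := by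
  funext w
  refine tsum_congr fun v => ?_
  simp [latticeTerm]

theorem differentiableAt_thetaConj (l : ℕ) {t : ℝ} (ht : 0 < t) {w : ℂ} (hw : w ∈ halfPlane) :
    DifferentiableAt ℝ (thetaConj l t) w := by
  rw [thetaConj_eq]
  exact ((termwiseSmooth_latticeTerm (isKernel_expo ht) 1 0 0 l 0
    contDiffOn_const).hasGrad_tsum hw).differentiableAt

/-- The Wirtinger derivative raises the degree of the coefficients by two. -/
theorem wirtinger_thetaConj (l : ℕ) {t : ℝ} (ht : 0 < t) {w : ℂ} (hw : w ∈ halfPlane) :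
    dX (thetaConj l t) w - I * dY (thetaConj l t) w =
      -(Real.pi * t * I / (w.im : ℂ) ^ 2) * thetaConj (l + 2) t w := by
  have hT := termwiseSmooth_latticeTerm (isKernel_expo ht) 1 0 (f := fun _ => 1) 0 l 0
    contDiffOn_const
  have hg := hT.hasGrad_tsum hw
  rw [thetaConj_eq, hg.dX, hg.dY, ← tsum_mul_left,
    ← (hT.2.1.locallySummable.summable hw).tsum_sub
      ((hT.2.2.locallySummable.summable hw).mul_left I), thetaConj, ← tsum_mul_left]
  refine tsum_congr fun v => ?_
  have h := hasGrad_latticeTerm (isKernel_expo ht) 0 0 l 0 v hw (hasGrad_const 1 w)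
  rw [h.dX, h.dY]
  have him := im_ne_zero hw
  -- The derivative in `w` does not see powers of `a w̄ + b`, and that of `quad` is a multiple of
  -- `(a w̄ + b)²`. Eliminating `lin` makes the terms in `a` cancel.
  have h2 : lin v.1 w = linConj v.1 w + 2 * I * v.1.1 * w.im := by rw [linConj_eq]; ring
  rw [h2]
  simp only [pow_zero, zero_add, pow_one, one_mul, mul_one, Nat.cast_zero, mul_zero, zero_mul,
    add_zero]
  push_cast
  field_simp
  ring_nf
  simp only [I_sq, show I ^ 3 = -I by rw [pow_succ, I_sq]; ring]
  ring

/-- Each Wirtinger derivative contributes `t⁻¹` on the left and `t` on the right, so the exponent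
grows by two with the degree. The constant term disappears at the first step. -/
theorem thetaConj_inv (n : ℕ) {t : ℝ} (ht : 0 < t) {w : ℂ} (hw : w ∈ halfPlane) :
    thetaConj (2 * n) t⁻¹ w + (if n = 0 then 1 else 0) =
      t ^ (2 * n + 1) * (thetaConj (2 * n) t w + (if n = 0 then 1 else 0)) := by
  induction n generalizing w with
  | zero => simpa [thetaConj] using theta_zero_inv ht hw
  | succ n ih =>
    have hd := (differentiableAt_thetaConj (2 * n) (inv_pos.2 ht) hw).hasGrad.add
      (hasGrad_const (if n = 0 then 1 else 0) w)
    have hd' := ((differentiableAt_thetaConj (2 * n) ht hw).hasGrad.add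
      (hasGrad_const (if n = 0 then 1 else 0) w)).const_mul ((t : ℂ) ^ (2 * n + 1))
    have hx := Set.EqOn.dX_eq (fun z hz => ih hz) hw
    have hy := Set.EqOn.dY_eq (fun z hz => ih hz) hw
    rw [hd.dX, hd'.dX] at hx
    rw [hd.dY, hd'.dY] at hy
    have h1 := wirtinger_thetaConj (2 * n) (inv_pos.2 ht) hw
    have h2 := wirtinger_thetaConj (2 * n) ht hw
    have him := im_ne_zero hw
    have htc : (t : ℂ) ≠ 0 := ofReal_ne_zero.2 ht.ne'
    have hpi : (Real.pi : ℂ) ≠ 0 := ofReal_ne_zero.2 Real.pi_ne_zero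
    simp only [add_zero] at hx hy
    rw [hx, hy] at h1
    have h3 : -(Real.pi * (t⁻¹ : ℝ) * I / (w.im : ℂ) ^ 2) * thetaConj (2 * n + 2) t⁻¹ w =
      (t : ℂ) ^ (2 * n + 1) * (-(Real.pi * t * I / (w.im : ℂ) ^ 2) * thetaConj (2 * n + 2) t w) := by
      rw [← h1, ← h2]; ring
    push_cast at h3
    have hne : -(Real.pi * (t : ℂ)⁻¹ * I / (w.im : ℂ) ^ 2) ≠ 0 := by
      simp [hpi, htc, him, I_ne_zero]
    simp only [Nat.succ_ne_zero, if_false, add_zero, mul_add, mul_one]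
    apply mul_left_cancel₀ hne
    rw [h3]
    field_simp
    ring

/-! ### The theta series of weight `k` -/

/-- The factor `(a w̄ + b) ^ k / y ^ k` or `(a w + b) ^ (-k)` according to the sign of `k`. -/
def pre (k : ℤ) (v : ℤ × ℤ) (w : ℂ) : ℂ :=
  (w.im : ℂ)⁻¹ ^ k.toNat * lin v w ^ (-k).toNat * linConj v w ^ k.toNat

/-- The theta series of weight `k`, without its constant term. -/
def thetaTail (k : ℤ) (w : ℂ) (t : ℝ) : ℂ := ∑' v : Pairs, pre k v.1 w * expo t (quad v.1 w)

/-- The constant term of the theta series. -/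
def constTerm (k : ℤ) : ℂ := if k = 0 then 1 else 0

/-- Up to a power of `y` this is the series with coefficients `(a w̄ + b)^k` for `k ≥ 0`, and the
complex conjugate of such a series for `k < 0`. -/
theorem thetaTail_inv {k : ℤ} (hk : Even k) {t : ℝ} (ht : 0 < t) {w : ℂ} (hw : w ∈ halfPlane) :
    thetaTail k w t⁻¹ + constTerm k =
      t ^ (k.natAbs + 1) * (thetaTail k w t + constTerm k) := by
  obtain ⟨m, hm⟩ := hk
  rcases le_or_gt 0 k with h | h
  · obtain ⟨n, rfl⟩ := Int.eq_ofNat_of_zero_le (show 0 ≤ m by omega)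
    have h1 : k.toNat = 2 * n := by omega
    have h2 : (-k).toNat = 0 := by omega
    have h3 : k.natAbs = 2 * n := by omega
    have h4 : constTerm k = if n = 0 then 1 else 0 := by
      rw [constTerm]; congr 1; simp; omega
    have h5 : ∀ t, thetaTail k w t = (w.im : ℂ)⁻¹ ^ (2 * n) * thetaConj (2 * n) t w := by
      intro t
      rw [thetaTail, thetaConj, ← tsum_mul_left]
      refine tsum_congr fun v => ?_
      rw [pre, h1, h2]; ring
    have h6 : constTerm k = (w.im : ℂ)⁻¹ ^ (2 * n) * (if n = 0 then 1 else 0) := by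
      rw [h4]; split_ifs with hn <;> simp [hn]
    rw [h5, h5, h6, h3, ← mul_add, thetaConj_inv n ht hw]
    ring
  · obtain ⟨n, hn⟩ := Int.eq_ofNat_of_zero_le (show 0 ≤ -m by omega)
    have h1 : k.toNat = 0 := by omega
    have h2 : (-k).toNat = 2 * n := by omega
    have h3 : k.natAbs = 2 * n := by omega
    have hn0 : n ≠ 0 := by omega
    have h4 : constTerm k = 0 := by rw [constTerm, if_neg h.ne]
    have h5 : ∀ t, thetaTail k w t = (starRingEnd ℂ) (thetaConj (2 * n) t w) := by
      intro t
      rw [thetaTail, thetaConj, conj_tsum]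
      refine tsum_congr fun v => ?_
      rw [pre, h1, h2, map_mul, map_pow, ← conj_lin, conj_conj, expo, conj_ofReal]; ring
    have h6 := congrArg (starRingEnd ℂ) (thetaConj_inv n ht hw)
    simp only [if_neg hn0, add_zero, map_mul, map_pow, conj_ofReal] at h6
    rw [h5, h5, h4, h3, add_zero, add_zero, h6]

/-! ### Convergence and decay of the theta tail -/

theorem norm_pre (k : ℤ) (v : ℤ × ℤ) {w : ℂ} (hw : w ∈ halfPlane) :
    ‖pre k v w‖ = w.im⁻¹ ^ k.toNat * ‖lin v w‖ ^ k.natAbs := by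
  have h : k.natAbs = (-k).toNat + k.toNat := by omega
  have hy : 0 < w.im := hw
  rw [pre, norm_mul, norm_mul, norm_pow, norm_pow, norm_pow, norm_linConj, norm_inv, norm_real,
    Real.norm_of_nonneg hy.le, h, pow_add]
  ring

theorem summable_norm_lin_pow {n : ℕ} (hn : 3 ≤ n) {w : ℂ} (hw : w ∈ halfPlane) :
    Summable fun v : Pairs => (‖lin v.1 w‖ ^ n)⁻¹ := by
  obtain ⟨r, hr, h⟩ := exists_mul_size_le_norm_lin |w.re| (B := w.im) hw
  refine Summable.of_nonneg_of_le (fun v => by positivity) (fun v => ?_)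
    ((summable_size_pow hn).mul_left (r ^ n)⁻¹)
  rw [← mul_inv, ← mul_pow]
  have := size_pos v
  gcongr
  exact h w le_rfl le_rfl v

/-- For fixed `w` the terms have order `‖lin‖ ^ (|k| - 2N)`, an exponent of at most `-3`. -/
theorem summable_pre_div_quad (k : ℤ) {N : ℕ} (hN : k.natAbs + 3 ≤ 2 * N) {w : ℂ}
    (hw : w ∈ halfPlane) : Summable fun v : Pairs => ‖pre k v.1 w‖ / quad v.1 w ^ N := by
  have hy : 0 < w.im := hw
  obtain ⟨e, he⟩ := Nat.exists_eq_add_of_le (show k.natAbs ≤ 2 * N by omega)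
  refine ((summable_norm_lin_pow (n := e) (by omega) hw).mul_left
    (w.im⁻¹ ^ k.toNat * w.im ^ N)).congr fun v => ?_
  have := norm_lin_pos v hw
  rw [norm_pre k v.1 hw, quad, div_pow, ← pow_mul, he, pow_add]
  field_simp

theorem hasDerivAt_thetaTail (k : ℤ) {t : ℝ} (ht : 0 < t) {w : ℂ} (hw : w ∈ halfPlane) :
    HasDerivAt (thetaTail k w)
      (∑' v : Pairs, pre k v.1 w * (-(Real.pi * quad v.1 w : ℝ) * expo t (quad v.1 w))) t := by
  set N := k.natAbs + 3
  have hN := (summable_pre_div_quad k (N := N) (by omega) hw).mul_left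
    (Real.pi * ((N + 1).factorial / (t / 2) ^ (N + 1)))
  have hterm : ∀ (v : Pairs) (s : ℝ), s ∈ Ioi (t / 2) →
      ‖pre k v.1 w * (-(Real.pi * quad v.1 w : ℝ) * expo s (quad v.1 w))‖ ≤
      Real.pi * ((N + 1).factorial / (t / 2) ^ (N + 1)) * (‖pre k v.1 w‖ / quad v.1 w ^ N) := by
    intro v s hs
    have hs : t / 2 < s := hs
    have hq := quad_pos v hw
    have hpi := Real.pi_pos
    rw [norm_mul, norm_mul, norm_neg, norm_real, Real.norm_of_nonneg (by positivity)]
    calc _ ≤ ‖pre k v.1 w‖ * (Real.pi * quad v.1 w *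
          ((N + 1).factorial / ((t / 2) ^ (N + 1) * quad v.1 w ^ (N + 1)))) := by
          gcongr
          refine (norm_expo_le (N + 1) (by linarith) hq).trans ?_
          gcongr
      _ = _ := by rw [pow_succ (quad v.1 w)]; field_simp
  refine hasDerivAt_tsum_of_isPreconnected hN isOpen_Ioi isPreconnected_Ioi
    (fun v s _ => (hasDerivAt_expo_left s (quad v.1 w)).const_mul (pre k v.1 w)) hterm
    (y₀ := t) (show t / 2 < t by linarith) ?_ (show t / 2 < t by linarith)
  refine Summable.of_norm_bounded ((summable_pre_div_quad k (N := N) (by omega) hw).mul_left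
    (N.factorial / t ^ N)) fun v => ?_
  rw [norm_mul]
  have hq := quad_pos v hw
  calc _ ≤ ‖pre k v.1 w‖ * (N.factorial / (t ^ N * quad v.1 w ^ N)) := by
        gcongr
        exact norm_expo_le N ht hq
    _ = _ := by field_simp

theorem rapidDecay_thetaTail (k : ℤ) {w : ℂ} (hw : w ∈ halfPlane) : RapidDecay (thetaTail k w) where
  meas := by
    refine ContinuousOn.aestronglyMeasurable (fun t ht => ?_) measurableSet_Ioi
    exact (hasDerivAt_thetaTail k (zero_lt_one.trans ht) hw).continuousAt.continuousWithinAt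
  bound N := by
    -- Large enough for the sum over the lattice to converge and at least `N`, so that decay of
    -- order `N` in `t` remains.
    set M := k.natAbs + 3 + N
    have hs := (summable_pre_div_quad k (N := M) (by omega) hw).mul_left (M.factorial : ℝ)
    have hnn : ∀ v : Pairs, 0 ≤ M.factorial * (‖pre k v.1 w‖ / quad v.1 w ^ M) := fun v => by
      have := quad_pos v hw
      positivity
    refine ⟨∑' v : Pairs, M.factorial * (‖pre k v.1 w‖ / quad v.1 w ^ M), tsum_nonneg hnn,
      fun t ht => ?_⟩
    have ht0 : 0 < t := by linarith
    rw [div_eq_mul_inv, ← tsum_mul_right]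
    refine tsum_of_norm_bounded (hs.mul_right _).hasSum fun v => ?_
    rw [norm_mul]
    have hq := quad_pos v hw
    calc _ ≤ ‖pre k v.1 w‖ * (M.factorial / (t ^ M * quad v.1 w ^ M)) := by
          gcongr
          exact norm_expo_le M ht0 hq
      _ ≤ ‖pre k v.1 w‖ * (M.factorial / (t ^ N * quad v.1 w ^ M)) := by
          gcongr
          · exact ht.le
          · omega
      _ = _ := by field_simp

theorem summable_pre_mul_lap (k : ℤ) (n : ℕ) (τ : ℂ) {w : ℂ} (hw : w ∈ halfPlane) :
    Summable fun v : Pairs => pre k v.1 w * lap n τ (quad v.1 w) := by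
  obtain ⟨N₀, h⟩ := exists_norm_lap_le n τ
  obtain ⟨C, hC, hb⟩ := h (N₀ + k.natAbs + 3) (by omega)
  refine Summable.of_norm_bounded ((summable_pre_div_quad k (N := N₀ + k.natAbs + 3)
    (by omega) hw).mul_left C) fun v => ?_
  rw [norm_mul]
  calc _ ≤ ‖pre k v.1 w‖ * (C / quad v.1 w ^ (N₀ + k.natAbs + 3)) := by
        gcongr
        exact hb _ (quad_pos v hw)
    _ = _ := by ring

theorem mellinTail_thetaTail (k : ℤ) (n : ℕ) (τ : ℂ) {w : ℂ} (hw : w ∈ halfPlane) :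
    mellinTail (thetaTail k w) n τ = ∑' v : Pairs, pre k v.1 w * lap n τ (quad v.1 w) := by
  obtain ⟨N₀, h⟩ := integral_norm_lap_integrand_le n τ
  set N := N₀ + k.natAbs + 3
  have key := hasSum_integral_of_summable_integral_norm (μ := volume.restrict (Ioi (1 : ℝ)))
    (F := fun (v : Pairs) (t : ℝ) =>
      pre k v.1 w * (expo t (quad v.1 w) * ((Real.log t : ℝ) : ℂ) ^ n * (t : ℂ) ^ τ))
    (fun v => ((rapidDecay_expo (quad_pos v hw)).integrableOn n τ).const_mul _) ?_
  · rw [mellinTail]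
    have h1 : ∀ v : Pairs, ∫ t in Ioi (1 : ℝ),
        pre k v.1 w * (expo t (quad v.1 w) * ((Real.log t : ℝ) : ℂ) ^ n * (t : ℂ) ^ τ) =
        pre k v.1 w * lap n τ (quad v.1 w) := fun v => integral_const_mul _ _
    simp only [h1] at key
    rw [key.tsum_eq]
    refine setIntegral_congr_fun measurableSet_Ioi fun t _ => ?_
    simp only [thetaTail, ← tsum_mul_right]
    refine tsum_congr fun v => by ring
  · simp only [norm_mul (pre _ _ _), integral_const_mul]
    refine Summable.of_nonneg_of_le (fun v => by positivity) (fun v => ?_)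
      ((summable_pre_div_quad k (N := N) (by omega) hw).mul_left (N.factorial : ℝ))
    calc _ ≤ ‖pre k v.1 w‖ * (N.factorial / quad v.1 w ^ N) := by
          gcongr
          exact h N (by omega) _ (quad_pos v hw)
      _ = _ := by ring

/-- The derivative of the functional equation of the theta series at its fixed point. -/
theorem tsum_pre_mul_expo_one {k : ℤ} (hk : Even k) {w : ℂ} (hw : w ∈ halfPlane) :
    ∑' v : Pairs, pre k v.1 w *
      ((2 * (Real.pi * quad v.1 w) - (k.natAbs + 1)) * expo 1 (quad v.1 w)) = constTerm k := by
  have hd := hasDerivAt_thetaTail k one_pos hw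
  set D := ∑' v : Pairs, pre k v.1 w * (-(Real.pi * quad v.1 w : ℝ) * expo 1 (quad v.1 w)) with hD
  have hsum1 : Summable fun v : Pairs => pre k v.1 w * expo 1 (quad v.1 w) := by
    refine Summable.of_norm_bounded ((summable_pre_div_quad k (N := k.natAbs + 3)
      (by omega) hw).mul_left ((k.natAbs + 3).factorial : ℝ)) fun v => ?_
    rw [norm_mul]
    calc _ ≤ ‖pre k v.1 w‖ * ((k.natAbs + 3).factorial /
          (1 ^ (k.natAbs + 3) * quad v.1 w ^ (k.natAbs + 3))) := by
          gcongr
          exact norm_expo_le _ one_pos (quad_pos v hw)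
      _ = _ := by rw [one_pow]; ring
  have hsum2 : Summable fun v : Pairs =>
      pre k v.1 w * (-(Real.pi * quad v.1 w : ℝ) * expo 1 (quad v.1 w)) := by
    refine Summable.of_norm_bounded ((summable_pre_div_quad k (N := k.natAbs + 3)
      (by omega) hw).mul_left (Real.pi * (k.natAbs + 4).factorial)) fun v => ?_
    have hq := quad_pos v hw
    have hpi := Real.pi_pos
    rw [norm_mul, norm_mul, norm_neg, norm_real, Real.norm_of_nonneg (by positivity)]
    calc _ ≤ ‖pre k v.1 w‖ * (Real.pi * quad v.1 w * ((k.natAbs + 4).factorial /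
          (1 ^ (k.natAbs + 4) * quad v.1 w ^ (k.natAbs + 4)))) := by
          gcongr
          exact norm_expo_le _ one_pos hq
      _ = _ := by rw [one_pow, pow_succ (quad v.1 w) (k.natAbs + 3)]; field_simp
  have hd1 : HasDerivAt (fun t : ℝ => thetaTail k w t⁻¹ + constTerm k) (-D) 1 := by
    have h0 : HasDerivAt (fun t : ℝ => t⁻¹) (-1) 1 := by simpa using hasDerivAt_inv (one_ne_zero (α := ℝ))
    have h1 : HasDerivAt (thetaTail k w) D (1 : ℝ)⁻¹ := by rwa [inv_one]
    simpa using (h1.scomp (1 : ℝ) h0).add_const (constTerm k)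
  have hd2 : HasDerivAt (fun t : ℝ => (t : ℂ) ^ (k.natAbs + 1) * (thetaTail k w t + constTerm k))
      ((k.natAbs + 1) * (thetaTail k w 1 + constTerm k) + D) 1 := by
    have h0 := ((hasDerivAt_id (1 : ℝ)).ofReal_comp).pow (k.natAbs + 1)
    refine (h0.mul (hd.add_const (constTerm k))).congr_deriv ?_
    simp
  -- Both sides of the inversion formula are differentiated at the fixed point `t = 1`.
  have heq : -D = (k.natAbs + 1) * (thetaTail k w 1 + constTerm k) + D := by
    refine HasDerivAt.unique hd1 (hd2.congr_of_eventuallyEq ?_)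
    filter_upwards [Ioi_mem_nhds one_pos] with t ht using thetaTail_inv hk ht hw
  have hδ : (k.natAbs : ℂ) * constTerm k = 0 := by
    rw [constTerm]; split_ifs with h <;> simp [h]
  have hsplit : ∀ v : Pairs, pre k v.1 w *
      ((2 * (Real.pi * quad v.1 w) - (k.natAbs + 1)) * expo 1 (quad v.1 w)) =
      -2 * (pre k v.1 w * (-(Real.pi * quad v.1 w : ℝ) * expo 1 (quad v.1 w)))
      - (k.natAbs + 1) * (pre k v.1 w * expo 1 (quad v.1 w)) := fun v => by push_cast; ring
  simp only [hsplit]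
  rw [(hsum2.mul_left _).tsum_sub (hsum1.mul_left _), tsum_mul_left, tsum_mul_left]
  rw [thetaTail] at heq
  linear_combination heq + hδ

/-! ### The entire continuation -/

theorem cast_eq_toNat_sub (k : ℤ) : (k : ℂ) = k.toNat - (-k).toNat := by
  have : k = (k.toNat : ℤ) - ((-k).toNat : ℤ) := by omega
  exact_mod_cast congrArg (Int.cast : ℤ → ℂ) this

theorem natAbs_eq_toNat_add (k : ℤ) : (k.natAbs : ℂ) = k.toNat + (-k).toNat := by
  have : k.natAbs = k.toNat + (-k).toNat := by omega
  exact_mod_cast congrArg (Nat.cast : ℕ → ℂ) this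

/-- The combination of truncated Mellin transforms of the theta series which is symmetric under
`s ↦ 1 - k - s`, differentiated `n` times in `s`. -/
def symMellin (k : ℤ) (n : ℕ) (s : ℂ) (w : ℂ) : ℂ :=
  mellinTail (thetaTail k w) n (s + k.toNat - 1) +
    (-1) ^ n * mellinTail (thetaTail k w) n (k.natAbs - s - k.toNat)

/-- The distance of `s` from the centre of symmetry `(1 - k) / 2`. -/
def centred (k : ℤ) (s : ℂ) : ℂ := s + k / 2 - 1 / 2

/-- The constant `π ^ (|k| / 2) / 2`. -/
def scale (k : ℤ) : ℂ := ((Real.pi : ℝ) : ℂ) ^ ((k.natAbs : ℂ) / 2) / 2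

/-- The `n`-th derivative in `s` of the entire continuation of the doubly-completed series. -/
def completedDeriv (k : ℤ) (n : ℕ) (s : ℂ) (w : ℂ) : ℂ :=
  (if n = 0 then constTerm k / 2 else 0) +
    scale k * ((centred k s ^ 2 - 1 / 4) * symMellin k n s w
      + 2 * n * centred k s * symMellin k (n - 1) s w
      + n * (n - 1) * symMellin k (n - 2) s w)

theorem hasDerivAt_symMellin (k : ℤ) (n : ℕ) (s : ℂ) {w : ℂ} (hw : w ∈ halfPlane) :
    HasDerivAt (fun s => symMellin k n s w) (symMellin k (n + 1) s w) s := by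
  have hrd := rapidDecay_thetaTail k hw
  have h1 : HasDerivAt (fun s : ℂ => s + k.toNat - 1) 1 s :=
    ((hasDerivAt_id s).add_const _).sub_const _
  have h2 : HasDerivAt (fun s : ℂ => k.natAbs - s - k.toNat) (-1) s :=
    ((hasDerivAt_id s).const_sub _).sub_const _
  have h3 := (hrd.hasDerivAt_mellinTail n _).comp s h1
  have h4 := ((hrd.hasDerivAt_mellinTail n _).comp s h2).const_mul ((-1 : ℂ) ^ n)
  refine (h3.add h4).congr_deriv ?_
  rw [symMellin, pow_succ]; ring

/-- Leibniz's rule stops after three terms because the factor `σ² - 1/4` is quadratic. Truncated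
indices occur only with zero coefficients, hence the separate small cases. -/
theorem hasDerivAt_completedDeriv (k : ℤ) (n : ℕ) (s : ℂ) {w : ℂ} (hw : w ∈ halfPlane) :
    HasDerivAt (fun s => completedDeriv k n s w) (completedDeriv k (n + 1) s w) s := by
  have hc : HasDerivAt (centred k) 1 s := ((hasDerivAt_id s).add_const _).sub_const _
  have hJ := fun n => hasDerivAt_symMellin k n s hw
  have h := ((((hc.pow 2).sub_const (1 / 4)).mul (hJ n)).add
    (((hc.const_mul (2 * n : ℂ)).mul (hJ (n - 1)))) |>.add
    ((hJ (n - 2)).const_mul ((n : ℂ) * (n - 1)))) |>.const_mul (scale k) |>.const_add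
    (if n = 0 then constTerm k / 2 else 0)
  refine h.congr_deriv ?_
  rcases n with _ | _ | n
  · simp [completedDeriv, -mul_eq_mul_left_iff]; ring
  · simp [completedDeriv, -mul_eq_mul_left_iff]; ring
  · simp [completedDeriv, -mul_eq_mul_left_iff]; ring

theorem iteratedDeriv_completedDeriv (k : ℤ) (n : ℕ) {w : ℂ} (hw : w ∈ halfPlane) :
    iteratedDeriv n (fun s => completedDeriv k 0 s w) = fun s => completedDeriv k n s w := by
  induction n with
  | zero => simp
  | succ n ih =>
    rw [iteratedDeriv_succ, ih]
    funext s
    exact (hasDerivAt_completedDeriv k n s hw).deriv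

/-- The functional equation. -/
theorem symMellin_one_sub (k : ℤ) (n : ℕ) (s w : ℂ) :
    symMellin k n (1 - k - s) w = (-1) ^ n * symMellin k n s w := by
  have h1 := cast_eq_toNat_sub k
  have h2 := natAbs_eq_toNat_add k
  rw [symMellin, symMellin,
    show (1 - k - s + k.toNat - 1 : ℂ) = k.natAbs - s - k.toNat by rw [h2, h1]; ring,
    show (k.natAbs - (1 - k - s) - k.toNat : ℂ) = s + k.toNat - 1 by rw [h2, h1]; ring,
    mul_add, ← mul_assoc, ← mul_pow]
  simp [add_comm]

theorem centred_one_sub (k : ℤ) (s : ℂ) : centred k (1 - k - s) = -centred k s := by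
  rw [centred, centred]; ring

theorem completedDeriv_one_sub (k : ℤ) (n : ℕ) (s w : ℂ) :
    completedDeriv k n (1 - k - s) w = (-1) ^ n * completedDeriv k n s w := by
  simp only [completedDeriv, symMellin_one_sub, centred_one_sub]
  rcases n with _ | _ | n
  · simp
  · simp; ring
  · simp [pow_succ]; ring

/-! ### Comparison with the series -/

theorem summable_norm_lin_rpow {e : ℝ} (he : 2 < e) {w : ℂ} (hw : w ∈ halfPlane) :
    Summable fun v : Pairs => ‖lin v.1 w‖ ^ (-e) := by
  have h := EisensteinSeries.summable_one_div_norm_rpow he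
  have h2 := (h.mul_left (EisensteinSeries.r ⟨w, hw⟩ ^ (-e))).comp_injective
    (i := fun v : Pairs => ![v.1.1, v.1.2]) (by
    rintro ⟨⟨a, b⟩, h⟩ ⟨⟨c, d⟩, h'⟩ hab
    have h0 := congrFun hab 0
    have h1 := congrFun hab 1
    simp at h0 h1
    simp [h0, h1])
  refine Summable.of_nonneg_of_le (fun v => by positivity) (fun v => ?_) h2
  have := EisensteinSeries.summand_bound ⟨w, hw⟩ (k := e) (by linarith) ![v.1.1, v.1.2]
  simpa [lin] using this

theorem summable_pre_mul_quad_rpow (k : ℤ) {x : ℝ} (hx : k.natAbs / 2 + 1 < x) {w : ℂ}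
    (hw : w ∈ halfPlane) : Summable fun v : Pairs => ‖pre k v.1 w‖ * quad v.1 w ^ (-x) := by
  have hy : 0 < w.im := hw
  refine ((summable_norm_lin_rpow (e := 2 * x - k.natAbs) (by linarith) hw).mul_left
    (w.im⁻¹ ^ k.toNat * w.im ^ x)).congr fun v => ?_
  have hl := norm_lin_pos v hw
  rw [norm_pre k v.1 hw, quad, Real.div_rpow (by positivity) hy.le, neg_sub, Real.rpow_sub hl,
    ← Real.rpow_natCast (‖lin v.1 w‖) k.natAbs, ← Real.rpow_natCast (‖lin v.1 w‖) 2,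
    ← Real.rpow_mul hl.le, Real.rpow_neg hy.le]
  push_cast
  rw [show (2 : ℝ) * -x = -(2 * x) by ring, Real.rpow_neg hl.le]
  field_simp

/-- Multiplying and dividing by `quad ^ k₊` clears the denominator `lin ^ k` for positive `k` and
moves the Mellin variable to `s + k₊`. -/
theorem term_eq_pre_mul_quad_cpow (k : ℤ) (s : ℂ) (v : Pairs) {w : ℂ} (hw : w ∈ halfPlane) :
    (w.im : ℂ) ^ s / (((‖lin v.1 w‖ : ℝ) : ℂ) ^ (2 * s) * lin v.1 w ^ k) =
      pre k v.1 w * ((quad v.1 w : ℝ) : ℂ) ^ (-(s + k.toNat)) := by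
  have hy : 0 < w.im := hw
  have hl := norm_lin_pos v hw
  have hlc : ((‖lin v.1 w‖ : ℝ) : ℂ) ≠ 0 := ofReal_ne_zero.2 hl.ne'
  have hyc : (w.im : ℂ) ≠ 0 := im_ne_zero hw
  have h0 := lin_ne_zero v hw
  have hq : ((quad v.1 w : ℝ) : ℂ) ^ (-(s + k.toNat)) =
      (w.im : ℂ) ^ s * (w.im : ℂ) ^ k.toNat *
      ((((‖lin v.1 w‖ : ℝ) : ℂ) ^ (2 * s))⁻¹ * ((lin v.1 w * linConj v.1 w) ^ k.toNat)⁻¹) := by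
    have h1 : quad v.1 w = ‖lin v.1 w‖ * (‖lin v.1 w‖ * w.im⁻¹) := by rw [quad]; field_simp
    have hc2 : ((‖lin v.1 w‖ : ℝ) : ℂ) ^ (2 * s) =
      ((‖lin v.1 w‖ : ℝ) : ℂ) ^ s * ((‖lin v.1 w‖ : ℝ) : ℂ) ^ s := by
      rw [two_mul, cpow_add _ _ hlc]
    rw [h1, ofReal_mul, mul_cpow_ofReal_nonneg hl.le (by positivity), ofReal_mul,
      mul_cpow_ofReal_nonneg hl.le (by positivity), hc2, lin_mul_linConj, ofReal_inv,
      inv_cpow _ _ (by rw [arg_ofReal_of_nonneg hy.le]; exact Real.pi_pos.ne), cpow_neg, cpow_neg,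
      inv_inv, cpow_add _ _ hlc, cpow_add _ _ hyc, cpow_natCast, cpow_natCast]
    push_cast
    field_simp
    ring
  rw [hq, pre]
  have hc : linConj v.1 w ≠ 0 := by rw [← conj_lin]; simpa using h0
  have hk : lin v.1 w ^ k = lin v.1 w ^ k.toNat / lin v.1 w ^ (-k).toNat := by
    rw [← zpow_natCast, ← zpow_natCast, ← zpow_sub₀ h0]
    congr 1; omega
  rw [hk, mul_pow, inv_pow]
  have := cpow_ne_zero_iff (x := ((‖lin v.1 w‖ : ℝ) : ℂ)) (y := 2 * s) |>.2 (Or.inl hlc)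
  field_simp

theorem integral_Ioi_expo_mul_cpow {s : ℂ} (hs : 0 < s.re) {q : ℝ} (hq : 0 < q) :
    ∫ t in Ioi (0 : ℝ), expo t q * (t : ℂ) ^ (s - 1) =
      ((Real.pi : ℝ) : ℂ) ^ (-s) * Complex.Gamma s * (q : ℂ) ^ (-s) := by
  have hpi := Real.pi_pos
  have h := Complex.integral_cpow_mul_exp_neg_mul_Ioi hs (r := Real.pi * q) (by positivity)
  have h1 : ∀ t : ℝ, expo t q * (t : ℂ) ^ (s - 1) =
      (t : ℂ) ^ (s - 1) * cexp (-(((Real.pi * q : ℝ) : ℂ) * t)) := by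
    intro t
    rw [expo, ofReal_exp, mul_comm]; push_cast; ring_nf
  simp only [h1, h]
  have hq' : 0 ≤ Real.pi * q := by positivity
  rw [one_div, inv_cpow _ _ (by rw [arg_ofReal_of_nonneg hq']; exact hpi.ne), ofReal_mul,
    mul_cpow_ofReal_nonneg hpi.le hq.le, cpow_neg, cpow_neg, mul_inv]
  ring

theorem integrableOn_expo_mul_cpow {s : ℂ} (hs : 0 < s.re) {q : ℝ} (hq : 0 < q) :
    IntegrableOn (fun t : ℝ => expo t q * (t : ℂ) ^ (s - 1)) (Ioi 0) := by
  by_contra h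
  -- A non-integrable function has integral `0` by convention, whereas the Gamma integral is
  -- nonzero.
  have h0 := integral_undef h
  rw [integral_Ioi_expo_mul_cpow hs hq] at h0
  have hpi : ((Real.pi : ℝ) : ℂ) ≠ 0 := ofReal_ne_zero.2 Real.pi_ne_zero
  have hqc : (q : ℂ) ≠ 0 := ofReal_ne_zero.2 hq.ne'
  simp only [mul_eq_zero, cpow_eq_zero_iff, hpi, hqc, false_and, or_false, false_or] at h0
  exact Gamma_ne_zero_of_re_pos hs h0

theorem integral_norm_expo_mul_cpow {s : ℂ} (hs : 0 < s.re) {q : ℝ} (hq : 0 < q) :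
    ∫ t in Ioi (0 : ℝ), ‖expo t q * (t : ℂ) ^ (s - 1)‖ =
      Real.pi ^ (-s.re) * Real.Gamma s.re * q ^ (-s.re) := by
  have h := integral_Ioi_expo_mul_cpow (s := (s.re : ℂ)) (by simpa using hs) hq
  have h1 : ∀ t ∈ Ioi (0 : ℝ), expo t q * (t : ℂ) ^ ((s.re : ℂ) - 1) =
      ((‖expo t q * (t : ℂ) ^ (s - 1)‖ : ℝ) : ℂ) := by
    intro t ht
    have ht : 0 < t := ht
    rw [norm_mul, norm_expo, expo, norm_cpow_eq_rpow_re_of_pos ht, ofReal_mul, ofReal_cpow ht.le]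
    simp
  rw [setIntegral_congr_fun measurableSet_Ioi h1, integral_complex_ofReal, Complex.Gamma_ofReal,
    ← ofReal_neg, ← ofReal_cpow Real.pi_pos.le, ← ofReal_cpow hq.le] at h
  exact_mod_cast h

/-- Riemann's argument: the Gamma integral turns the series into the Mellin transform of the theta
tail. The part over `t < 1` is inverted, and the constant term produces the two elementary poles. -/
theorem tsum_pre_mul_quad_cpow {k : ℤ} (hk : Even k) {s : ℂ} (hs : k.natAbs / 2 + 1 < s.re) {w : ℂ}
    (hw : w ∈ halfPlane) :
    ((Real.pi : ℝ) : ℂ) ^ (-s) * Complex.Gamma s *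
      ∑' v : Pairs, pre k v.1 w * ((quad v.1 w : ℝ) : ℂ) ^ (-s) =
      mellinTail (thetaTail k w) 0 (s - 1) + mellinTail (thetaTail k w) 0 (k.natAbs - s)
        + constTerm k * (1 / (s - 1) - 1 / s) := by
  have hs0 : 0 < s.re := by
    have : (0 : ℝ) ≤ k.natAbs := Nat.cast_nonneg _
    linarith
  have hint := fun v : Pairs => integrableOn_expo_mul_cpow hs0 (quad_pos v hw)
  set g : Pairs → ℝ → ℂ := fun v t => expo t (quad v.1 w) * (t : ℂ) ^ (s - 1) with hg
  have hsub : Ioo (0 : ℝ) 1 ⊆ Ioi 0 := fun t ht => ht.1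
  have hA : ∀ v : Pairs, ((Real.pi : ℝ) : ℂ) ^ (-s) * Complex.Gamma s *
      (pre k v.1 w * ((quad v.1 w : ℝ) : ℂ) ^ (-s)) =
      (∫ t in Ioo (0 : ℝ) 1, pre k v.1 w * g v t) + pre k v.1 w * lap 0 (s - 1) (quad v.1 w) := by
    intro v
    have h1 := integral_Ioi_expo_mul_cpow hs0 (quad_pos v hw)
    have h2 : ∫ t in Ioi (0 : ℝ), g v t = (∫ t in Ioo (0 : ℝ) 1, g v t) + ∫ t in Ioi (1 : ℝ), g v t := by
      rw [← integral_Ioc_eq_integral_Ioo, ← setIntegral_union (Set.Ioc_disjoint_Ioi le_rfl)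
        measurableSet_Ioi ((hint v).mono_set fun t ht => ht.1)
        ((hint v).mono_set (Ioi_subset_Ioi zero_le_one)), Ioc_union_Ioi_eq_Ioi zero_le_one]
    have h3 : lap 0 (s - 1) (quad v.1 w) = ∫ t in Ioi (1 : ℝ), g v t := by
      simp [lap, mellinTail, hg]
    rw [integral_const_mul, h3, ← mul_add, ← h2, h1]
    ring
  have hB := hasSum_integral_of_summable_integral_norm (μ := volume.restrict (Ioo (0 : ℝ) 1))
    (F := fun (v : Pairs) (t : ℝ) => pre k v.1 w * g v t)
    (fun v => ((hint v).mono_set hsub).const_mul _) (by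
      refine Summable.of_nonneg_of_le (fun v => by positivity) (fun v => ?_)
        ((summable_pre_mul_quad_rpow k hs hw).mul_left (Real.pi ^ (-s.re) * Real.Gamma s.re))
      simp only [norm_mul (pre _ _ _), integral_const_mul]
      calc _ ≤ ‖pre k v.1 w‖ * ∫ t in Ioi (0 : ℝ), ‖g v t‖ := by
            refine mul_le_mul_of_nonneg_left ?_ (norm_nonneg _)
            exact setIntegral_mono_set (hint v).norm (Eventually.of_forall fun _ => norm_nonneg _)
              (LE.le.eventuallyLE hsub)
        _ = _ := by rw [integral_norm_expo_mul_cpow hs0 (quad_pos v hw)]; ring)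
  rw [← tsum_mul_left, tsum_congr hA, hB.summable.tsum_add (summable_pre_mul_lap k 0 (s - 1) hw),
    hB.tsum_eq, ← mellinTail_thetaTail k 0 (s - 1) hw]
  have hC : ∫ t in Ioo (0 : ℝ) 1, ∑' v : Pairs, pre k v.1 w * g v t =
      ∫ t in Ioi (1 : ℝ), thetaTail k w t⁻¹ * (t : ℂ) ^ (-s - 1) := by
    -- The substitution `t ↦ 1/t` on `(0, 1)` is the inversion rule for Mellin transforms, applied
    -- to the tail cut off at `t < 1`.
    have h1 := mellin_comp_inv (indicator (Iio 1) (thetaTail k w)) (-s)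
    rw [neg_neg, mellin, mellin] at h1
    have h2 : ∀ t ∈ Ioi (0 : ℝ), (t : ℂ) ^ (s - 1) • indicator (Iio 1) (thetaTail k w) t =
        indicator (Iio 1) (fun t => ∑' v : Pairs, pre k v.1 w * g v t) t := by
      intro t _
      by_cases h : t ∈ Iio (1 : ℝ)
      · rw [indicator_of_mem h, indicator_of_mem h, thetaTail, smul_eq_mul, mul_comm, ← tsum_mul_right]
        exact tsum_congr fun v => by rw [hg]; ring
      · simp [indicator_of_notMem h]
    have h3 : ∀ t ∈ Ioi (0 : ℝ), (t : ℂ) ^ (-s - 1) • indicator (Iio 1) (thetaTail k w) t⁻¹ =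
        indicator (Ioi 1) (fun t => thetaTail k w t⁻¹ * (t : ℂ) ^ (-s - 1)) t := by
      intro t ht
      have ht : 0 < t := ht
      by_cases h : t ∈ Ioi (1 : ℝ)
      · rw [indicator_of_mem h, indicator_of_mem (show t⁻¹ ∈ Iio (1 : ℝ) from
          (inv_lt_one_of_one_lt₀ (show (1 : ℝ) < t from h) : t⁻¹ < 1)),
          smul_eq_mul, mul_comm]
      · rw [indicator_of_notMem h, indicator_of_notMem, smul_zero]
        simp only [mem_Ioi, not_lt, mem_Iio] at h ⊢
        exact (one_le_inv₀ ht).2 h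
    rw [setIntegral_congr_fun measurableSet_Ioi h2, setIntegral_congr_fun measurableSet_Ioi h3,
      setIntegral_indicator measurableSet_Iio, setIntegral_indicator measurableSet_Ioi,
      Ioi_inter_Iio, inter_eq_right.2 (Ioi_subset_Ioi zero_le_one)] at h1
    exact h1.symm
  have hre : 0 < s.re := hs0
  have hcint : ∀ a : ℂ, a.re < -1 → IntegrableOn (fun t : ℝ => (t : ℂ) ^ a) (Ioi 1) :=
    fun a ha => integrableOn_Ioi_cpow_of_lt ha one_pos
  have hD : ∫ t in Ioi (1 : ℝ), thetaTail k w t⁻¹ * (t : ℂ) ^ (-s - 1) =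
      mellinTail (thetaTail k w) 0 (k.natAbs - s) + constTerm k * (1 / (s - 1) - 1 / s) := by
    have h1 : ∀ t ∈ Ioi (1 : ℝ), thetaTail k w t⁻¹ * (t : ℂ) ^ (-s - 1) =
        thetaTail k w t * ((Real.log t : ℝ) : ℂ) ^ 0 * (t : ℂ) ^ (k.natAbs - s)
          + constTerm k * ((t : ℂ) ^ (-s) - (t : ℂ) ^ (-s - 1)) := by
      intro t ht
      have ht0 : 0 < t := zero_lt_one.trans ht
      have htc : (t : ℂ) ≠ 0 := ofReal_ne_zero.2 ht0.ne'
      have hth := eq_sub_of_add_eq (thetaTail_inv hk ht0 hw)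
      have hδ : constTerm k * (t : ℂ) ^ k.natAbs = constTerm k := by
        rw [constTerm]; split_ifs with h <;> simp [h]
      have e1 : (t : ℂ) ^ (k.natAbs - s) = (t : ℂ) ^ k.natAbs * t * (t : ℂ) ^ (-s - 1) := by
        rw [show (k.natAbs - s : ℂ) = k.natAbs + 1 + (-s - 1) by ring, cpow_add _ _ htc,
          cpow_add _ _ htc, cpow_natCast, cpow_one]
      have e2 : (t : ℂ) ^ (-s) = t * (t : ℂ) ^ (-s - 1) := by
        rw [show (-s : ℂ) = 1 + (-s - 1) by ring, cpow_add _ _ htc, cpow_one]; ring_nf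
      rw [hth, e1, e2]
      linear_combination (t * (t : ℂ) ^ (-s - 1)) * hδ
    rw [setIntegral_congr_fun measurableSet_Ioi h1]
    -- The elementary integrals occur only in weight 0, where the hypothesis says `Re s > 1`;
    -- otherwise their coefficient is zero.
    by_cases hk0 : k = 0
    · have hs1 : 1 < s.re := by subst hk0; simpa using hs
      have i1 := hcint (-s) (by simpa using hs1)
      have i2 := hcint (-s - 1) (by simp; linarith)
      have i3 : Integrable (fun t : ℝ => constTerm k * ((t : ℂ) ^ (-s) - (t : ℂ) ^ (-s - 1)))
        (volume.restrict (Ioi 1)) := (i1.sub i2).const_mul _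
      rw [integral_add ((rapidDecay_thetaTail k hw).integrableOn 0 _) i3,
        integral_const_mul, integral_sub i1 i2, integral_Ioi_cpow_of_lt (by simpa using hs1) one_pos,
        integral_Ioi_cpow_of_lt (by simp; linarith) one_pos, ← mellinTail]
      have hsne : s ≠ 0 := fun h => by simp [h] at hre
      have hsne1 : s - 1 ≠ 0 := fun h => by
        rw [sub_eq_zero.1 h] at hs1; simp at hs1
      have : -s + 1 ≠ 0 := fun h => hsne1 (by linear_combination -h)
      simp only [ofReal_one, one_cpow, sub_add_cancel]
      congr 2
      field_simp
      ring
    · simp only [constTerm, if_neg hk0, zero_mul, add_zero, mellinTail]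
  rw [hC, hD]
  ring

theorem completedDeriv_eq_doublyCompletedSum {k : ℤ} (hk : Even k) (z : ℍ) {s : ℂ}
    (hs : 1 - (k : ℝ) / 2 < s.re) : completedDeriv k 0 s z = doublyCompletedSum k z s := by
  have hz : (z : ℂ) ∈ halfPlane := z.2
  have h1 := cast_eq_toNat_sub k
  have h2 := natAbs_eq_toNat_add k
  have h3 : ((|k| : ℤ) : ℂ) = k.natAbs := by
    rw [Int.abs_eq_natAbs]; simp
  have hK : (k.natAbs : ℝ) / 2 + 1 < (s + k.toNat).re := by
    have e1 : (k : ℝ) = k.toNat - (-k).toNat := by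
      have : k = (k.toNat : ℤ) - ((-k).toNat : ℤ) := by omega
      exact_mod_cast congrArg (Int.cast : ℤ → ℝ) this
    have e2 : (k.natAbs : ℝ) = k.toNat + (-k).toNat := by
      have : k.natAbs = k.toNat + (-k).toNat := by omega
      exact_mod_cast congrArg (Nat.cast : ℕ → ℝ) this
    simp only [add_re, natCast_re]
    rw [e2]; rw [e1] at hs; linarith
  have key := tsum_pre_mul_quad_cpow hk hK hz
  have hE : eisensteinSum k z s =
      1 / 2 * ∑' v : Pairs, pre k v.1 z * ((quad v.1 z : ℝ) : ℂ) ^ (-(s + k.toNat)) := by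
    rw [eisensteinSum]
    congr 1
    exact tsum_congr fun v => term_eq_pre_mul_quad_cpow k s v hz
  have hpi : ((Real.pi : ℝ) : ℂ) ≠ 0 := ofReal_ne_zero.2 Real.pi_ne_zero
  have hpow : ((Real.pi : ℝ) : ℂ) ^ (-s - (k : ℂ) / 2) =
      ((Real.pi : ℝ) : ℂ) ^ (-(s + k.toNat)) * ((Real.pi : ℝ) : ℂ) ^ ((k.natAbs : ℂ) / 2) := by
    rw [← cpow_add _ _ hpi]; congr 1; rw [h2, h1]; ring
  have hG : s + (k : ℂ) / 2 + ((|k| : ℤ) : ℂ) / 2 = s + k.toNat := by rw [h3, h2, h1]; ring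
  rw [doublyCompletedSum, hE, hpow, hG]
  -- In weight 0 the quadratic factor is `s(s - 1)`, cancelling `1/(s - 1) - 1/s`, and `2 * scale k
  -- = 1`. In other weights both sides vanish.
  have hδ : constTerm k = (centred k s ^ 2 - 1 / 4) *
      (constTerm k * (1 / (s + k.toNat - 1) - 1 / (s + k.toNat))) * (2 * scale k) := by
    rw [constTerm]
    split_ifs with h0
    · subst h0
      have hs1 : 1 < s.re := by simpa using hs
      have hsne : s ≠ 0 := fun h => by simp [h] at hs1; linarith
      have hsne1 : s - 1 ≠ 0 := fun h => by rw [sub_eq_zero.1 h] at hs1; simp at hs1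
      simp [centred, scale]
      field_simp
      ring
    · simp
  have hlhs : completedDeriv k 0 s z = constTerm k / 2 + scale k * ((centred k s ^ 2 - 1 / 4) *
      (mellinTail (thetaTail k z) 0 (s + k.toNat - 1) +
        mellinTail (thetaTail k z) 0 (k.natAbs - (s + k.toNat)))) := by
    simp [completedDeriv, symMellin, sub_sub]
  have hc : (s + (k : ℂ) / 2) * (s + (k : ℂ) / 2 - 1) = centred k s ^ 2 - 1 / 4 := by
    rw [centred]; ring
  have hsc : ((Real.pi : ℝ) : ℂ) ^ ((k.natAbs : ℂ) / 2) = 2 * scale k := by rw [scale]; ring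
  rw [hlhs, hc, hsc]
  linear_combination (1 / 2) * hδ - scale k * (centred k s ^ 2 - 1 / 4) * key

theorem isEntireContinuation_completedDeriv {k : ℤ} (hk : Even k) (z : ℍ) :
    IsEntireContinuation k z (fun s => completedDeriv k 0 s z) :=
  ⟨fun s => (hasDerivAt_completedDeriv k 0 s z.2).differentiableAt,
    fun _ hs => completedDeriv_eq_doublyCompletedSum hk z hs⟩

/-- Replaces the abstractly continued function by the explicit formula, to which all later arguments
refer. -/
theorem taylorCoeff_eq {k : ℤ} (hk : Even k) (n : ℕ) (s₀ : ℂ) :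
    taylorCoeff k n s₀ = fun z : ℍ => completedDeriv k n s₀ z := by
  funext z
  rw [taylorCoeff, (isEntireContinuation_completedDeriv hk z).eq_doublyCompletedEisenstein,
    iteratedDeriv_completedDeriv k n z.2]

/-! ### The Laplacian -/

/-- The weight `k` Laplacian on functions on `ℂ`. -/
def laplace (k : ℤ) (f : ℂ → ℂ) (w : ℂ) : ℂ :=
  (w.im : ℂ) ^ 2 * (dX (dX f) w + dY (dY f) w) - I * k * w.im * (dX f w + I * dY f w)

/-- Smoothness on the upper half-plane. -/
abbrev SmoothOn (f : ℂ → ℂ) : Prop := ContDiffOn ℝ ∞ f halfPlane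

theorem dX_add {f g : ℂ → ℂ} (hf : SmoothOn f) (hg : SmoothOn g) :
    EqOn (dX fun z => f z + g z) (fun z => dX f z + dX g z) halfPlane := fun _ hw =>
  ((hf.differentiableAt_halfPlane hw).hasGrad.add (hg.differentiableAt_halfPlane hw).hasGrad).dX

theorem dY_add {f g : ℂ → ℂ} (hf : SmoothOn f) (hg : SmoothOn g) :
    EqOn (dY fun z => f z + g z) (fun z => dY f z + dY g z) halfPlane := fun _ hw =>
  ((hf.differentiableAt_halfPlane hw).hasGrad.add (hg.differentiableAt_halfPlane hw).hasGrad).dY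

theorem dX_const_mul {f : ℂ → ℂ} (c : ℂ) (hf : SmoothOn f) :
    EqOn (dX fun z => c * f z) (fun z => c * dX f z) halfPlane := fun _ hw =>
  ((hf.differentiableAt_halfPlane hw).hasGrad.const_mul c).dX

theorem dY_const_mul {f : ℂ → ℂ} (c : ℂ) (hf : SmoothOn f) :
    EqOn (dY fun z => c * f z) (fun z => c * dY f z) halfPlane := fun _ hw =>
  ((hf.differentiableAt_halfPlane hw).hasGrad.const_mul c).dY

theorem laplace_congr (k : ℤ) {f g : ℂ → ℂ} (h : EqOn f g halfPlane) :
    EqOn (laplace k f) (laplace k g) halfPlane := fun w hw => by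
  rw [laplace, laplace, h.dX_eq.dX_eq hw, h.dY_eq.dY_eq hw, h.dX_eq hw, h.dY_eq hw]

theorem laplace_add (k : ℤ) {f g : ℂ → ℂ} (hf : SmoothOn f) (hg : SmoothOn g) {w : ℂ}
    (hw : w ∈ halfPlane) :
    laplace k (fun z => f z + g z) w = laplace k f w + laplace k g w := by
  rw [laplace, laplace, laplace, (dX_add hf hg).dX_eq hw, (dY_add hf hg).dY_eq hw,
    dX_add hf hg hw, dY_add hf hg hw, dX_add (contDiffOn_dX hf) (contDiffOn_dX hg) hw,
    dY_add (contDiffOn_dY hf) (contDiffOn_dY hg) hw]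
  ring

theorem laplace_const_mul (k : ℤ) {f : ℂ → ℂ} (c : ℂ) (hf : SmoothOn f) {w : ℂ}
    (hw : w ∈ halfPlane) : laplace k (fun z => c * f z) w = c * laplace k f w := by
  rw [laplace, laplace, (dX_const_mul c hf).dX_eq hw, (dY_const_mul c hf).dY_eq hw,
    dX_const_mul c hf hw, dY_const_mul c hf hw, dX_const_mul c (contDiffOn_dX hf) hw,
    dY_const_mul c (contDiffOn_dY hf) hw]
  ring

theorem laplace_const (k : ℤ) (c w : ℂ) : laplace k (fun _ => c) w = 0 := by
  have h1 : dX (fun _ => c) = fun _ => 0 := funext fun w => (hasGrad_const c w).dX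
  have h2 : dY (fun _ => c) = fun _ => 0 := funext fun w => (hasGrad_const c w).dY
  rw [laplace, h1, h2, (hasGrad_const 0 w).dX, (hasGrad_const 0 w).dY]
  ring

theorem contDiffOn_laplace (k : ℤ) {f : ℂ → ℂ} (hf : SmoothOn f) : SmoothOn (laplace k f) := by
  have h1 := contDiffOn_dX hf
  have h2 := contDiffOn_dY hf
  exact ((contDiffOn_im.pow 2).mul ((contDiffOn_dX h1).add (contDiffOn_dY h2))).sub
    ((contDiffOn_const.mul contDiffOn_im).mul (h1.add (contDiffOn_const.mul h2)))

theorem laplace_tsum (k : ℤ) {ι : Type*} {u : ι → ℂ → ℂ} (hu : TermwiseSmooth 2 u) {w : ℂ}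
    (hw : w ∈ halfPlane) :
    laplace k (fun z => ∑' i, u i z) w = ∑' i, laplace k (u i) w := by
  have hX : EqOn (dX fun z => ∑' i, u i z) (fun z => ∑' i, dX (u i) z) halfPlane :=
    fun z hz => (hu.hasGrad_tsum hz).dX
  have hY : EqOn (dY fun z => ∑' i, u i z) (fun z => ∑' i, dY (u i) z) halfPlane :=
    fun z hz => (hu.hasGrad_tsum hz).dY
  have s1 := hu.2.1.locallySummable.summable hw
  have s2 := hu.2.2.locallySummable.summable hw
  have s3 := hu.2.1.2.1.locallySummable.summable hw
  have s4 := hu.2.2.2.2.locallySummable.summable hw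
  rw [laplace, hX.dX_eq hw, hY.dY_eq hw, hX hw, hY hw, (hu.2.1.hasGrad_tsum hw).dX,
    (hu.2.2.hasGrad_tsum hw).dY, ← s3.tsum_add s4, ← tsum_mul_left, ← tsum_mul_left,
    ← s1.tsum_add (s2.mul_left I), ← tsum_mul_left,
    ← ((s3.add s4).mul_left _).tsum_sub ((s1.add (s2.mul_left I)).mul_left _)]
  rfl

/-- The Laplacian of the slash translate of a function of the imaginary part. -/
theorem laplace_lin_zpow_mul (k : ℤ) (v : Pairs) {H H₁ H₂ : ℝ → ℂ}
    (h1 : ∀ q > 0, HasDerivAt H (H₁ q) q) (h2 : ∀ q > 0, HasDerivAt H₁ (H₂ q) q) {w : ℂ}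
    (hw : w ∈ halfPlane) :
    laplace k (fun z => lin v.1 z ^ (-k) * H (quad v.1 z)) w =
      lin v.1 w ^ (-k) * (quad v.1 w ^ 2 * H₂ (quad v.1 w)
        + (2 - k) * quad v.1 w * H₁ (quad v.1 w)) := by
  -- For primitive `v` the function is the weight `k` translate of `y ↦ H(1/y)`, on which `Δ_k = y²
  -- ∂_y² + k y ∂_y` becomes the stated operator in `q = 1/y`. As `v` need not be primitive, the
  -- identity is checked by direct differentiation.
  set X : ℂ → ℂ := fun z => v.1.1 * (lin v.1 z + linConj v.1 z) * (z.im : ℂ)⁻¹ with hX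
  set Y : ℂ → ℂ := fun z => I * v.1.1 * (linConj v.1 z - lin v.1 z) * (z.im : ℂ)⁻¹ -
    lin v.1 z * linConj v.1 z * ((z.im : ℂ)⁻¹ ^ 2) with hY
  have hQ : ∀ z ∈ halfPlane, HasGrad (fun z => ((quad v.1 z : ℝ) : ℂ)) z (X z) (Y z) :=
    fun z hz => (hasGrad_quad v.1 hz).congr (by rw [hX]; ring) (by rw [hY]; ring)
  have hA : ∀ (n : ℤ), ∀ z ∈ halfPlane, HasGrad (fun z => lin v.1 z ^ n) z
      (n * lin v.1 z ^ (n - 1) * v.1.1) (n * lin v.1 z ^ (n - 1) * (I * v.1.1)) :=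
    fun n z hz => (hasGrad_lin v.1 z).zpow (lin_ne_zero v hz) n
  have hH : ∀ z ∈ halfPlane, HasGrad (fun z => H (quad v.1 z)) z (H₁ (quad v.1 z) * X z)
      (H₁ (quad v.1 z) * Y z) := fun z hz => HasGrad.comp_real (h1 _ (quad_pos v hz)) (hQ z hz)
  have hH₁ : ∀ z ∈ halfPlane, HasGrad (fun z => H₁ (quad v.1 z)) z (H₂ (quad v.1 z) * X z)
      (H₂ (quad v.1 z) * Y z) := fun z hz => HasGrad.comp_real (h2 _ (quad_pos v hz)) (hQ z hz)
  have hyi := (hasGrad_im w).inv (im_ne_zero hw)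
  have hXg := (((hasGrad_lin v.1 w).add (hasGrad_linConj v.1 w)).const_mul (v.1.1 : ℂ)).mul hyi
  have hYg := ((((hasGrad_linConj v.1 w).sub (hasGrad_lin v.1 w)).const_mul (I * v.1.1)).mul hyi).sub
    (((hasGrad_lin v.1 w).mul (hasGrad_linConj v.1 w)).mul (hyi.pow 2))
  have hf := fun z hz => (hA (-k) z hz).mul (hH z hz)
  have hdX := Set.EqOn.dX_eq (fun z hz => (hf z hz).dX) hw
  have hdY := Set.EqOn.dY_eq (fun z hz => (hf z hz).dY) hw
  have hgX := ((hA (-k) w hw).mul ((hH₁ w hw).mul hXg)).add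
    ((hH w hw).mul (((hA (-k - 1) w hw).const_mul ((-k : ℤ) : ℂ)).mul (hasGrad_const v.1.1 w)))
  have hgY := ((hA (-k) w hw).mul ((hH₁ w hw).mul hYg)).add
    ((hH w hw).mul (((hA (-k - 1) w hw).const_mul ((-k : ℤ) : ℂ)).mul (hasGrad_const (I * v.1.1) w)))
  rw [laplace, hdX, hdY, (hf w hw).dX, (hf w hw).dY, hgX.dX, hgY.dY]
  have hl := lin_ne_zero v hw
  have hy := im_ne_zero hw
  rw [zpow_sub_one₀ hl (-k - 1), zpow_sub_one₀ hl (-k)]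
  rw [ofReal_quad]
  simp only [hX, hY]
  generalize H (quad v.1 w) = a
  generalize H₁ (quad v.1 w) = b
  generalize H₂ (quad v.1 w) = c
  generalize lin v.1 w ^ (-k) = L
  rw [linConj_eq]
  generalize lin v.1 w = A at hl ⊢
  push_cast
  field_simp
  ring_nf
  have e2 : I ^ 2 = -1 := I_sq
  have e3 : I ^ 3 = -I := by rw [pow_succ, e2]; ring
  have e4 : I ^ 4 = 1 := I_pow_four
  simp only [e2, e3, e4]
  ring

theorem pre_eq (k : ℤ) (v : Pairs) {w : ℂ} (hw : w ∈ halfPlane) :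
    pre k v.1 w = lin v.1 w ^ (-k) * ((quad v.1 w : ℝ) : ℂ) ^ k.toNat := by
  have h0 := lin_ne_zero v hw
  have hk : lin v.1 w ^ (-k) = lin v.1 w ^ (-k).toNat / lin v.1 w ^ k.toNat := by
    rw [← zpow_natCast, ← zpow_natCast, ← zpow_sub₀ h0]
    congr 1; omega
  have hy := im_ne_zero hw
  rw [pre, hk, ofReal_quad, div_pow, mul_pow, inv_pow]
  field_simp

theorem natCast_toNat_mul (k : ℤ) : (k.toNat : ℂ) * ((-k).toNat : ℂ) = 0 := by
  rcases le_total 0 k with h | h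
  · rw [show (-k).toNat = 0 by omega]; simp
  · rw [show k.toNat = 0 by omega]; simp

/-- As `pre` is `lin ^ (-k) * quad ^ k₊`, the radial formula applies to `H(q) = q ^ k₊ φ(q)`; the
products of `k₊` and `(-k)₊` vanish. -/
theorem laplace_pre_mul (k : ℤ) (v : Pairs) {φ : ℕ → ℝ → ℂ} (hφ : IsKernel φ) {w : ℂ}
    (hw : w ∈ halfPlane) :
    laplace k (fun z => pre k v.1 z * φ 0 (quad v.1 z)) w =
      pre k v.1 w * (quad v.1 w ^ 2 * φ 2 (quad v.1 w)
        + (k.natAbs + 2) * (quad v.1 w * φ 1 (quad v.1 w)) + k.toNat * φ 0 (quad v.1 w)) := by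
  have hpow : ∀ q : ℝ, q > 0 → HasDerivAt (fun q : ℝ => (q : ℂ) ^ k.toNat)
      (k.toNat * (q : ℂ) ^ k.toNat * (q : ℂ)⁻¹) q := by
    intro q hq
    have hqc : (q : ℂ) ≠ 0 := ofReal_ne_zero.2 (ne_of_gt hq)
    refine ((hasDerivAt_id q).ofReal_comp.pow k.toNat).congr_deriv ?_
    rcases k.toNat with _ | n
    · simp
    · simp [pow_succ]; field_simp
  have hinv : ∀ q : ℝ, q > 0 → HasDerivAt (fun q : ℝ => (q : ℂ)⁻¹) (-((q : ℂ) ^ 2)⁻¹) q := by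
    intro q hq
    exact (hasDerivAt_inv (ofReal_ne_zero.2 (ne_of_gt hq))).comp_ofReal
  have h1 : ∀ q : ℝ, q > 0 → HasDerivAt (fun q : ℝ => (q : ℂ) ^ k.toNat * φ 0 q)
      ((q : ℂ) ^ k.toNat * φ 1 q + φ 0 q * (k.toNat * (q : ℂ) ^ k.toNat * (q : ℂ)⁻¹)) q :=
    fun q hq => ((hpow q hq).mul (hφ.hasDerivAt 0 q hq)).congr_deriv (by ring)
  have h2 : ∀ q : ℝ, q > 0 → HasDerivAt (fun q : ℝ => (q : ℂ) ^ k.toNat * φ 1 q +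
      φ 0 q * (k.toNat * (q : ℂ) ^ k.toNat * (q : ℂ)⁻¹))
      ((q : ℂ) ^ k.toNat * (φ 2 q + 2 * k.toNat * (q : ℂ)⁻¹ * φ 1 q +
        (k.toNat * k.toNat - k.toNat) * ((q : ℂ) ^ 2)⁻¹ * φ 0 q)) q := by
    intro q hq
    have hqc : (q : ℂ) ≠ 0 := ofReal_ne_zero.2 (ne_of_gt hq)
    refine (((hpow q hq).mul (hφ.hasDerivAt 1 q hq)).add ((hφ.hasDerivAt 0 q hq).mul
      (((hpow q hq).const_mul (k.toNat : ℂ)).mul (hinv q hq)))).congr_deriv ?_ |>.congr_of_eventuallyEq ?_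
    · simp only [Pi.mul_apply]
      field_simp
      ring
    · exact Eventually.of_forall fun q => by simp
  have hcongr : EqOn (fun z => pre k v.1 z * φ 0 (quad v.1 z)) (fun z => lin v.1 z ^ (-k) *
      ((quad v.1 z : ℂ) ^ k.toNat * φ 0 (quad v.1 z))) halfPlane := fun z hz => by
    simp only [pre_eq k v hz, mul_assoc]
  rw [laplace_congr k hcongr hw, laplace_lin_zpow_mul k v h1 h2 hw, pre_eq k v hw]
  generalize lin v.1 w ^ (-k) = L
  have hq : ((quad v.1 w : ℝ) : ℂ) ≠ 0 := ofReal_ne_zero.2 (quad_pos v hw).ne'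
  generalize ((quad v.1 w : ℝ) : ℂ) = Q at hq ⊢
  rw [natAbs_eq_toNat_add, cast_eq_toNat_sub k]
  have hpq := natCast_toNat_mul k
  field_simp
  linear_combination (L * φ 0 (quad v.1 w)) * hpq

/-- The effect of the radial part of the Laplacian on the kernel functions. -/
theorem radial_lap (K p : ℂ) (n : ℕ) (τ : ℂ) {q : ℝ} (hq : 0 < q) :
    (q : ℂ) ^ 2 * ((-Real.pi : ℂ) ^ 2 * lap n (τ + 2) q)
        + (K + 2) * (q * ((-Real.pi : ℂ) * lap n (τ + 1) q)) + p * lap n τ q =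
      ((τ + 1) * (τ - K) + p) * lap n τ q + n * (2 * τ + 1 - K) * lap (n - 1) τ q
        + n * (n - 1) * lap (n - 2) τ q
        + (if n = 0 then Real.pi * q + τ - K else if n = 1 then 1 else 0) * expo 1 q := by
  have h1 := pi_mul_lap_add_one n τ hq
  have h2 := pi_mul_lap_add_one n (τ + 1) hq
  -- Needed because the second integration by parts leaves `n * lap (n - 1) (τ + 1) q`.
  have h3 := pi_mul_lap_add_one (n - 1) τ hq
  rw [show τ + 1 + 1 = τ + 2 by ring] at h2
  rcases n with _ | _ | n
  · simp only [Nat.cast_zero, zero_mul, if_true, add_zero] at h1 h2 ⊢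
    linear_combination (Real.pi * q : ℂ) * h2 + (τ + 2 - K - 2) * h1
  · simp at h1 h2 h3 ⊢
    linear_combination (Real.pi * q : ℂ) * h2 + (τ + 2 - K - 2) * h1 + h3
  · simp at h1 h2 h3 ⊢
    linear_combination (Real.pi * q : ℂ) * h2 + (τ + 2 - K - 2) * h1 + (n + 1 + 1) * h3

/-- The lattice sum of `lap n τ`. -/
def lapSum (k : ℤ) (n : ℕ) (τ : ℂ) (w : ℂ) : ℂ := ∑' v : Pairs, pre k v.1 w * lap n τ (quad v.1 w)

theorem contDiffOn_im_inv_pow (n : ℕ) : SmoothOn fun w => (w.im : ℂ)⁻¹ ^ n := contDiffOn_im_inv.pow n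

theorem termwiseSmooth_pre_mul (k : ℤ) {φ : ℕ → ℝ → ℂ} (hφ : IsKernel φ) (n : ℕ) :
    TermwiseSmooth n fun (v : Pairs) w => pre k v.1 w * φ 0 (quad v.1 w) :=
  (termwiseSmooth_latticeTerm hφ n 0 (-k).toNat k.toNat 0 (contDiffOn_im_inv_pow k.toNat)).congr
    fun v w _ => by simp [latticeTerm, pre]

theorem termwiseSmooth_pre_mul_lap (k : ℤ) (n : ℕ) (τ : ℂ) (N : ℕ) :
    TermwiseSmooth N fun (v : Pairs) w => pre k v.1 w * lap n τ (quad v.1 w) :=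
  (termwiseSmooth_pre_mul k (isKernel_lap n τ) N).congr fun v w _ => by simp

theorem contDiffOn_lapSum (k : ℤ) (n : ℕ) (τ : ℂ) : SmoothOn (lapSum k n τ) :=
  contDiffOn_tsum fun N => termwiseSmooth_pre_mul_lap k n τ N

/-- The sum of `π Q exp (-π Q)` over the lattice. -/
def thetaMoment (k : ℤ) (w : ℂ) : ℂ :=
  ∑' v : Pairs, pre k v.1 w * (Real.pi * quad v.1 w * expo 1 (quad v.1 w))

theorem summable_thetaTail_one (k : ℤ) {w : ℂ} (hw : w ∈ halfPlane) :
    Summable fun v : Pairs => pre k v.1 w * expo 1 (quad v.1 w) :=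
  ((termwiseSmooth_pre_mul k (isKernel_expo one_pos) 0).locallySummable.summable hw).congr
    fun v => by simp

theorem summable_thetaMoment (k : ℤ) {w : ℂ} (hw : w ∈ halfPlane) :
    Summable fun v : Pairs => pre k v.1 w * (Real.pi * quad v.1 w * expo 1 (quad v.1 w)) := by
  have hT := termwiseSmooth_latticeTerm (isKernel_expo one_pos) 0 0 ((-k).toNat + 1) (k.toNat + 1) 1
    (contDiffOn_im_inv_pow (k.toNat + 1))
  refine ((hT.locallySummable.summable hw).mul_left (-1)).congr fun v => ?_
  have hy := im_ne_zero hw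
  rw [latticeTerm, pre, ofReal_quad, inv_pow, inv_pow, pow_succ (w.im : ℂ)]
  push_cast
  field_simp
  ring

theorem two_mul_thetaMoment_sub {k : ℤ} (hk : Even k) {w : ℂ} (hw : w ∈ halfPlane) :
    2 * thetaMoment k w - (k.natAbs + 1) * thetaTail k w 1 = constTerm k := by
  rw [← tsum_pre_mul_expo_one hk hw, thetaMoment, thetaTail, ← tsum_mul_left, ← tsum_mul_left,
    ← ((summable_thetaMoment k hw).mul_left _).tsum_sub ((summable_thetaTail_one k hw).mul_left _)]
  exact tsum_congr fun v => by ring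

/-- The last bracket collects the boundary terms at `t = 1`, which sum to values of theta series
there. -/
theorem laplace_lapSum (k : ℤ) (n : ℕ) (τ : ℂ) {w : ℂ} (hw : w ∈ halfPlane) :
    laplace k (lapSum k n τ) w =
      ((τ + 1) * (τ - k.natAbs) + k.toNat) * lapSum k n τ w
        + n * (2 * τ + 1 - k.natAbs) * lapSum k (n - 1) τ w
        + n * (n - 1) * lapSum k (n - 2) τ w
        + (if n = 0 then thetaMoment k w + (τ - k.natAbs) * thetaTail k w 1
            else if n = 1 then thetaTail k w 1 else 0) := by
  have hterm : ∀ v : Pairs, laplace k (fun z => pre k v.1 z * lap n τ (quad v.1 z)) w =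
      ((τ + 1) * (τ - k.natAbs) + k.toNat) * (pre k v.1 w * lap n τ (quad v.1 w))
        + n * (2 * τ + 1 - k.natAbs) * (pre k v.1 w * lap (n - 1) τ (quad v.1 w))
        + n * (n - 1) * (pre k v.1 w * lap (n - 2) τ (quad v.1 w))
        + (if n = 0 then pre k v.1 w * (Real.pi * quad v.1 w * expo 1 (quad v.1 w))
              + (τ - k.natAbs) * (pre k v.1 w * expo 1 (quad v.1 w))
            else if n = 1 then pre k v.1 w * expo 1 (quad v.1 w) else 0) := by
    intro v
    have h := laplace_pre_mul k v (isKernel_lap n τ) hw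
    have hr := radial_lap k.natAbs k.toNat n τ (quad_pos v hw)
    simp only [pow_zero, one_mul, Nat.cast_zero, add_zero, pow_one, Nat.cast_one,
      Nat.cast_ofNat] at h
    rw [h, hr]
    split_ifs <;> ring
  have s1 := summable_pre_mul_lap k n τ hw
  have s2 := summable_pre_mul_lap k (n - 1) τ hw
  have s3 := summable_pre_mul_lap k (n - 2) τ hw
  have s4 := summable_thetaTail_one k hw
  have s5 := summable_thetaMoment k hw
  unfold lapSum
  rw [laplace_tsum k (termwiseSmooth_pre_mul_lap k n τ 2) hw, tsum_congr hterm]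
  have s6 : HasSum (fun v : Pairs =>
      if n = 0 then pre k v.1 w * (Real.pi * quad v.1 w * expo 1 (quad v.1 w))
              + (τ - k.natAbs) * (pre k v.1 w * expo 1 (quad v.1 w))
            else if n = 1 then pre k v.1 w * expo 1 (quad v.1 w) else 0)
      (if n = 0 then thetaMoment k w + (τ - k.natAbs) * thetaTail k w 1
            else if n = 1 then thetaTail k w 1 else 0) := by
    split_ifs
    · exact s5.hasSum.add (s4.hasSum.mul_left _)
    · exact s4.hasSum
    · exact hasSum_zero
  exact ((((s1.hasSum.mul_left _).add (s2.hasSum.mul_left _)).add (s3.hasSum.mul_left _)).add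
    s6).tsum_eq

theorem symMellin_eq (k : ℤ) (n : ℕ) (s : ℂ) :
    EqOn (symMellin k n s) (fun w => lapSum k n (s + k.toNat - 1) w +
      (-1) ^ n * lapSum k n (k.natAbs - s - k.toNat) w) halfPlane := fun w hw => by
  simp only [symMellin, mellinTail_thetaTail k n _ hw, lapSum]

theorem contDiffOn_symMellin (k : ℤ) (n : ℕ) (s : ℂ) : SmoothOn (symMellin k n s) :=
  ((contDiffOn_lapSum k n _).add (contDiffOn_const.mul (contDiffOn_lapSum k n _))).congr
    (symMellin_eq k n s)

/-- The two exponents give the same eigenvalue and opposite values of `2τ + 1 - |k|`, which the sign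
`(-1) ^ n` reconciles. The boundary terms for `n = 0` add up to the differentiated inversion
formula; those for `n = 1` cancel. -/
theorem laplace_symMellin {k : ℤ} (hk : Even k) (n : ℕ) (s : ℂ) {w : ℂ} (hw : w ∈ halfPlane) :
    laplace k (symMellin k n s) w = s * (s + k - 1) * symMellin k n s w
      + 2 * n * centred k s * symMellin k (n - 1) s w + n * (n - 1) * symMellin k (n - 2) s w
      + (if n = 0 then constTerm k else 0) := by
  rw [laplace_congr k (symMellin_eq k n s) hw, laplace_add k (contDiffOn_lapSum k n _)
    (contDiffOn_const.mul (contDiffOn_lapSum k n _)) hw, laplace_const_mul k _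
    (contDiffOn_lapSum k n _) hw, laplace_lapSum k n _ hw, laplace_lapSum k n _ hw,
    symMellin_eq k n s hw, symMellin_eq k (n - 1) s hw, symMellin_eq k (n - 2) s hw, centred]
  have hθ := two_mul_thetaMoment_sub hk hw
  have hpq := natCast_toNat_mul k
  rw [natAbs_eq_toNat_add] at hθ
  rw [natAbs_eq_toNat_add, cast_eq_toNat_sub k]
  rcases n with _ | _ | n
  · simp only [if_true, Nat.cast_zero, pow_zero]
    linear_combination hθ - (lapSum k 0 (s + k.toNat - 1) w +
      lapSum k 0 (k.toNat + (-k).toNat - s - k.toNat) w) * hpq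
  · simp
    linear_combination -(lapSum k 1 (s + k.toNat - 1) w -
      lapSum k 1 (k.toNat + (-k).toNat - s - k.toNat) w) * hpq
  · simp [pow_succ]
    linear_combination -(lapSum k (n + 1 + 1) (s + k.toNat - 1) w + (-1) ^ n *
      lapSum k (n + 1 + 1) (k.toNat + (-k).toNat - s - k.toNat) w) * hpq

theorem contDiffOn_completedDeriv (k : ℤ) (n : ℕ) (s : ℂ) : SmoothOn (completedDeriv k n s) :=
  contDiffOn_const.add (contDiffOn_const.mul (((contDiffOn_const.mul (contDiffOn_symMellin k n s)).add
    (contDiffOn_const.mul (contDiffOn_symMellin k (n - 1) s))).add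
      (contDiffOn_const.mul (contDiffOn_symMellin k (n - 2) s))))

/-- This is the eigenvalue equation differentiated `n` times in `s`: the eigenvalue has derivatives
`2σ` and `2`. In weight 0 the added constant `1/2` compensates the inhomogeneous term of
`laplace_symMellin`. -/
theorem laplace_completedDeriv {k : ℤ} (hk : Even k) (n : ℕ) (s : ℂ) {w : ℂ} (hw : w ∈ halfPlane) :
    laplace k (completedDeriv k n s) w - s * (s + k - 1) * completedDeriv k n s w =
      2 * n * centred k s * completedDeriv k (n - 1) s w
        + n * (n - 1) * completedDeriv k (n - 2) s w := by
  have hJ := fun n => contDiffOn_symMellin k n s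
  have hL := fun n => laplace_symMellin hk n s hw
  have h1 : laplace k (completedDeriv k n s) w =
      scale k * ((centred k s ^ 2 - 1 / 4) * laplace k (symMellin k n s) w
      + 2 * n * centred k s * laplace k (symMellin k (n - 1) s) w
      + n * (n - 1) * laplace k (symMellin k (n - 2) s) w) := by
    have a1 := contDiffOn_const (c := centred k s ^ 2 - 1 / 4) |>.mul (hJ n)
    have a2 := contDiffOn_const (c := 2 * n * centred k s) |>.mul (hJ (n - 1))
    have a3 := contDiffOn_const (c := (n : ℂ) * (n - 1)) |>.mul (hJ (n - 2))
    unfold completedDeriv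
    rw [laplace_add k contDiffOn_const (contDiffOn_const.mul ((a1.add a2).add a3)) hw,
      laplace_const, laplace_const_mul k _ ((a1.add a2).add a3) hw,
      laplace_add k (a1.add a2) a3 hw, laplace_add k a1 a2 hw, laplace_const_mul k _ (hJ n) hw,
      laplace_const_mul k _ (hJ (n - 1)) hw, laplace_const_mul k _ (hJ (n - 2)) hw, zero_add]
  have hδ : constTerm k * scale k = constTerm k / 2 := by
    rw [constTerm]; split_ifs with h
    · simp [scale, h]
    · simp
  have hδ2 : constTerm k * (centred k s ^ 2 - 1 / 4) = constTerm k * (s * (s + k - 1)) := by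
    rw [constTerm]; split_ifs with h
    · simp [centred, h]; ring
    · simp
  rw [h1, hL, hL, hL]
  -- The recursion is applied to indices down to `n - 2`, so indices as low as `n - 4` occur and
  -- truncation has to be excluded case by case.
  rcases n with _ | _ | _ | _ | n
  · simp [completedDeriv]
    linear_combination (centred k s ^ 2 - 1 / 4) * hδ + hδ2 / 2
  · simp [completedDeriv]
    linear_combination (2 * centred k s) * hδ
  · simp [completedDeriv]
    linear_combination 2 * hδ
  · simp [completedDeriv]
    ring
  · simp [completedDeriv]
    ring

/-! ### Modularity -/

/-- Right multiplication by a matrix on row vectors. -/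
def vecMulEquiv (γ : Matrix.SpecialLinearGroup (Fin 2) ℤ) : ℤ × ℤ ≃ ℤ × ℤ where
  toFun v := (v.1 * γ 0 0 + v.2 * γ 1 0, v.1 * γ 0 1 + v.2 * γ 1 1)
  invFun v := (v.1 * γ 1 1 - v.2 * γ 1 0, v.2 * γ 0 0 - v.1 * γ 0 1)
  left_inv v := by
    have h := γ.det_coe
    rw [Matrix.det_fin_two] at h
    ext <;> simp only
    · linear_combination v.1 * h
    · linear_combination v.2 * h
  right_inv v := by
    have h := γ.det_coe
    rw [Matrix.det_fin_two] at h
    ext <;> simp only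
    · linear_combination v.1 * h
    · linear_combination v.2 * h

/-- Right multiplication by a matrix on nonzero row vectors. -/
def pairsEquiv (γ : Matrix.SpecialLinearGroup (Fin 2) ℤ) : Pairs ≃ Pairs :=
  (vecMulEquiv γ).subtypeEquiv fun v => by
    have h0 : vecMulEquiv γ (0, 0) = (0, 0) := by simp [vecMulEquiv]
    rw [Ne, Ne, ← (vecMulEquiv γ).injective.eq_iff (a := v), h0]

/-- The factor of automorphy `c z + d`. -/
def autFactor (γ : Matrix.SpecialLinearGroup (Fin 2) ℤ) (z : ℍ) : ℂ :=
  ((γ 1 0 : ℤ) : ℂ) * (z : ℂ) + ((γ 1 1 : ℤ) : ℂ)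

theorem im_smul (γ : Matrix.SpecialLinearGroup (Fin 2) ℤ) (z : ℍ) :
    ((γ • z : ℍ) : ℂ).im = (z : ℂ).im / ‖autFactor γ z‖ ^ 2 := by
  have h := ModularGroup.im_smul_eq_div_normSq γ z
  rw [normSq_eq_norm_sq] at h
  simpa [UpperHalfPlane.denom, autFactor] using h

theorem autFactor_ne_zero (γ : Matrix.SpecialLinearGroup (Fin 2) ℤ) (z : ℍ) :
    autFactor γ z ≠ 0 := fun h => by
  have h1 := im_smul γ z
  rw [h, norm_zero] at h1
  have h2 : 0 < ((γ • z : ℍ) : ℂ).im := (γ • z).2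
  simp only [ne_eq, OfNat.ofNat_ne_zero, not_false_eq_true, zero_pow, div_zero] at h1
  linarith

theorem lin_smul (γ : Matrix.SpecialLinearGroup (Fin 2) ℤ) (z : ℍ) (v : ℤ × ℤ) :
    lin v (γ • z : ℍ) = lin (vecMulEquiv γ v) z / autFactor γ z := by
  have h := autFactor_ne_zero γ z
  have hc : ((γ • z : ℍ) : ℂ) = ((γ 0 0 : ℤ) * z + (γ 0 1 : ℤ)) / autFactor γ z := by
    rw [UpperHalfPlane.coe_specialLinearGroup_apply]
    simp [autFactor]
  rw [eq_div_iff h, hc, lin, add_mul, mul_assoc, div_mul_cancel₀ _ h]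
  simp only [lin, vecMulEquiv, autFactor, Equiv.coe_fn_mk]
  push_cast
  ring

theorem quad_smul (γ : Matrix.SpecialLinearGroup (Fin 2) ℤ) (z : ℍ) (v : ℤ × ℤ) :
    quad v (γ • z : ℍ) = quad (vecMulEquiv γ v) z := by
  have h := norm_pos_iff.2 (autFactor_ne_zero γ z)
  have hz : 0 < (z : ℂ).im := z.2
  rw [quad, quad, im_smul, lin_smul, norm_div, div_pow]
  field_simp

theorem pre_smul (k : ℤ) (γ : Matrix.SpecialLinearGroup (Fin 2) ℤ) (z : ℍ) (v : Pairs) :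
    pre k v.1 (γ • z : ℍ) = autFactor γ z ^ k * pre k (pairsEquiv γ v).1 z := by
  have h := autFactor_ne_zero γ z
  rw [pre_eq k v (γ • z).2, pre_eq k (pairsEquiv γ v) z.2, quad_smul, lin_smul, div_zpow, zpow_neg,
    zpow_neg, zpow_neg]
  rw [show (pairsEquiv γ v).1 = vecMulEquiv γ v.1 from rfl, div_inv_eq_mul]
  ring

/-- Right multiplication by `γ` permutes the nonzero row vectors, and `quad` is carried along
without a factor. -/
theorem lapSum_smul (k : ℤ) (n : ℕ) (τ : ℂ) (γ : Matrix.SpecialLinearGroup (Fin 2) ℤ) (z : ℍ) :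
    lapSum k n τ (γ • z : ℍ) = autFactor γ z ^ k * lapSum k n τ z := by
  rw [lapSum, lapSum, ← tsum_mul_left, ← (pairsEquiv γ).tsum_eq
    (fun v => autFactor γ z ^ k * (pre k v.1 z * lap n τ (quad v.1 z)))]
  refine tsum_congr fun v => ?_
  rw [pre_smul, quad_smul, mul_assoc]
  rfl

theorem symMellin_smul (k : ℤ) (n : ℕ) (s : ℂ) (γ : Matrix.SpecialLinearGroup (Fin 2) ℤ) (z : ℍ) :
    symMellin k n s (γ • z : ℍ) = autFactor γ z ^ k * symMellin k n s z := by
  rw [symMellin_eq k n s (γ • z).2, symMellin_eq k n s z.2]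
  simp only [lapSum_smul]
  ring

theorem completedDeriv_smul (k : ℤ) (n : ℕ) (s : ℂ) (γ : Matrix.SpecialLinearGroup (Fin 2) ℤ)
    (z : ℍ) : completedDeriv k n s (γ • z : ℍ) = autFactor γ z ^ k * completedDeriv k n s z := by
  have hδ : constTerm k = autFactor γ z ^ k * constTerm k := by
    rw [constTerm]; split_ifs with h <;> simp [h]
  simp only [completedDeriv, symMellin_smul]
  split_ifs
  · linear_combination hδ / 2
  · ring

/-! ### Growth -/

/-- Polynomial growth on the strip `|x| ≤ 1 / 2`. -/
def StripBounded (f : ℂ → ℂ) : Prop :=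
  ∃ (N : ℕ) (C : ℝ), 0 ≤ C ∧ ∀ w : ℂ, |w.re| ≤ 1 / 2 → 1 ≤ w.im → ‖f w‖ ≤ C * w.im ^ N

theorem StripBounded.add {f g : ℂ → ℂ} (hf : StripBounded f) (hg : StripBounded g) :
    StripBounded fun w => f w + g w := by
  obtain ⟨N, C, hC, h⟩ := hf
  obtain ⟨N', C', hC', h'⟩ := hg
  refine ⟨max N N', C + C', by positivity, fun w h1 h2 => (norm_add_le _ _).trans ?_⟩
  rw [add_mul]
  refine add_le_add ((h w h1 h2).trans ?_) ((h' w h1 h2).trans ?_)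
  · gcongr
    exact le_max_left _ _
  · gcongr
    exact le_max_right _ _

theorem StripBounded.const_mul {f : ℂ → ℂ} (c : ℂ) (hf : StripBounded f) :
    StripBounded fun w => c * f w := by
  obtain ⟨N, C, hC, h⟩ := hf
  refine ⟨N, ‖c‖ * C, by positivity, fun w h1 h2 => ?_⟩
  rw [norm_mul, mul_assoc]
  exact mul_le_mul_of_nonneg_left (h w h1 h2) (norm_nonneg _)

theorem stripBounded_const (c : ℂ) : StripBounded fun _ => c :=
  ⟨0, ‖c‖, norm_nonneg _, fun _ _ _ => by simp⟩

theorem StripBounded.congr {f g : ℂ → ℂ} (hf : StripBounded f) (h : EqOn f g halfPlane) :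
    StripBounded g := by
  obtain ⟨N, C, hC, hb⟩ := hf
  refine ⟨N, C, hC, fun w h1 h2 => ?_⟩
  rw [← h (show 0 < w.im by linarith)]
  exact hb w h1 h2

theorem stripBounded_lapSum (k : ℤ) (n : ℕ) (τ : ℂ) : StripBounded (lapSum k n τ) := by
  obtain ⟨N, C, hC, hb⟩ := (isKernel_lap n τ).exists_term_bound 0 (-k).toNat k.toNat 0 (1 / 2) one_pos
  refine ⟨N, C * ∑' v : Pairs, (size v.1 ^ 3)⁻¹, mul_nonneg hC (tsum_nonneg fun v => by
    have := size_pos v; positivity), fun w h1 h2 => ?_⟩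
  rw [mul_right_comm, ← tsum_mul_left]
  refine tsum_of_norm_bounded ((summable_size_pow le_rfl).mul_left _).hasSum fun v => ?_
  have h3 := hb w h1 h2 v
  have hy : 0 < w.im := by linarith
  simp only [pow_zero, one_mul, Nat.cast_zero, add_zero] at h3
  rw [pre, mul_assoc, mul_assoc, norm_mul, ← mul_assoc (lin _ _ ^ _)]
  refine (mul_le_of_le_one_left (norm_nonneg _) ?_).trans h3
  rw [norm_pow, norm_inv, norm_real, Real.norm_of_nonneg hy.le]
  exact pow_le_one₀ (by positivity) (inv_le_one_of_one_le₀ h2)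

theorem stripBounded_symMellin (k : ℤ) (n : ℕ) (s : ℂ) : StripBounded (symMellin k n s) :=
  ((stripBounded_lapSum k n _).add ((stripBounded_lapSum k n _).const_mul _)).congr
    fun _ hw => (symMellin_eq k n s hw).symm

theorem stripBounded_completedDeriv (k : ℤ) (n : ℕ) (s : ℂ) :
    StripBounded (completedDeriv k n s) :=
  (stripBounded_const _).add (((((stripBounded_symMellin k n s).const_mul _).add
    ((stripBounded_symMellin k (n - 1) s).const_mul _)).add
      ((stripBounded_symMellin k (n - 2) s).const_mul _)).const_mul _)

theorem isBigO_completedDeriv (k : ℤ) (n : ℕ) (s : ℂ) : ∃ N : ℕ,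
    Asymptotics.IsBigO UpperHalfPlane.atImInfty (fun z : ℍ => completedDeriv k n s z)
      (fun z : ℍ => z.im ^ N) := by
  obtain ⟨N, C, hC, hb⟩ := stripBounded_completedDeriv k n s
  refine ⟨N, Asymptotics.IsBigO.of_bound C ?_⟩
  rw [Filter.eventually_iff, UpperHalfPlane.atImInfty_mem]
  refine ⟨1, fun z hz => ?_⟩
  -- The strip bound needs `|x| ≤ 1/2`; an integral translation reaches it without changing the
  -- value of the function or `im z`.
  set m : ℤ := -round z.re
  have hT := completedDeriv_smul k n s (ModularGroup.T ^ m) z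
  have hj : autFactor (ModularGroup.T ^ m) z = 1 := by
    simp [autFactor, ModularGroup.coe_T_zpow]
  rw [hj, one_zpow, one_mul] at hT
  have him : ((ModularGroup.T ^ m • z : ℍ) : ℂ).im = z.im := by
    rw [ModularGroup.coe_T_zpow_smul_eq]; simp
  have hre : |((ModularGroup.T ^ m • z : ℍ) : ℂ).re| ≤ 1 / 2 := by
    rw [ModularGroup.coe_T_zpow_smul_eq]
    simpa [m, ← sub_eq_add_neg] using abs_sub_round z.re
  have h := hb _ hre (by rw [him]; exact hz)
  rw [hT, him] at h
  simp only [mem_ofPred_eq]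
  rwa [Real.norm_of_nonneg (pow_nonneg z.im_pos.le _)]

/-! ### Functions on `ℍ` -/

theorem comp_ofComplex_eqOn (g : ℂ → ℂ) :
    EqOn (fun w : ℂ => g ((UpperHalfPlane.ofComplex w : ℍ) : ℂ)) g halfPlane := fun w hw => by
  simp only [UpperHalfPlane.ofComplex_apply_of_im_pos hw]

theorem partialX_coe (g : ℂ → ℂ) : partialX (fun z : ℍ => g z) = fun z : ℍ => dX g z :=
  funext fun z => (comp_ofComplex_eqOn g).dX_eq z.2

theorem partialY_coe (g : ℂ → ℂ) : partialY (fun z : ℍ => g z) = fun z : ℍ => dY g z :=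
  funext fun z => (comp_ofComplex_eqOn g).dY_eq z.2

theorem hyperbolicLaplacian_coe (k : ℤ) (g : ℂ → ℂ) :
    hyperbolicLaplacian k (fun z : ℍ => g z) = fun z : ℍ => laplace k g z := by
  funext z
  rw [hyperbolicLaplacian, partialX_coe, partialY_coe, partialX_coe, partialY_coe]
  rfl

theorem shiftedLaplacian_coe (k : ℤ) (lam : ℂ) (g : ℂ → ℂ) :
    shiftedLaplacian k lam (fun z : ℍ => g z) = fun z : ℍ => laplace k g z - lam * g z := by
  funext z
  rw [shiftedLaplacian, hyperbolicLaplacian_coe]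

/-- The smooth functions on the upper half-plane. -/
def smoothFunctions : Submodule ℂ (ℍ → ℂ) where
  carrier := {f | ∃ g : ℂ → ℂ, SmoothOn g ∧ f = fun z : ℍ => g z}
  add_mem' := by
    rintro _ _ ⟨g, hg, rfl⟩ ⟨h, hh, rfl⟩
    exact ⟨_, hg.add hh, rfl⟩
  zero_mem' := ⟨fun _ => 0, contDiffOn_const, rfl⟩
  smul_mem' := by
    rintro c _ ⟨g, hg, rfl⟩
    exact ⟨fun z => c * g z, contDiffOn_const.mul hg, rfl⟩

/-- The operator `Δ_k - lam` as an endomorphism of the space of smooth functions. -/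
def shiftedLaplacianLin (k : ℤ) (lam : ℂ) : Module.End ℂ smoothFunctions where
  toFun f := ⟨shiftedLaplacian k lam f, by
    obtain ⟨_, g, hg, rfl⟩ := f
    exact ⟨_, (contDiffOn_laplace k hg).sub (contDiffOn_const.mul hg), shiftedLaplacian_coe k lam g⟩⟩
  map_add' := by
    rintro ⟨_, g, hg, rfl⟩ ⟨_, h, hh, rfl⟩
    ext z
    have e := shiftedLaplacian_coe k lam fun z => g z + h z
    change shiftedLaplacian k lam (fun z : ℍ => g z + h z) z =
      shiftedLaplacian k lam (fun z : ℍ => g z) z + shiftedLaplacian k lam (fun z : ℍ => h z) z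
    rw [e, shiftedLaplacian_coe, shiftedLaplacian_coe]
    simp only [laplace_add k hg hh z.2]
    ring
  map_smul' := by
    rintro c ⟨_, g, hg, rfl⟩
    ext z
    have e := shiftedLaplacian_coe k lam fun z => c * g z
    change shiftedLaplacian k lam (fun z : ℍ => c * g z) z =
      c * shiftedLaplacian k lam (fun z : ℍ => g z) z
    rw [e, shiftedLaplacian_coe]
    simp only [laplace_const_mul k c hg z.2]
    ring

theorem coe_shiftedLaplacianLin_pow (k : ℤ) (lam : ℂ) (m : ℕ) (f : smoothFunctions) :
    (((shiftedLaplacianLin k lam ^ m) f : smoothFunctions) : ℍ → ℂ) =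
      (shiftedLaplacian k lam)^[m] f := by
  induction m generalizing f with
  | zero => rfl
  | succ m ih =>
    rw [pow_succ, Module.End.mul_apply, ih, Function.iterate_succ_apply]
    rfl

/-- The Taylor coefficient function as a smooth function. -/
def coeffFun (k : ℤ) (n : ℕ) (s : ℂ) : smoothFunctions :=
  ⟨fun z : ℍ => completedDeriv k n s z, _, contDiffOn_completedDeriv k n s, rfl⟩

theorem shiftedLaplacianLin_coeffFun {k : ℤ} (hk : Even k) (n : ℕ) (s : ℂ) :
    shiftedLaplacianLin k (s * (s + k - 1)) (coeffFun k n s) =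
      (2 * n * centred k s) • coeffFun k (n - 1) s + ((n : ℂ) * (n - 1)) • coeffFun k (n - 2) s := by
  ext z
  exact (congrFun (shiftedLaplacian_coe k (s * (s + k - 1)) (completedDeriv k n s)) z).trans
    (laplace_completedDeriv hk n s z.2)

/-- Smoothness, modularity and growth hold for every index, so only the annihilation condition is
left. The passage to smooth functions makes the operator an endomorphism. -/
theorem coeffFun_mem_polyharmonicForms_iff (k : ℤ) (n m : ℕ) (s lam : ℂ) :
    (coeffFun k n s : ℍ → ℂ) ∈ polyharmonicForms k m lam ↔
      (shiftedLaplacianLin k lam ^ m) (coeffFun k n s) = 0 := by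
  have h0 : (shiftedLaplacianLin k lam ^ m) (coeffFun k n s) = 0 ↔
      (shiftedLaplacian k lam)^[m] (coeffFun k n s : ℍ → ℂ) = 0 := by
    rw [← coe_shiftedLaplacianLin_pow, ZeroMemClass.coe_eq_zero]
  rw [h0]
  refine ⟨fun h => h.annihilated, fun h => ⟨?_, fun γ z => completedDeriv_smul k n s γ z,
    isBigO_completedDeriv k n s, h⟩⟩
  exact (contDiffOn_completedDeriv k n s).congr
    (comp_ofComplex_eqOn (completedDeriv k n s))

theorem coe_coeffFun {k : ℤ} (hk : Even k) (n : ℕ) (s : ℂ) :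
    (coeffFun k n s : ℍ → ℂ) = taylorCoeff k n s := (taylorCoeff_eq hk n s).symm

theorem coeffFun_one_sub (k : ℤ) (n : ℕ) (s : ℂ) :
    coeffFun k n (1 - k - s) = (-1 : ℂ) ^ n • coeffFun k n s := by
  ext z
  exact completedDeriv_one_sub k n s z

/-! ### Nonvanishing -/

/-- The kernel function whose lattice sum is `symMellin k 0 s`. -/
def symKernel (k : ℤ) (s : ℂ) (q : ℝ) : ℂ :=
  lap 0 (s + k.toNat - 1) q + lap 0 (k.natAbs - s - k.toNat) q

theorem exists_norm_symKernel_le (k : ℤ) (s : ℂ) :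
    ∃ N₀ : ℕ, ∀ N ≥ N₀, ∃ C, 0 ≤ C ∧ ∀ q > 0, ‖symKernel k s q‖ ≤ C / q ^ N := by
  obtain ⟨N₁, h₁⟩ := exists_norm_lap_le 0 (s + k.toNat - 1)
  obtain ⟨N₂, h₂⟩ := exists_norm_lap_le 0 (k.natAbs - s - k.toNat)
  refine ⟨max N₁ N₂, fun N hN => ?_⟩
  obtain ⟨C₁, hC₁, b₁⟩ := h₁ N (le_trans (le_max_left _ _) hN)
  obtain ⟨C₂, hC₂, b₂⟩ := h₂ N (le_trans (le_max_right _ _) hN)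
  refine ⟨C₁ + C₂, by positivity, fun q hq => (norm_add_le _ _).trans ?_⟩
  rw [add_div]
  exact add_le_add (b₁ q hq) (b₂ q hq)

theorem summable_pre_mul_symKernel (k : ℤ) (s : ℂ) {w : ℂ} (hw : w ∈ halfPlane) :
    Summable fun v : Pairs => pre k v.1 w * symKernel k s (quad v.1 w) :=
  ((summable_pre_mul_lap k 0 (s + k.toNat - 1) hw).add
    (summable_pre_mul_lap k 0 (k.natAbs - s - k.toNat) hw)).congr
    fun v => by rw [symKernel]; ring

theorem symMellin_zero_eq_tsum (k : ℤ) (s : ℂ) {w : ℂ} (hw : w ∈ halfPlane) :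
    symMellin k 0 s w = ∑' v : Pairs, pre k v.1 w * symKernel k s (quad v.1 w) := by
  rw [symMellin_eq k 0 s hw]
  simp only [lapSum, pow_zero, one_mul]
  rw [← (summable_pre_mul_lap k 0 _ hw).tsum_add (summable_pre_mul_lap k 0 _ hw)]
  exact tsum_congr fun v => by rw [symKernel]; ring

/-- The pairs on the vertical axis. -/
def axis : Set Pairs := {v | v.1.1 = 0}

/-- Enumeration of the pairs on the vertical axis. -/
def axisMap : ℕ ⊕ ℕ → axis
  | .inl n => ⟨⟨(0, (n : ℤ) + 1), fun h => by have := congrArg Prod.snd h; simp at this; omega⟩, rfl⟩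
  | .inr n => ⟨⟨(0, -((n : ℤ) + 1)), fun h => by
      have := congrArg Prod.snd h; simp at this; omega⟩, rfl⟩

theorem axisMap_bijective : Function.Bijective axisMap := by
  constructor
  · intro a b h
    have h := congrArg (fun v : axis => v.1.1.2) h
    rcases a with n | n <;> rcases b with m | m <;> simp only [axisMap] at h <;>
      grind
  · rintro ⟨⟨⟨a, b⟩, h⟩, h' : a = 0⟩
    subst h'
    have hb : b ≠ 0 := fun hb => h (by rw [hb])
    rcases lt_or_gt_of_ne hb with hb | hb
    · refine ⟨Sum.inr (-b - 1).toNat, Subtype.ext (Subtype.ext (Prod.ext rfl ?_))⟩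
      simp only [axisMap]; omega
    · refine ⟨Sum.inl (b - 1).toNat, Subtype.ext (Subtype.ext (Prod.ext rfl ?_))⟩
      simp only [axisMap]; omega

/-- The sum over the vertical axis, as a function of the imaginary part. -/
def axisSum (k : ℤ) (s : ℂ) (y : ℝ) : ℂ :=
  ∑' n : ℕ, ((n : ℂ) + 1) ^ k.natAbs * symKernel k s (((n : ℝ) + 1) ^ 2 / y)

theorem mul_I_mem {y : ℝ} (hy : 0 < y) : (y : ℂ) * I ∈ halfPlane := by
  simpa [halfPlane] using hy

theorem norm_sq_lin_mul_I (v : ℤ × ℤ) (y : ℝ) :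
    ‖lin v (y * I)‖ ^ 2 = (v.2 : ℝ) ^ 2 + (v.1 : ℝ) ^ 2 * y ^ 2 := by
  rw [← normSq_eq_norm_sq, normSq_apply]
  simp [lin]
  ring

/-- On the axis `quad = b² / y`, and `b`, `-b` contribute equally because `k` is even. -/
theorem tsum_axis {k : ℤ} (hk : Even k) (s : ℂ) {y : ℝ} (hy : 0 < y) :
    ∑' v : axis, pre k v.1.1 (y * I) * symKernel k s (quad v.1.1 (y * I)) =
      (y : ℂ)⁻¹ ^ k.toNat * (2 * axisSum k s y) := by
  have hs := (summable_pre_mul_symKernel k s (mul_I_mem hy)).subtype axis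
  have hK : Even k.natAbs := Int.natAbs_even.2 hk
  have hKe : k.natAbs = (-k).toNat + k.toNat := by omega
  have h1 : ∀ (n : ℕ) (b : ℤ), (b = n + 1 ∨ b = -(n + 1 : ℤ)) →
      pre k (0, b) (y * I) * symKernel k s (quad (0, b) (y * I)) = (y : ℂ)⁻¹ ^ k.toNat *
      (((n : ℂ) + 1) ^ k.natAbs * symKernel k s (((n : ℝ) + 1) ^ 2 / y)) := by
    intro n b hb
    have hq : quad (0, b) (y * I) = ((n : ℝ) + 1) ^ 2 / y := by
      rw [quad, norm_sq_lin_mul_I]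
      rcases hb with rfl | rfl
      · simp
      · simp only [Int.cast_neg, neg_sq]; simp
    have hp : pre k (0, b) (y * I) = (y : ℂ)⁻¹ ^ k.toNat * ((n : ℂ) + 1) ^ k.natAbs := by
      have : ((b : ℂ)) ^ k.natAbs = ((n : ℂ) + 1) ^ k.natAbs := by
        rcases hb with rfl | rfl
        · push_cast; rfl
        · push_cast; rw [hK.neg_pow]
      rw [← this, hKe, pow_add, pre]
      simp [lin, linConj]
      ring
    rw [hq, hp, mul_assoc]
  set g : axis → ℂ := fun v => pre k v.1.1 (y * I) * symKernel k s (quad v.1.1 (y * I)) with hg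
  have hs' : Summable (g ∘ Equiv.ofBijective _ axisMap_bijective) := (Equiv.summable_iff _).2 hs
  have e1 : ∀ n : ℕ, g (axisMap (Sum.inl n)) = (y : ℂ)⁻¹ ^ k.toNat *
      (((n : ℂ) + 1) ^ k.natAbs * symKernel k s (((n : ℝ) + 1) ^ 2 / y)) := fun n =>
    h1 n _ (Or.inl rfl)
  have e2 : ∀ n : ℕ, g (axisMap (Sum.inr n)) = (y : ℂ)⁻¹ ^ k.toNat *
      (((n : ℂ) + 1) ^ k.natAbs * symKernel k s (((n : ℝ) + 1) ^ 2 / y)) := fun n =>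
    h1 n _ (Or.inr rfl)
  rw [← (Equiv.ofBijective _ axisMap_bijective).tsum_eq]
  change ∑' i, (g ∘ Equiv.ofBijective _ axisMap_bijective) i = _
  rw [Summable.tsum_sum
    (hs'.comp_injective Sum.inl_injective) (hs'.comp_injective Sum.inr_injective)]
  simp only [Function.comp_apply, Equiv.ofBijective_apply, e1, e2]
  rw [tsum_mul_left, axisSum]
  ring

/-- For `a ≠ 0` one has `|aiy + b| ≥ y`, so the rapid decay of the kernel becomes rapid decay in
`y`. -/
theorem exists_norm_tsum_compl_axis_le (k : ℤ) (s : ℂ) (N : ℕ) : ∃ C, 0 ≤ C ∧ ∀ y : ℝ, 1 ≤ y →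
    ‖∑' v : (axisᶜ : Set Pairs), pre k v.1.1 (y * I) * symKernel k s (quad v.1.1 (y * I))‖ ≤
      C / y ^ N := by
  obtain ⟨N₀, h⟩ := exists_norm_symKernel_le k s
  set M := k.natAbs + 3 + N + N₀ with hM
  obtain ⟨C, hC, hb⟩ := h M (by omega)
  have hsum : Summable fun v : (axisᶜ : Set Pairs) => C * (size v.1.1 ^ 3)⁻¹ :=
    ((summable_size_pow le_rfl).subtype (axisᶜ : Set Pairs)).mul_left C
  have hnn : ∀ v : (axisᶜ : Set Pairs), 0 ≤ C * (size v.1.1 ^ 3)⁻¹ := fun v => by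
    have := size_pos v.1
    positivity
  refine ⟨∑' v : (axisᶜ : Set Pairs), C * (size v.1.1 ^ 3)⁻¹, tsum_nonneg hnn, fun y hy => ?_⟩
  have hy0 : 0 < y := by linarith
  rw [div_eq_mul_inv]
  refine tsum_of_norm_bounded (hsum.hasSum.mul_right (y ^ N)⁻¹) fun v => ?_
  have hw := mul_I_mem hy0
  have hl := norm_lin_pos v.1 hw
  have hs := size_pos v.1
  have ha : 1 ≤ (v.1.1.1 : ℝ) ^ 2 := by
    have h0 : v.1.1.1 ≠ 0 := v.2
    have : 1 ≤ v.1.1.1 ^ 2 := by have := sq_pos_of_ne_zero h0; omega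
    exact_mod_cast this
  have hly : y ≤ ‖lin v.1.1 (y * I)‖ := by
    refine (sq_le_sq₀ hy0.le hl.le).1 ?_
    rw [norm_sq_lin_mul_I]
    nlinarith [sq_nonneg (v.1.1.2 : ℝ), sq_nonneg y]
  have hls : size v.1.1 ≤ ‖lin v.1.1 (y * I)‖ := by
    have hy2 : 1 ≤ y ^ 2 := one_le_pow₀ hy
    refine max_le (abs_le_of_sq_le_sq ?_ hl.le) (abs_le_of_sq_le_sq ?_ hl.le)
    · rw [norm_sq_lin_mul_I]
      nlinarith [sq_nonneg (v.1.1.2 : ℝ), sq_nonneg (v.1.1.1 : ℝ)]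
    · rw [norm_sq_lin_mul_I]
      nlinarith [sq_nonneg (v.1.1.2 : ℝ), mul_nonneg (sq_nonneg (v.1.1.1 : ℝ)) (sq_nonneg y)]
  have him : ((y : ℂ) * I).im = y := by simp
  -- Of the `2M` factors `‖lin‖` in `quad ^ M`, `|k|` cancel against `pre` and three give the
  -- summable inverse cube. The others are bounded below by `y` and outweigh `y ^ M` by `y ^ (N +
  -- N₀)`.
  have hexp : 2 * M = k.natAbs + ((M + N + N₀) + 3) := by omega
  rw [norm_mul, norm_pre k _ hw, him]
  calc y⁻¹ ^ k.toNat * ‖lin v.1.1 (y * I)‖ ^ k.natAbs * ‖symKernel k s (quad v.1.1 (y * I))‖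
      ≤ 1 * ‖lin v.1.1 (y * I)‖ ^ k.natAbs * (C / quad v.1.1 (y * I) ^ M) := by
        gcongr
        · exact pow_le_one₀ (by positivity) (inv_le_one_of_one_le₀ hy)
        · exact hb _ (quad_pos v.1 hw)
    _ = C * (y ^ M / (‖lin v.1.1 (y * I)‖ ^ (M + N + N₀) * ‖lin v.1.1 (y * I)‖ ^ 3)) := by
        rw [quad, him, div_pow, ← pow_mul, hexp, pow_add, pow_add]
        field_simp
    _ ≤ C * (y ^ M / (y ^ (M + N + N₀) * size v.1.1 ^ 3)) := by gcongr
    _ = C * (size v.1.1 ^ 3)⁻¹ * (y ^ (N + N₀))⁻¹ := by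
        rw [add_assoc, pow_add y M]; field_simp
    _ ≤ C * (size v.1.1 ^ 3)⁻¹ * (y ^ N)⁻¹ := by
        gcongr
        omega

theorem exists_norm_axisSum_le {k : ℤ} (hk : Even k) {s c : ℂ} (hc : k ≠ 0 → c = 0)
    (h : ∀ w ∈ halfPlane, symMellin k 0 s w = c) :
    ∃ C, 0 ≤ C ∧ ∀ y : ℝ, 1 ≤ y → ‖axisSum k s y‖ ≤ C := by
  obtain ⟨C, hC, hb⟩ := exists_norm_tsum_compl_axis_le k s k.toNat
  refine ⟨‖c‖ + C, by positivity, fun y hy => ?_⟩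
  have hy0 : 0 < y := by linarith
  have hw := mul_I_mem hy0
  have hsplit := (summable_pre_mul_symKernel k s hw).tsum_subtype_add_tsum_subtype_compl axis
  rw [← symMellin_zero_eq_tsum k s hw, h _ hw, tsum_axis hk s hy0] at hsplit
  have hyc : (y : ℂ) ≠ 0 := ofReal_ne_zero.2 hy0.ne'
  set R := ∑' v : (axisᶜ : Set Pairs), pre k v.1.1 (y * I) * symKernel k s (quad v.1.1 (y * I))
  -- This is where a nonzero constant is allowed only in weight 0: for positive `k` it would grow
  -- with `y`.
  have hcy : (y : ℂ) ^ k.toNat * c = c := by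
    by_cases hk0 : k = 0
    · simp [hk0]
    · simp [hc hk0]
  have hm : 2 * axisSum k s y = c - (y : ℂ) ^ k.toNat * R := by
    have : (y : ℂ) ^ k.toNat * ((y : ℂ)⁻¹ ^ k.toNat * (2 * axisSum k s y)) = 2 * axisSum k s y := by
      rw [← mul_assoc, ← mul_pow, mul_inv_cancel₀ hyc, one_pow, one_mul]
    rw [← this, ← hcy]
    linear_combination (y : ℂ) ^ k.toNat * hsplit
  have hR : ‖(y : ℂ) ^ k.toNat * R‖ ≤ C := by
    rw [norm_mul, norm_pow, norm_real, Real.norm_of_nonneg hy0.le]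
    calc _ ≤ y ^ k.toNat * (C / y ^ k.toNat) := by gcongr; exact hb y hy
      _ = C := by field_simp
  have h2 : ‖2 * axisSum k s y‖ ≤ ‖c‖ + C := by
    rw [hm]
    exact (norm_sub_le _ _).trans (by gcongr)
  rw [norm_mul, Complex.norm_two] at h2
  linarith [norm_nonneg (axisSum k s y)]

/-- Small `y` means large arguments of the kernel, where any high inverse power is available. -/
theorem exists_norm_axisSum_le_pow (k : ℤ) (s : ℂ) : ∃ M₀ : ℕ, ∀ M ≥ M₀, ∃ C, 0 ≤ C ∧
    ∀ y : ℝ, 0 < y → ‖axisSum k s y‖ ≤ C * y ^ M := by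
  obtain ⟨N₀, h⟩ := exists_norm_symKernel_le k s
  refine ⟨N₀ + k.natAbs + 1, fun M hM => ?_⟩
  obtain ⟨C, hC, hb⟩ := h M (by omega)
  have hs : Summable fun n : ℕ => (((n : ℝ) + 1) ^ 2)⁻¹ := by
    have := (summable_nat_add_iff 1).2 (Real.summable_nat_pow_inv.2 one_lt_two)
    simpa using this
  refine ⟨∑' n : ℕ, C * (((n : ℝ) + 1) ^ 2)⁻¹, tsum_nonneg fun n => by positivity, fun y hy => ?_⟩
  rw [← tsum_mul_right]
  refine tsum_of_norm_bounded ((hs.mul_left C).mul_right _).hasSum fun n => ?_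
  have hn : 1 ≤ (n : ℝ) + 1 := by linarith [Nat.cast_nonneg (α := ℝ) n]
  obtain ⟨e, he⟩ := Nat.exists_eq_add_of_le (show k.natAbs + 2 ≤ 2 * M by omega)
  have hnorm : ‖(n : ℂ) + 1‖ = (n : ℝ) + 1 := by
    rw [← Nat.cast_add_one, Complex.norm_natCast]; push_cast; rfl
  rw [norm_mul, norm_pow, hnorm]
  calc ((n : ℝ) + 1) ^ k.natAbs * ‖symKernel k s (((n : ℝ) + 1) ^ 2 / y)‖
      ≤ ((n : ℝ) + 1) ^ k.natAbs * (C / (((n : ℝ) + 1) ^ 2 / y) ^ M) := by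
        gcongr
        exact hb _ (by positivity)
    _ = C * (((n : ℝ) + 1) ^ 2)⁻¹ * y ^ M * (((n : ℝ) + 1) ^ e)⁻¹ := by
        rw [div_pow, ← pow_mul, he, pow_add, pow_add]; field_simp
    _ ≤ C * (((n : ℝ) + 1) ^ 2)⁻¹ * y ^ M * 1 := by
        gcongr
        exact inv_le_one_of_one_le₀ (one_le_pow₀ hn)
    _ = _ := mul_one _

/-! #### Mellin transforms -/

theorem measurable_expo : Measurable fun p : ℝ × ℝ => expo p.1 p.2 := by
  unfold expo; fun_prop

/-- Integrating absolute values over `q` first gives a multiple of `t ^ (Re τ - Re w)`, integrable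
at infinity by the second hypothesis. -/
theorem integrable_prod_expo {τ w : ℂ} (hw : 0 < w.re) (hτ : τ.re + 1 < w.re) :
    Integrable (fun p : ℝ × ℝ => expo p.2 p.1 * (p.2 : ℂ) ^ τ * (p.1 : ℂ) ^ (w - 1))
      ((volume.restrict (Ioi 0)).prod (volume.restrict (Ioi 1))) := by
  have hmeas : AEStronglyMeasurable
      (fun p : ℝ × ℝ => expo p.2 p.1 * (p.2 : ℂ) ^ τ * (p.1 : ℂ) ^ (w - 1))
      ((volume.restrict (Ioi 0)).prod (volume.restrict (Ioi 1))) := by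
    have := measurable_expo.comp measurable_swap
    refine Measurable.aestronglyMeasurable ?_
    refine Measurable.mul (Measurable.mul this ?_) ?_ <;> fun_prop
  rw [integrable_prod_iff' hmeas]
  constructor
  · filter_upwards [ae_restrict_mem measurableSet_Ioi] with t ht
    have ht : 0 < t := zero_lt_one.trans ht
    refine ((integrableOn_expo_mul_cpow hw ht).mul_const ((t : ℂ) ^ τ)).congr
      (Eventually.of_forall fun q => ?_)
    simp only [expo_comm q t]
    ring
  · have hb : IntegrableOn (fun t : ℝ => Real.pi ^ (-w.re) * Real.Gamma w.re * t ^ (τ.re - w.re))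
      (Ioi 1) := (integrableOn_Ioi_rpow_of_lt (by linarith) one_pos).const_mul _
    refine hb.congr ?_
    filter_upwards [ae_restrict_mem measurableSet_Ioi] with t ht
    have ht : 0 < t := zero_lt_one.trans ht
    have h := integral_norm_expo_mul_cpow hw ht
    have e : ∀ q : ℝ, ‖expo t q * (t : ℂ) ^ τ * (q : ℂ) ^ (w - 1)‖ =
        t ^ τ.re * ‖expo q t * (q : ℂ) ^ (w - 1)‖ := by
      intro q
      rw [norm_mul, norm_mul, norm_mul, expo_comm q t, norm_cpow_eq_rpow_re_of_pos ht]
      ring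
    simp only [e, integral_const_mul, h]
    rw [sub_eq_add_neg, Real.rpow_add ht]
    ring

/-- After the exchange of integrals, the cut-off at `t = 1` produces the factor `1/(w - τ - 1)`,
whose pole drives the nonvanishing argument. -/
theorem hasMellin_lap {τ w : ℂ} (hw : 0 < w.re) (hτ : τ.re + 1 < w.re) :
    HasMellin (lap 0 τ) w (((Real.pi : ℝ) : ℂ) ^ (-w) * Complex.Gamma w * (1 / (w - τ - 1))) := by
  have hI := integrable_prod_expo hw hτ
  have e : ∀ q : ℝ, ∫ t in Ioi (1 : ℝ), expo t q * (t : ℂ) ^ τ * (q : ℂ) ^ (w - 1) =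
      (q : ℂ) ^ (w - 1) • lap 0 τ q := by
    intro q
    rw [integral_mul_const, smul_eq_mul, mul_comm]
    simp [lap, mellinTail]
  refine ⟨?_, ?_⟩
  · have := hI.integral_prod_left
    simp only [e] at this
    exact this
  · rw [mellin]
    simp only [← e]
    rw [integral_integral_swap hI]
    have h1 : ∀ t ∈ Ioi (1 : ℝ), ∫ q in Ioi (0 : ℝ), expo t q * (t : ℂ) ^ τ * (q : ℂ) ^ (w - 1) =
        ((Real.pi : ℝ) : ℂ) ^ (-w) * Complex.Gamma w * (t : ℂ) ^ (τ - w) := by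
      intro t ht
      have ht : 0 < t := zero_lt_one.trans ht
      have h := integral_Ioi_expo_mul_cpow hw ht
      have e : ∀ q : ℝ, expo t q * (t : ℂ) ^ τ * (q : ℂ) ^ (w - 1) =
        (t : ℂ) ^ τ * (expo q t * (q : ℂ) ^ (w - 1)) := fun q => by rw [expo_comm q t]; ring
      simp only [e, integral_const_mul, h]
      rw [sub_eq_add_neg τ w, cpow_add _ _ (ofReal_ne_zero.2 ht.ne')]
      ring
    rw [setIntegral_congr_fun measurableSet_Ioi h1, integral_const_mul,
      integral_Ioi_cpow_of_lt (by rw [sub_re]; linarith) one_pos]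
    congr 1
    rw [ofReal_one, one_cpow, ← neg_div_neg_eq, neg_neg]
    congr 1
    ring

theorem hasMellin_symKernel {k : ℤ} {s w : ℂ} (hw : 0 < w.re) (h1 : (s + k.toNat).re < w.re)
    (h2 : k.natAbs + 1 < (w + s + k.toNat).re) :
    HasMellin (symKernel k s) w (((Real.pi : ℝ) : ℂ) ^ (-w) * Complex.Gamma w *
      (1 / (w - (s + k.toNat)) + 1 / (w + s + k.toNat - k.natAbs - 1))) := by
  have a := hasMellin_lap (τ := s + k.toNat - 1) hw (by simpa using h1)
  have b := hasMellin_lap (τ := k.natAbs - s - k.toNat) hw (by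
    simp at h2 ⊢; linarith)
  have := hasMellin_add a.1 b.1
  rw [a.2, b.2] at this
  rw [← mul_add] at this
  have e : (1 / (w - (s + k.toNat)) + 1 / (w + s + k.toNat - k.natAbs - 1)) =
      1 / (w - (s + k.toNat - 1) - 1) + 1 / (w - (k.natAbs - s - k.toNat) - 1) := by
    congr 2 <;> ring
  rw [e]
  exact this

theorem integral_norm_comp_div {f : ℝ → ℂ} (w : ℂ) {a : ℝ} (ha : 0 < a) :
    ∫ y in Ioi (0 : ℝ), ‖(y : ℂ) ^ (-w - 1) • f (a / y)‖ =
      a ^ (-w.re) * ∫ q in Ioi (0 : ℝ), ‖(q : ℂ) ^ (w - 1) • f q‖ := by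
  have e : ∀ (v : ℂ) (g : ℝ → ℂ), mellin (fun q => ((‖g q‖ : ℝ) : ℂ)) (v.re : ℂ) =
      ((∫ q in Ioi (0 : ℝ), ‖(q : ℂ) ^ (v - 1) • g q‖ : ℝ) : ℂ) := by
    intro v g
    rw [mellin, ← integral_complex_ofReal]
    refine setIntegral_congr_fun measurableSet_Ioi fun q hq => ?_
    have hq : 0 < q := hq
    change (q : ℂ) ^ ((v.re : ℂ) - 1) * ((‖g q‖ : ℝ) : ℂ) = ((‖(q : ℂ) ^ (v - 1) * g q‖ : ℝ) : ℂ)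
    rw [norm_mul, norm_cpow_eq_rpow_re_of_pos hq, ofReal_mul, ofReal_cpow hq.le, sub_re, one_re,
      ofReal_sub, ofReal_one]
  have h1 := mellin_comp_inv (fun u => ((‖f (a * u)‖ : ℝ) : ℂ)) ((-w).re : ℂ)
  have h2 := mellin_comp_mul_left (fun u => ((‖f u‖ : ℝ) : ℂ)) (w.re : ℂ) ha
  rw [neg_re, ofReal_neg, neg_neg, h2, ← ofReal_neg, ← neg_re, e (-w) (fun u => f (a * u⁻¹)), e w f,
    smul_eq_mul, ← ofReal_cpow ha.le, ← ofReal_mul] at h1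
  simpa only [div_eq_mul_inv, neg_re] using ofReal_injective h1

/-- Rescaling the term of index `n` contributes `(n + 1) ^ (|k| - 2w)`, and these add up to the zeta
factor. -/
theorem integral_axisSum {k : ℤ} {s w : ℂ} (h1 : (s + k.toNat).re < w.re)
    (h2 : k.natAbs + 1 < (w + s + k.toNat).re) (h3 : (k.natAbs + 1) / 2 < w.re) :
    ∫ y in Ioi (0 : ℝ), (y : ℂ) ^ (-w - 1) • axisSum k s y =
      riemannZeta (2 * w - k.natAbs) * (((Real.pi : ℝ) : ℂ) ^ (-w) * Complex.Gamma w *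
      (1 / (w - (s + k.toNat)) + 1 / (w + s + k.toNat - k.natAbs - 1))) := by
  have hw0 : 0 < w.re := by
    have : (0 : ℝ) ≤ k.natAbs := Nat.cast_nonneg _
    linarith
  have hM := hasMellin_symKernel hw0 h1 h2
  set B := ∫ q in Ioi (0 : ℝ), ‖(q : ℂ) ^ (w - 1) • symKernel k s q‖ with hB
  have hpos : ∀ n : ℕ, 0 < (n : ℝ) + 1 := fun n => by positivity
  set F : ℕ → ℝ → ℂ := fun n y => (((n : ℂ) + 1) ^ k.natAbs) *
    ((y : ℂ) ^ (-w - 1) • symKernel k s (((n : ℝ) + 1) ^ 2 / y)) with hF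
  have hzre : 1 < (2 * w - k.natAbs).re := by simp only [sub_re, mul_re, natCast_re, re_ofNat, im_ofNat]; linarith
  have hint : ∀ n, Integrable (F n) (volume.restrict (Ioi 0)) := by
    intro n
    have := (MellinConvergent.comp_rpow (f := fun u => symKernel k s (((n : ℝ) + 1) ^ 2 * u))
      (s := -w) (a := -1) (by norm_num)).2 (by
        rw [ofReal_neg, ofReal_one, neg_div_neg_eq, div_one]
        exact (MellinConvergent.comp_mul_left (by positivity)).2 hM.1)
    simp only [Real.rpow_neg_one] at this
    exact Integrable.const_mul this _
  have hnorm : ∀ n, ∫ y in Ioi (0 : ℝ), ‖F n y‖ = (1 / ((n : ℝ) + 1) ^ (2 * w - k.natAbs).re) * B := by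
    intro n
    have hn : ‖(n : ℂ) + 1‖ = (n : ℝ) + 1 := by
      rw [← Nat.cast_add_one, Complex.norm_natCast]; push_cast; rfl
    simp only [hF, norm_mul (_ ^ k.natAbs), integral_const_mul]
    rw [integral_norm_comp_div w (pow_pos (hpos n) 2), ← hB, ← mul_assoc, norm_pow, hn]
    congr 1
    rw [← Real.rpow_natCast, ← Real.rpow_natCast, ← Real.rpow_mul (hpos n).le,
      ← Real.rpow_add (hpos n), one_div, ← Real.rpow_neg (hpos n).le]
    congr 1
    simp
    ring
  have hsum := hasSum_integral_of_summable_integral_norm (F := F) hint (by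
    simp only [hnorm]
    refine Summable.mul_right _ ?_
    have := (summable_nat_add_iff 1).2 (Real.summable_one_div_nat_rpow.2 hzre)
    simpa using this)
  have hval : ∀ n, ∫ y in Ioi (0 : ℝ), F n y = (1 / ((n : ℂ) + 1) ^ (2 * w - k.natAbs)) *
      (((Real.pi : ℝ) : ℂ) ^ (-w) * Complex.Gamma w *
      (1 / (w - (s + k.toNat)) + 1 / (w + s + k.toNat - k.natAbs - 1))) := by
    intro n
    have ha : (0 : ℝ) < ((n : ℝ) + 1) ^ 2 := pow_pos (hpos n) 2
    have e1 := mellin_comp_inv (fun u => symKernel k s (((n : ℝ) + 1) ^ 2 * u)) (-w)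
    rw [neg_neg, mellin_comp_mul_left _ _ ha, hM.2] at e1
    have hn0 : ((n : ℂ) + 1) ≠ 0 := by
      exact_mod_cast (Nat.succ_ne_zero n)
    have hc : (((((n : ℝ) + 1) ^ 2 : ℝ)) : ℂ) ^ (-w) = ((n : ℂ) + 1) ^ (-(2 * w)) := by
      have : ((((n : ℝ) + 1) ^ 2 : ℝ) : ℂ) = (((n : ℝ) + 1 : ℝ) : ℂ) * (((n : ℝ) + 1 : ℝ) : ℂ) := by
        push_cast; ring
      rw [this, mul_cpow_ofReal_nonneg (hpos n).le (hpos n).le]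
      push_cast
      rw [← cpow_add _ _ hn0]
      congr 1
      ring
    simp only [hF, integral_const_mul]
    rw [mellin] at e1
    simp only [← div_eq_mul_inv] at e1
    rw [e1, hc, smul_eq_mul, ← mul_assoc]
    congr 1
    rw [one_div, ← cpow_neg, neg_sub, sub_eq_add_neg, cpow_add _ _ hn0, cpow_natCast]
  simp only [hval] at hsum
  rw [zeta_eq_tsum_one_div_nat_add_one_cpow hzre, ← tsum_mul_right, hsum.tsum_eq]
  refine setIntegral_congr_fun measurableSet_Ioi fun y _ => ?_
  simp only [hF, axisSum, smul_eq_mul, ← tsum_mul_left]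
  exact tsum_congr fun n => by ring

/-! ### The contradiction at the pole -/

theorem exists_norm_integral_axisSum_le {k : ℤ} (hk : Even k) {s c : ℂ} (hc : k ≠ 0 → c = 0)
    (h : ∀ w ∈ halfPlane, symMellin k 0 s w = c) (R : ℝ) :
    ∃ B, ∀ w : ℂ, 1 / 2 ≤ w.re → w.re ≤ R →
      ‖∫ y in Ioi (0 : ℝ), (y : ℂ) ^ (-w - 1) • axisSum k s y‖ ≤ B := by
  obtain ⟨C₁, hC₁, b₁⟩ := exists_norm_axisSum_le hk hc h
  obtain ⟨M₀, hM₀⟩ := exists_norm_axisSum_le_pow k s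
  -- With `M ≥ R + 1` the integrand is bounded on `(0, 1]` whenever `Re w ≤ R`; beyond `1`, `Re w ≥
  -- 1/2` gives the exponent `-3/2`.
  obtain ⟨M, hM⟩ := exists_nat_ge (max (R + 1) M₀)
  obtain ⟨C₂, hC₂, b₂⟩ := hM₀ M (by exact_mod_cast (le_max_right _ _).trans hM)
  have hMR : R + 1 ≤ M := (le_max_left _ _).trans hM
  set b : ℝ → ℝ := fun y => if y ≤ 1 then C₂ else C₁ * y ^ (-(3 / 2) : ℝ) with hb
  have hbi : IntegrableOn b (Ioi 0) := by
    rw [← Ioc_union_Ioi_eq_Ioi (zero_le_one' ℝ)]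
    refine IntegrableOn.union ?_ ?_
    · refine (integrableOn_const (C := C₂) (by simp) (by simp)).congr_fun (fun y hy => ?_)
        measurableSet_Ioc
      simp [hb, hy.2]
    · have : IntegrableOn (fun y : ℝ => C₁ * y ^ (-(3 / 2) : ℝ)) (Ioi 1) :=
        (integrableOn_Ioi_rpow_of_lt (by norm_num) one_pos).const_mul C₁
      refine this.congr_fun (fun y hy => ?_) measurableSet_Ioi
      simp [hb, not_le.2 (show 1 < y from hy)]
  refine ⟨∫ y in Ioi 0, b y, fun w h1 h2 => norm_integral_le_of_norm_le hbi ?_⟩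
  filter_upwards [ae_restrict_mem measurableSet_Ioi] with y hy
  have hy : 0 < y := hy
  rw [norm_smul, norm_cpow_eq_rpow_re_of_pos hy, sub_re, neg_re, one_re]
  simp only [hb]
  split_ifs with hy1
  · calc y ^ (-w.re - 1) * ‖axisSum k s y‖ ≤ y ^ (-w.re - 1) * (C₂ * y ^ M) := by
          gcongr
          exact b₂ y hy
      _ = C₂ * y ^ (-w.re - 1 + M) := by
          rw [Real.rpow_add hy, Real.rpow_natCast]; ring
      _ ≤ C₂ * 1 := by
          gcongr
          exact Real.rpow_le_one hy.le hy1 (by linarith)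
      _ = C₂ := mul_one _
  · have hy1 : 1 ≤ y := (not_le.1 hy1).le
    rw [mul_comm]
    gcongr
    · exact b₁ y hy1
    · linarith

/-- At `σ = 0` the linear factor cancels the pole of zeta; elsewhere the limit is nonzero because
zeta has no zeros with `Re ≥ 1`. -/
theorem exists_tendsto_mul_zeta {σ : ℂ} (hσ : 0 ≤ σ.re) : ∃ L : ℂ, L ≠ 0 ∧
    Tendsto (fun ε : ℝ => (2 * σ + 2 * ε) * riemannZeta (1 + (2 * σ + 2 * ε))) (𝓝[>] 0) (𝓝 L) := by
  by_cases h : σ = 0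
  · subst h
    refine ⟨1, one_ne_zero, ?_⟩
    have hc : Continuous fun ε : ℝ => (1 : ℂ) + (2 * 0 + 2 * ε) := by fun_prop
    have ht : Tendsto (fun ε : ℝ => (1 : ℂ) + (2 * 0 + 2 * ε)) (𝓝[>] 0) (𝓝[≠] 1) := by
      refine tendsto_nhdsWithin_iff.2 ⟨?_, ?_⟩
      · have := (hc.tendsto 0).mono_left (nhdsWithin_le_nhds (s := Ioi 0))
        simpa using this
      · filter_upwards [self_mem_nhdsWithin] with ε hε
        have : ε ≠ 0 := ne_of_gt hε
        simpa using this
    refine (riemannZeta_residue_one.comp ht).congr fun ε => ?_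
    simp only [Function.comp_apply]
    ring
  · have h1 : (1 : ℂ) + 2 * σ ≠ 1 := by simpa using h
    refine ⟨2 * σ * riemannZeta (1 + 2 * σ), mul_ne_zero (by simpa using h)
      (riemannZeta_ne_zero_of_one_le_re (by simp; linarith)), ?_⟩
    have hc : Continuous fun ε : ℝ => 2 * σ + 2 * (ε : ℂ) := by fun_prop
    have hz : ContinuousAt (fun ε : ℝ => riemannZeta (1 + (2 * σ + 2 * ε))) 0 := by
      refine ContinuousAt.comp (f := fun ε : ℝ => (1 : ℂ) + (2 * σ + 2 * ε)) ?_ (by fun_prop)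
      rw [ofReal_zero, mul_zero, add_zero]
      exact (differentiableAt_riemannZeta h1).continuousAt
    have := (hc.continuousAt (x := 0)).mul hz
    have h2 := this.tendsto.mono_left (nhdsWithin_le_nhds (s := Ioi 0))
    simp only [Pi.mul_apply, ofReal_zero, mul_zero, add_zero] at h2
    exact h2

theorem not_symMellin_const {k : ℤ} (hk : Even k) {s c : ℂ} (hσ : 0 ≤ (centred k s).re)
    (hc : k ≠ 0 → c = 0) : ¬ ∀ w ∈ halfPlane, symMellin k 0 s w = c := by
  intro h
  set σ := centred k s with hσd
  -- The point `w ε` tends from the right to the pole `s + k₊` of the Mellin transform as `ε`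
  -- decreases to `0`.
  set w : ℝ → ℂ := fun ε => σ + (k.natAbs + 1) / 2 + ε with hw
  have hs : s + k.toNat = σ + (k.natAbs + 1) / 2 := by
    rw [hσd, centred, natAbs_eq_toNat_add k, cast_eq_toNat_sub k]
    ring
  have hK : (0 : ℝ) ≤ k.natAbs := Nat.cast_nonneg _
  have hwre : ∀ ε, (w ε).re = σ.re + (k.natAbs + 1) / 2 + ε := by
    intro ε
    have : ((k.natAbs : ℂ) + 1) / 2 = (((k.natAbs + 1) / 2 : ℝ) : ℂ) := by push_cast; rfl
    simp only [hw, this, add_re, ofReal_re]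
  obtain ⟨B, hB⟩ := exists_norm_integral_axisSum_le hk hc h (σ.re + (k.natAbs + 1) / 2 + 1)
  obtain ⟨L, hL, hζ⟩ := exists_tendsto_mul_zeta hσ
  have hw0 : 0 < (w 0).re := by rw [hwre]; linarith
  set H : ℝ → ℂ := fun ε => ((Real.pi : ℝ) : ℂ) ^ (-w ε) * Complex.Gamma (w ε) with hH
  have hwc : Continuous w := by fun_prop
  have hHc : ContinuousAt H 0 := by
    refine ContinuousAt.mul ?_ ?_
    · exact ContinuousAt.const_cpow hwc.neg.continuousAt
        (Or.inl (ofReal_ne_zero.2 Real.pi_ne_zero))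
    · refine ContinuousAt.comp (f := w) ?_ hwc.continuousAt
      refine (differentiableAt_Gamma _ fun m hm => ?_).continuousAt
      have := congrArg re hm
      simp only [neg_re, natCast_re] at this
      linarith [Nat.cast_nonneg (α := ℝ) m]
  have hH0 : H 0 ≠ 0 := mul_ne_zero
    (by simp [cpow_eq_zero_iff, Real.pi_ne_zero]) (Gamma_ne_zero_of_re_pos hw0)
  have hlim := hζ.mul (hHc.tendsto.mono_left (nhdsWithin_le_nhds (s := Ioi 0)))
  have hzero : Tendsto (fun ε : ℝ => (2 * σ + 2 * ε) * riemannZeta (1 + (2 * σ + 2 * ε)) * H ε)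
      (𝓝[>] 0) (𝓝 0) := by
    have hg : Tendsto (fun ε : ℝ => ‖(ε : ℂ) * (2 * σ + ε)‖ * B) (𝓝[>] 0) (𝓝 0) := by
      have : Continuous fun ε : ℝ => ‖(ε : ℂ) * (2 * σ + ε)‖ * B := by fun_prop
      have := (this.tendsto 0).mono_left (nhdsWithin_le_nhds (s := Ioi 0))
      simpa using this
    refine squeeze_zero_norm' ?_ hg
    filter_upwards [Ioc_mem_nhdsGT one_pos] with ε hε
    have hε0 : 0 < ε := hε.1
    have hsre : (s + k.toNat).re = σ.re + (k.natAbs + 1) / 2 := by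
      have := hwre 0
      simp only [hw, ofReal_zero, add_zero] at this
      rw [hs, this]
    have h2w : w ε + s + k.toNat = w ε + (s + k.toNat) := by ring
    have hI := integral_axisSum (k := k) (s := s) (w := w ε) (by rw [hsre, hwre]; linarith)
      (by rw [h2w, add_re, hsre, hwre]; linarith) (by rw [hwre]; linarith)
    have hb := hB (w ε) (by rw [hwre]; linarith) (by rw [hwre]; linarith [hε.2])
    have e1 : w ε - (s + k.toNat) = ε := by rw [hs]; simp only [hw]; ring
    have e2 : w ε + s + k.toNat - k.natAbs - 1 = 2 * σ + ε := by
      rw [h2w, hs]; simp only [hw]; ring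
    have e3 : 2 * w ε - k.natAbs = 1 + (2 * σ + 2 * ε) := by simp only [hw]; ring
    have hne : (ε : ℂ) ≠ 0 := ofReal_ne_zero.2 hε0.ne'
    have hne2 : 2 * σ + ε ≠ 0 := fun h0 => by
      have := congrArg re h0
      simp at this
      linarith
    -- The identity `1/ε + 1/(2σ + ε) = (2σ + 2ε)/(ε(2σ + ε))` treats the simple pole and, at `σ =
    -- 0`, the coinciding poles at once. A bounded integral forces the product to tend to zero.
    have key : (2 * σ + 2 * ε) * riemannZeta (1 + (2 * σ + 2 * ε)) * H ε = (ε * (2 * σ + ε)) *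
        ∫ y in Ioi (0 : ℝ), (y : ℂ) ^ (-w ε - 1) • axisSum k s y := by
      rw [hI, e1, e2, e3]
      simp only [hH]
      field_simp
      ring
    rw [key, norm_mul]
    gcongr
  exact mul_ne_zero hL hH0 (tendsto_nhds_unique hlim hzero)

theorem not_symMellin_const' {k : ℤ} (hk : Even k) (s : ℂ) {c : ℂ} (hc : k ≠ 0 → c = 0) :
    ¬ ∀ w ∈ halfPlane, symMellin k 0 s w = c := by
  rcases le_total 0 (centred k s).re with h | h
  · exact not_symMellin_const hk h hc
  · refine fun hs => not_symMellin_const (s := 1 - k - s) hk ?_ hc fun w hw => ?_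
    · rw [centred_one_sub, neg_re]
      linarith
    · rw [symMellin_one_sub, pow_zero, one_mul, hs w hw]

theorem scale_ne_zero (k : ℤ) : scale k ≠ 0 :=
  div_ne_zero (by simp [cpow_eq_zero_iff, Real.pi_ne_zero]) two_ne_zero

/-- Vanishing would make `symMellin k 0 s` constant when `σ² ≠ 1/4`; when `σ² = 1/4`, weight 0
leaves the constant `1/2`. -/
theorem coeffFun_zero_ne_zero {k : ℤ} (hk : Even k) {s : ℂ}
    (h : centred k s ^ 2 ≠ 1 / 4 ∨ k = 0) : coeffFun k 0 s ≠ 0 := by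
  intro h0
  have h1 : ∀ w ∈ halfPlane,
      constTerm k / 2 + scale k * ((centred k s ^ 2 - 1 / 4) * symMellin k 0 s w) = 0 := by
    intro w hw
    have : completedDeriv k 0 s w = 0 := congrFun (congrArg Subtype.val h0) ⟨w, hw⟩
    simpa [completedDeriv] using this
  by_cases h2 : centred k s ^ 2 = 1 / 4
  · have := h1 I (by simp [halfPlane])
    rw [h2, sub_self, zero_mul, mul_zero, add_zero, constTerm,
      if_pos (h.resolve_left (not_not.2 h2))] at this
    norm_num at this
  · have h3 := sub_ne_zero.2 h2
    have h4 := scale_ne_zero k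
    refine not_symMellin_const' hk s
      (c := -(constTerm k / 2) / (scale k * (centred k s ^ 2 - 1 / 4)))
      (fun hk0 => by simp [constTerm, hk0]) fun w hw => ?_
    rw [eq_div_iff (mul_ne_zero h4 h3)]
    linear_combination h1 w hw

theorem coeffFun_zero_eq_zero {k : ℤ} (hk0 : k ≠ 0) {s : ℂ} (h : centred k s ^ 2 = 1 / 4) :
    coeffFun k 0 s = 0 := by
  ext z
  change completedDeriv k 0 s z = 0
  simp [completedDeriv, constTerm, hk0, h]

/-- At a zero of `σ² - 1/4` only the term with its derivative `2σ = ±1` survives. -/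
theorem coeffFun_one_ne_zero {k : ℤ} (hk : Even k) {s : ℂ}
    (h : centred k s ^ 2 = 1 / 4) : coeffFun k 1 s ≠ 0 := by
  intro h0
  have hc : centred k s ≠ 0 := fun hc => by norm_num [hc] at h
  refine not_symMellin_const' hk s (c := 0) (fun _ => rfl) fun w hw => ?_
  have h1 : completedDeriv k 1 s w = 0 := congrFun (congrArg Subtype.val h0) ⟨w, hw⟩
  simpa [completedDeriv, h, scale_ne_zero k, hc] using h1

/-! ### Jordan chains -/

section Chain

variable {M : Type*} [AddCommGroup M] [Module ℂ M] {D : Module.End ℂ M} {g : ℕ → M}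

theorem pow_apply_chain {c d : ℕ → ℂ} (h0 : D (g 0) = 0)
    (h : ∀ n, D (g (n + 1)) = c n • g n + d n • g (n - 1)) (hd : d 0 = 0) (n : ℕ) :
    (D ^ n) (g n) = (∏ i ∈ Finset.range n, c i) • g 0 ∧ (D ^ (n + 1)) (g n) = 0 := by
  have key : ∀ n, (D ^ n) (g n) = (∏ i ∈ Finset.range n, c i) • g 0 →
      (D ^ (n + 1)) (g n) = 0 := fun n hn => by
    rw [pow_succ', Module.End.mul_apply, hn, map_smul, h0, smul_zero]
  suffices h1 : (D ^ n) (g n) = (∏ i ∈ Finset.range n, c i) • g 0 from ⟨h1, key n h1⟩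
  induction n using Nat.strong_induction_on with
  | _ n ih =>
    rcases n with _ | n
    · simp
    -- At `n = 0` the index `n - 1` is truncated to `0`; the condition `d 0 = 0` discards this
    -- spurious term.
    have h2 : d n • (D ^ n) (g (n - 1)) = 0 := by
      rcases n with _ | n
      · simp [hd]
      · rw [Nat.add_sub_cancel, key n (ih n (by omega)), smul_zero]
    rw [pow_succ, Module.End.mul_apply, h, map_add, map_smul, map_smul, ih n n.lt_succ_self, h2,
      add_zero, smul_smul, Finset.prod_range_succ, mul_comm]

theorem pow_apply_chain_eq_zero_iff {c d : ℕ → ℂ} (hg : g 0 ≠ 0) (hc : ∀ n, c n ≠ 0)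
    (h0 : D (g 0) = 0) (h : ∀ n, D (g (n + 1)) = c n • g n + d n • g (n - 1)) (hd : d 0 = 0)
    (m n : ℕ) : (D ^ m) (g n) = 0 ↔ n < m := by
  have hp := pow_apply_chain h0 h hd n
  constructor
  · intro hm
    by_contra! hn
    obtain ⟨j, rfl⟩ := Nat.exists_eq_add_of_le hn
    rw [add_comm m j, pow_add, Module.End.mul_apply, add_comm j m, hm, map_zero] at hp
    exact smul_ne_zero (Finset.prod_ne_zero_iff.2 fun i _ => hc i) hg hp.1.symm
  · intro hm
    obtain ⟨j, rfl⟩ := Nat.exists_eq_add_of_le hm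
    rw [add_comm, pow_add, Module.End.mul_apply, hp.2, map_zero]

/-- The first `m` vectors lie in the kernel of `D ^ m`, and the next one does not. -/
theorem linearIndependent_chain (h : ∀ m n, (D ^ m) (g n) = 0 ↔ n < m) (m : ℕ) :
    LinearIndependent ℂ fun n : Fin m => g n := by
  induction m with
  | zero => exact linearIndependent_empty_type
  | succ m ih =>
    refine linearIndependent_finSucc'.2 ⟨ih, fun hm => ?_⟩
    have hle : Submodule.span ℂ (range (Fin.init fun n : Fin (m + 1) => g n)) ≤
        LinearMap.ker (D ^ m) := by
      refine Submodule.span_le.2 ?_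
      rintro _ ⟨i, rfl⟩
      exact (h m i).2 i.2
    exact lt_irrefl m ((h m m).1 (hle hm))

end Chain

/-! ### The Eisenstein spaces -/

theorem mul_add_sub_eq (k : ℤ) (s : ℂ) :
    s * (s + k - 1) = centred k s ^ 2 - ((1 - k) / 2 : ℂ) ^ 2 := by
  rw [centred]; ring

theorem mul_add_sub_eq_iff (k : ℤ) (s t : ℂ) :
    t * (t + k - 1) = s * (s + k - 1) ↔ t = s ∨ t = 1 - k - s := by
  rw [← sub_eq_zero, show t * (t + k - 1) - s * (s + k - 1) = (t - s) * (t - (1 - k - s)) by ring,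
    mul_eq_zero, sub_eq_zero, sub_eq_zero]

theorem exists_mul_add_sub_eq (k : ℤ) (lam : ℂ) : ∃ s : ℂ, s * (s + k - 1) = lam := by
  obtain ⟨r, hr⟩ := IsAlgClosed.exists_pow_nat_eq (lam + ((1 - k) / 2 : ℂ) ^ 2) two_pos
  refine ⟨r + (1 - k) / 2, ?_⟩
  linear_combination hr

/-- The only other solution is `1 - k - s`, where the functional equation gives the same functions
up to sign. -/
theorem eisensteinSpaceAt_eq {k : ℤ} (hk : Even k) (m : ℕ) (s : ℂ) :
    eisensteinSpaceAt k m s = eisensteinSpace k m (s * (s + k - 1)) := by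
  refine le_antisymm (Submodule.span_mono ?_) (Submodule.span_le.2 ?_)
  · rintro f ⟨⟨n, rfl⟩, h⟩
    exact ⟨⟨s, n, rfl, rfl⟩, h⟩
  · rintro f ⟨⟨t, n, ht, rfl⟩, h⟩
    rcases (mul_add_sub_eq_iff k s t).1 ht with rfl | rfl
    · exact Submodule.subset_span ⟨⟨n, rfl⟩, h⟩
    · rw [← coe_coeffFun hk, coeffFun_mem_polyharmonicForms_iff, coeffFun_one_sub, map_smul,
        smul_eq_zero_iff_right (by simp), ← coeffFun_mem_polyharmonicForms_iff, coe_coeffFun hk] at h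
      rw [← coe_coeffFun hk, coeffFun_one_sub, Submodule.coe_smul, coe_coeffFun hk]
      exact Submodule.smul_mem _ _ (Submodule.subset_span ⟨⟨n, rfl⟩, h⟩)

/-- `g` enumerates the nonzero Taylor coefficient functions at `s` as a Jordan chain. -/
structure IsEisensteinChain (k : ℤ) (s : ℂ) (g : ℕ → smoothFunctions) : Prop where
  eq_coeffFun : ∀ j, ∃ n, g j = coeffFun k n s
  coeffFun_eq : ∀ n, coeffFun k n s = 0 ∨ ∃ j, coeffFun k n s = g j
  pow_eq_zero_iff : ∀ m j, (shiftedLaplacianLin k (s * (s + k - 1)) ^ m) (g j) = 0 ↔ j < m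

theorem IsEisensteinChain.isBasisOf {k : ℤ} (hk : Even k) {s : ℂ} {g : ℕ → smoothFunctions}
    (h : IsEisensteinChain k s g) (m : ℕ) :
    IsBasisOf (fun n : Fin m => (g n : ℍ → ℂ)) (eisensteinSpace k m (s * (s + k - 1))) := by
  refine ⟨(linearIndependent_chain h.pow_eq_zero_iff m).map' smoothFunctions.subtype
    (Submodule.ker_subtype _), ?_⟩
  rw [← eisensteinSpaceAt_eq hk]
  refine le_antisymm (Submodule.span_le.2 ?_) (Submodule.span_le.2 ?_)
  · rintro _ ⟨j, rfl⟩
    obtain ⟨n, hn⟩ := h.eq_coeffFun j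
    refine Submodule.subset_span ⟨⟨n, by simp only [hn, coe_coeffFun hk]⟩, ?_⟩
    have := (h.pow_eq_zero_iff m j).2 j.2
    rw [hn] at this
    simp only [hn]
    exact (coeffFun_mem_polyharmonicForms_iff k n m s _).2 this
  · rintro f ⟨⟨n, rfl⟩, hf⟩
    rw [← coe_coeffFun hk, coeffFun_mem_polyharmonicForms_iff] at hf
    rw [← coe_coeffFun hk]
    rcases h.coeffFun_eq n with h0 | ⟨j, hj⟩
    · rw [h0]; exact zero_mem _
    · rw [hj] at hf ⊢
      exact Submodule.subset_span ⟨⟨j, (h.pow_eq_zero_iff m j).1 hf⟩, rfl⟩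

theorem isEisensteinChain_coeffFun {k : ℤ} (hk : Even k) {s : ℂ} (hs : centred k s ≠ 0)
    (h0 : coeffFun k 0 s ≠ 0) : IsEisensteinChain k s fun n => coeffFun k n s where
  eq_coeffFun j := ⟨j, rfl⟩
  coeffFun_eq n := Or.inr ⟨n, rfl⟩
  pow_eq_zero_iff := pow_apply_chain_eq_zero_iff (c := fun n => 2 * (n + 1) * centred k s)
    (d := fun n => (n + 1) * n) h0
    (fun n => mul_ne_zero (mul_ne_zero two_ne_zero n.cast_add_one_ne_zero) hs)
    (by simp [shiftedLaplacianLin_coeffFun hk])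
    (fun n => by
      rw [shiftedLaplacianLin_coeffFun hk, Nat.add_sub_cancel, show n + 1 - 2 = n - 1 by omega]
      push_cast
      rw [add_sub_cancel_right])
    (by simp)

theorem isEisensteinChain_coeffFun_add_one {k : ℤ} (hk : Even k) {s : ℂ} (hs : centred k s ≠ 0)
    (h0 : coeffFun k 0 s = 0) (h1 : coeffFun k 1 s ≠ 0) :
    IsEisensteinChain k s fun n => coeffFun k (n + 1) s where
  eq_coeffFun j := ⟨j + 1, rfl⟩
  coeffFun_eq n := by
    rcases n with _ | n
    · exact Or.inl h0
    · exact Or.inr ⟨n, rfl⟩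
  pow_eq_zero_iff := pow_apply_chain_eq_zero_iff (c := fun n => 2 * (n + 2) * centred k s)
    -- At `n = 0` the second term of the recursion is a multiple of `coeffFun k 0 s = 0`, whereas
    -- the truncated index of the chain would point to `coeffFun k 1 s`.
    (d := fun n => if n = 0 then 0 else (n + 2) * (n + 1)) h1
    (fun n => mul_ne_zero (mul_ne_zero two_ne_zero (by exact_mod_cast (n + 1).succ_ne_zero)) hs)
    (by simp [shiftedLaplacianLin_coeffFun hk, h0])
    (fun n => by
      rw [shiftedLaplacianLin_coeffFun hk, Nat.add_sub_cancel, Nat.add_sub_cancel (n := n) (m := 2)]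
      rcases n with _ | n
      · simp [h0]
      · push_cast
        congr 2 <;> ring)
    (by simp)

theorem isEisensteinChain_coeffFun_two_mul {k : ℤ} (hk : Even k) {s : ℂ} (hs : centred k s = 0) :
    IsEisensteinChain k s fun n => coeffFun k (2 * n) s where
  eq_coeffFun j := ⟨2 * j, rfl⟩
  coeffFun_eq n := by
    rcases n.even_or_odd' with ⟨j, rfl | rfl⟩
    · exact Or.inr ⟨j, rfl⟩
    · left
      -- At the fixed point of the functional equation the odd derivatives equal their negatives.
      have h1 : 1 - k - s = s := by
        rw [centred] at hs
        linear_combination -2 * hs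
      have h2 := coeffFun_one_sub k (2 * j + 1) s
      rw [h1, Odd.neg_one_pow ⟨j, rfl⟩] at h2
      ext z
      have h3 : completedDeriv k (2 * j + 1) s z = -1 * completedDeriv k (2 * j + 1) s z :=
        congrFun (congrArg Subtype.val h2) z
      exact self_eq_neg.1 (h3.trans (neg_one_mul _))
  pow_eq_zero_iff := pow_apply_chain_eq_zero_iff (c := fun n => (2 * n + 2) * (2 * n + 1))
    (d := fun n => 0) (coeffFun_zero_ne_zero hk (Or.inl (by norm_num [hs])))
    (fun n => by exact_mod_cast (mul_pos (2 * n + 1).succ_pos (2 * n).succ_pos).ne')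
    (by simp [shiftedLaplacianLin_coeffFun hk])
    (fun n => by
      rw [shiftedLaplacianLin_coeffFun hk, hs, show 2 * (n + 1) - 2 = 2 * n by omega]
      push_cast
      simp only [mul_zero, zero_smul, zero_add, add_zero]
      congr 1
      ring)
    rfl

theorem exists_isEisensteinChain {k : ℤ} (hk : Even k) (s : ℂ) : ∃ g, IsEisensteinChain k s g := by
  by_cases hs : centred k s = 0
  · exact ⟨_, isEisensteinChain_coeffFun_two_mul hk hs⟩
  · by_cases h : centred k s ^ 2 = 1 / 4 ∧ k ≠ 0
    · exact ⟨_, isEisensteinChain_coeffFun_add_one hk hs (coeffFun_zero_eq_zero h.2 h.1)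
        (coeffFun_one_ne_zero hk h.1)⟩
    · exact ⟨_, isEisensteinChain_coeffFun hk hs
        (coeffFun_zero_ne_zero hk (by tauto))⟩

theorem rank_eisensteinSpace {k : ℤ} (hk : Even k) (m : ℕ) (lam : ℂ) :
    Module.rank ℂ (eisensteinSpace k m lam) = (m : Cardinal) := by
  obtain ⟨s, rfl⟩ := exists_mul_add_sub_eq k lam
  obtain ⟨g, hg⟩ := exists_isEisensteinChain hk s
  obtain ⟨h1, h2⟩ := hg.isBasisOf hk m
  rw [← h2, rank_span h1, Cardinal.mk_range_eq _ h1.injective, Cardinal.mk_fin]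

end MaassEisenstein

end

theorem mainTheorem4 (k : ℤ) (hk : Even k) (m : ℕ) (lam : ℂ) :
    -- the doubly-completed series continues to an entire function of `s`
    (∀ z : UpperHalfPlane, IsEntireContinuation k z (doublyCompletedEisenstein k z)) ∧
    -- the dimension, and independence of the space from the choice of `s₀`
    Module.rank ℂ (eisensteinSpace k m lam) = (m : Cardinal) ∧
    (∀ s₀ : ℂ, s₀ * (s₀ + (k : ℂ) - 1) = lam →
      eisensteinSpaceAt k m s₀ = eisensteinSpace k m lam) ∧
    -- the generic case
    (lam ≠ (k : ℂ) / 2 * (1 - (k : ℂ) / 2) → lam ≠ -((1 - (k : ℂ)) / 2) ^ 2 →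
      {s₀ : ℂ | s₀ * (s₀ + (k : ℂ) - 1) = lam}.ncard = 2 ∧
      ∀ s₀ : ℂ, s₀ * (s₀ + (k : ℂ) - 1) = lam →
        taylorCoeff k 0 s₀ ≠ 0 ∧
        IsBasisOf (fun n : Fin m => taylorCoeff k (n : ℕ) s₀) (eisensteinSpace k m lam)) ∧
    -- the case `lam = (k/2) (1 - k/2)`
    (lam = (k : ℂ) / 2 * (1 - (k : ℂ) / 2) →
      {s₀ : ℂ | s₀ * (s₀ + (k : ℂ) - 1) = lam} = {-((k : ℂ) / 2), 1 - (k : ℂ) / 2} ∧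
      ∀ s₀ : ℂ, s₀ * (s₀ + (k : ℂ) - 1) = lam →
        (k ≠ 0 →
          taylorCoeff k 0 s₀ = 0 ∧
          IsBasisOf (fun n : Fin m => taylorCoeff k ((n : ℕ) + 1) s₀)
            (eisensteinSpace k m lam)) ∧
        (k = 0 →
          taylorCoeff k 0 s₀ ≠ 0 ∧
          IsBasisOf (fun n : Fin m => taylorCoeff k (n : ℕ) s₀) (eisensteinSpace k m lam))) ∧
    -- the case `lam = -((1 - k)/2)²`
    (lam = -((1 - (k : ℂ)) / 2) ^ 2 →
      {s₀ : ℂ | s₀ * (s₀ + (k : ℂ) - 1) = lam} = {(1 - (k : ℂ)) / 2} ∧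
      IsBasisOf (fun n : Fin m => taylorCoeff k (2 * (n : ℕ)) ((1 - (k : ℂ)) / 2))
        (eisensteinSpace k m lam)) := by
  have hsol : ∀ s : ℂ, {s₀ : ℂ | s₀ * (s₀ + (k : ℂ) - 1) = s * (s + k - 1)} = {s, 1 - k - s} :=
    fun s => Set.ext fun t => MaassEisenstein.mul_add_sub_eq_iff k s t
  refine ⟨fun z => ?_, MaassEisenstein.rank_eisensteinSpace hk m lam, ?_, ?_, ?_, ?_⟩
  · have h := MaassEisenstein.isEntireContinuation_completedDeriv hk z
    rwa [h.eq_doublyCompletedEisenstein]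
  · rintro s rfl
    exact MaassEisenstein.eisensteinSpaceAt_eq hk m s
  · intro h1 h2
    -- Since `λ = σ² - ((1 - k)/2)²`, the two excluded eigenvalues correspond to `σ² = 1/4` and `σ =
    -- 0`.
    have hσ : ∀ s : ℂ, s * (s + k - 1) = lam →
        MaassEisenstein.centred k s ^ 2 ≠ 1 / 4 ∧ MaassEisenstein.centred k s ≠ 0 := by
      rintro s rfl
      rw [MaassEisenstein.mul_add_sub_eq] at h1 h2
      exact ⟨fun h => h1 (by rw [h]; ring), fun h => h2 (by rw [h]; ring)⟩
    constructor
    · obtain ⟨s, rfl⟩ := MaassEisenstein.exists_mul_add_sub_eq k lam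
      rw [hsol s]
      -- The two solutions coincide only at the centre `σ = 0`.
      refine Set.ncard_pair fun h => (hσ s rfl).2 ?_
      rw [MaassEisenstein.centred]
      linear_combination h / 2
    · rintro s rfl
      have h0 := MaassEisenstein.coeffFun_zero_ne_zero hk (Or.inl (hσ s rfl).1)
      have h := (MaassEisenstein.isEisensteinChain_coeffFun hk (hσ s rfl).2 h0).isBasisOf hk m
      simp only [MaassEisenstein.coe_coeffFun hk] at h
      refine ⟨?_, h⟩
      rwa [← MaassEisenstein.coe_coeffFun hk, Ne, ZeroMemClass.coe_eq_zero]
  · intro h1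
    have hσ : ∀ s : ℂ, s * (s + k - 1) = lam → MaassEisenstein.centred k s ^ 2 = 1 / 4 := by
      intro s hs
      rw [h1, MaassEisenstein.mul_add_sub_eq] at hs
      linear_combination hs
    have hσ0 : ∀ s : ℂ, s * (s + k - 1) = lam → MaassEisenstein.centred k s ≠ 0 := by
      intro s hs h
      have := hσ s hs
      norm_num [h] at this
    constructor
    · rw [show lam = -((k : ℂ) / 2) * (-((k : ℂ) / 2) + k - 1) by rw [h1]; ring, hsol]
      congr 2
      ring
    · rintro s rfl
      have h2 := hσ s rfl
      have h3 := hσ0 s rfl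
      refine ⟨fun hk0 => ?_, fun hk0 => ?_⟩
      · have h0 := MaassEisenstein.coeffFun_zero_eq_zero hk0 h2
        have h := (MaassEisenstein.isEisensteinChain_coeffFun_add_one hk h3 h0
          (MaassEisenstein.coeffFun_one_ne_zero hk h2)).isBasisOf hk m
        simp only [MaassEisenstein.coe_coeffFun hk] at h
        refine ⟨?_, h⟩
        rwa [← MaassEisenstein.coe_coeffFun hk, ZeroMemClass.coe_eq_zero]
      · have h0 := MaassEisenstein.coeffFun_zero_ne_zero hk (s := s) (Or.inr hk0)
        have h := (MaassEisenstein.isEisensteinChain_coeffFun hk h3 h0).isBasisOf hk m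
        simp only [MaassEisenstein.coe_coeffFun hk] at h
        refine ⟨?_, h⟩
        rwa [← MaassEisenstein.coe_coeffFun hk, Ne, ZeroMemClass.coe_eq_zero]
  · intro h1
    have hl : lam = (1 - (k : ℂ)) / 2 * ((1 - (k : ℂ)) / 2 + k - 1) := by rw [h1]; ring
    subst hl
    constructor
    · rw [hsol, show 1 - (k : ℂ) - (1 - k) / 2 = (1 - k) / 2 by ring, Set.pair_eq_singleton]
    · have h := (MaassEisenstein.isEisensteinChain_coeffFun_two_mul hk
        (show MaassEisenstein.centred k ((1 - k) / 2) = 0 by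
          rw [MaassEisenstein.centred]; ring)).isBasisOf hk m
      simpa only [MaassEisenstein.coe_coeffFun hk] using h
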